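/- **Notation.** Fix $d\in\mathbb N$. Let $\mathcal T^p$ ($1\le p<\infty$) be the Schatten class of operators on $L^2(\mathbb R^d)$ whose singular values lie in $\ell^p$, let $\mathcal T^\infty=B(L^2(\mathbb R^d))$, and let $K$ be the space of compact operators on $L^2(\mathbb R^d)$. For $z=(x,\omega)\in\mathbb R^{2d}$ let $\pi(z)\psi(t)=e^{2\pi i\omega\cdot t}\psi(t-x)$, $\alpha_z(A)=\pi(z)A\pi(z)^*$, $T_zg(w)=g(w-z)$, and $\check A=PAP$ with $P\psi(t)=\psi(-t)$. For $S\in\mathcal T^1$, $f\in L^p(\mathbb R^{2d})$ and $T\in\mathcal T^p$ put $$f*S=\int_{\mathbb R^{2d}}f(z)\,\alpha_z(S)\,dz,\qquad (T*S)(z)=\operatorname{tr}\bigl(T\,\alpha_z(\check S)\bigr),$$ the first integral being weak: $\langle (f*S)\psi,\phi\rangle=\int f(z)\langle\alpha_z(S)\psi,\phi\rangle\,dz$ for all $\psi,\phi\in L^2(\mathbb R^d)$. For $p<\infty$, a function $g\in L^p(\mathbb R^{2d})$ (an operator $S\in\mathcal T^p$) is *$p$-regular* if its translates $T_zg$ ($\alpha_z(S)$),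 $z\in\mathbb R^{2d}$, span a norm dense subspace of $L^p(\mathbb R^{2d})$ (of $\mathcal T^p$). A function $g\in L^\infty(\mathbb R^{2d})$ is *$\infty$-regular* if its translates span a weak* dense subspace of $L^\infty(\mathbb R^{2d})=(L^1)^*$; a bounded operator $S$ is *$\infty$-regular* if its translates span a norm dense subspace of $K$. *Regular* means $1$-regular. **Theorem.** Let $1\le p\le\infty$ and $\frac1p+\frac1q=1$. Let $S\in\mathcal T^1$. Then $f*S$ is a well-defined bounded operator for every $f\in L^p(\mathbb R^{2d})\cup L^q(\mathbb R^{2d})$, and the following are equivalent: 1. $S$ is $p$-regular. 2. If $f\in L^q(\mathbb R^{2d})$ and $f*S=0$, then $f=0$. 3. $\mathcal T^p*S$ is a dense subset of $L^p(\mathbb R^{2d})$. 4. If $T\in\mathcal T^q$ and $T*S=0$, then $T=0$. 5. $L^p(\mathbb R^{2d})*S$ is a dense subset of $\mathcal T^p$. 6. $S*S$ is $p$-regular. 7. For every regular $T_0\in\mathcal T^1$, $T_0*S$ is $p$-regular. In (3) and (5) density is with respect to the norm if $p<\infty$, and weak* density (with respect to the preduals $L^1(\mathbb R^{2d})$ and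 $\mathcal T^1$) if $p=\infty$. If $p=\infty$, these statements are also equivalent to each of the following: - (i) $K*S$ is a dense subset of $C_0(\mathbb R^{2d})$ in the supremum norm. - (ii) $C_0(\mathbb R^{2d})*S$ is a dense subset of $K$ in the operator norm. Finally, for every $1\le p\le\infty$ there exists a $p$-regular operator $S_0\in\mathcal T^1$. -/

import Mathlib

open MeasureTheory
open scoped ENNReal ZeroAtInfty

noncomputable section

namespace QHA

section Schatten

variable {E : Type*} [NormedAddCommGroup E] [InnerProductSpace ℂ E]

/-- The `n`-th singular value (`n = 0, 1, 2, …`) of a bounded operator: its distance, in operator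
norm, to the operators of rank at most `n`. For a compact operator `T` this is the `(n+1)`-st
largest eigenvalue of `|T|`, counted with multiplicity; the sequence tends to `0` only if `T` is
compact. -/
def singularValue (T : E →L[ℂ] E) (n : ℕ) : ℝ :=
  ⨅ F : {F : E →L[ℂ] E // LinearMap.rank (F : E →ₗ[ℂ] E) ≤ (n : Cardinal)}, ‖T - F.1‖

/-- The Schatten `p`-norm, i.e. the `ℓ^p`-norm of the sequence of singular values, with value `∞`
outside the Schatten class. For `p = ∞` it is the operator norm. -/
def schattenNorm (p : ℝ≥0∞) (T : E →L[ℂ] E) : ℝ≥0∞ :=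
  eLpNorm (singularValue T) p Measure.count

/-- Membership in the Schatten class `𝒯^p`; `𝒯^1` is the trace class, and `𝒯^∞` consists of all
bounded operators. -/
def MemSchatten (p : ℝ≥0∞) (T : E →L[ℂ] E) : Prop :=
  schattenNorm p T < ∞

variable [CompleteSpace E]

/-- The trace `∑ ⟨T e, e⟩`, the sum running over an orthonormal basis of the Hilbert space. -/
def trace (T : E →L[ℂ] E) : ℂ :=
  ∑' e : (exists_hilbertBasis ℂ E).choose, inner ℂ (e : E) (T (e : E))

/-- `D` is a dense subset of `𝒯^p`: in the Schatten norm if `p < ∞`, and in the weak-* topology of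
the bounded operators as the dual of the trace class operators if `p = ∞`. -/
def SchattenDense (p : ℝ≥0∞) (D : Set (E →L[ℂ] E)) : Prop :=
  (∀ A ∈ D, MemSchatten p A) ∧
    if p = ∞ then
      ∀ (A : E →L[ℂ] E) (F : Finset (E →L[ℂ] E)), (∀ T ∈ F, MemSchatten 1 T) →
        ∀ ε : ℝ, 0 < ε → ∃ B ∈ D, ∀ T ∈ F, ‖trace ((A - B) ∘L T)‖ < ε
    else
      ∀ A : E →L[ℂ] E, MemSchatten p A →
        ∀ ε : ℝ≥0∞, 0 < ε → ∃ B ∈ D, schattenNorm p (A - B) < ε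

/-- `D` is a subset of the compact operators, dense there in the operator norm. -/
def CompactDense (D : Set (E →L[ℂ] E)) : Prop :=
  D ⊆ {A | IsCompactOperator A} ∧ {A : E →L[ℂ] E | IsCompactOperator A} ⊆ closure D

end Schatten

/-- Phase space `ℝ^{2d}`, with points `z = (x, ω)`. -/
abbrev PhaseSpace (d : ℕ) : Type := EuclideanSpace ℝ (Fin d) × EuclideanSpace ℝ (Fin d)

/-- The Hilbert space `L²(ℝ^d)`. -/
abbrev L2 (d : ℕ) : Type := Lp ℂ 2 (volume : Measure (EuclideanSpace ℝ (Fin d)))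

section Shifts

variable {d : ℕ}

/-- The translation `(T_x ψ)(t) = ψ(t - x)`. -/
def translationOp (x : EuclideanSpace ℝ (Fin d)) : L2 d →L[ℂ] L2 d :=
  (Lp.compMeasurePreservingₗᵢ ℂ (fun t : EuclideanSpace ℝ (Fin d) => t - x)
    (measurePreserving_sub_right volume x)).toContinuousLinearMap

/-- The parity operator `(P ψ)(t) = ψ(-t)`. -/
def parityOp (d : ℕ) : L2 d →L[ℂ] L2 d :=
  (Lp.compMeasurePreservingₗᵢ ℂ (fun t : EuclideanSpace ℝ (Fin d) => -t)
    (Measure.measurePreserving_neg volume)).toContinuousLinearMap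

/-- The character `t ↦ e^{2πi ω·t}`. -/
def character (ω t : EuclideanSpace ℝ (Fin d)) : ℂ :=
  Complex.exp (2 * Real.pi * Complex.I * (inner ℝ ω t : ℝ))

theorem norm_character (ω t : EuclideanSpace ℝ (Fin d)) : ‖character ω t‖ = 1 := by
  rw [character, Complex.norm_exp]
  simp

theorem continuous_character (ω : EuclideanSpace ℝ (Fin d)) : Continuous (character ω) := by
  unfold character
  fun_prop

theorem memLp_character_mul (ω : EuclideanSpace ℝ (Fin d)) (ψ : L2 d) :
    MemLp (fun t => character ω t * ψ t) 2 volume := by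
  refine (Lp.memLp ψ).of_le
    ((continuous_character ω).aestronglyMeasurable.mul (Lp.aestronglyMeasurable ψ)) ?_
  filter_upwards with t
  rw [norm_mul, norm_character, one_mul]

/-- The modulation `(M_ω ψ)(t) = e^{2πi ω·t} ψ(t)`. -/
def modulationOp (ω : EuclideanSpace ℝ (Fin d)) : L2 d →L[ℂ] L2 d :=
  LinearMap.mkContinuous
    { toFun := fun ψ => (memLp_character_mul ω ψ).toLp _
      map_add' := by
        intro ψ φ
        apply Lp.ext
        filter_upwards [MemLp.coeFn_toLp (memLp_character_mul ω (ψ + φ)),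
          MemLp.coeFn_toLp (memLp_character_mul ω ψ), MemLp.coeFn_toLp (memLp_character_mul ω φ),
          Lp.coeFn_add ψ φ,
          Lp.coeFn_add ((memLp_character_mul ω ψ).toLp _) ((memLp_character_mul ω φ).toLp _)]
          with t h1 h2 h3 h4 h5
        rw [h1, h5, h4, Pi.add_apply, Pi.add_apply, h2, h3, mul_add]
      map_smul' := by
        intro c ψ
        apply Lp.ext
        filter_upwards [MemLp.coeFn_toLp (memLp_character_mul ω (c • ψ)),
          MemLp.coeFn_toLp (memLp_character_mul ω ψ), Lp.coeFn_smul c ψ,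
          Lp.coeFn_smul c ((memLp_character_mul ω ψ).toLp _)]
          with t h1 h2 h3 h4
        simp only [RingHom.id_apply]
        rw [h1, h4, h3, Pi.smul_apply, Pi.smul_apply, h2, smul_eq_mul, smul_eq_mul]
        ring }
    1 (by
      intro ψ
      rw [one_mul]
      refine Lp.norm_le_norm_of_ae_le ?_
      filter_upwards [MemLp.coeFn_toLp (memLp_character_mul ω ψ)] with t h1
      simp only [LinearMap.coe_mk, AddHom.coe_mk]
      rw [h1, norm_mul, norm_character, one_mul])

/-- The time-frequency shift `π(z) = M_ω T_x` for `z = (x, ω)`. -/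
def timeFreqShift (z : PhaseSpace d) : L2 d →L[ℂ] L2 d :=
  modulationOp z.2 ∘L translationOp z.1

/-- The translation of operators `α_z(A) = π(z) A π(z)^*`. -/
def opShift (z : PhaseSpace d) (A : L2 d →L[ℂ] L2 d) : L2 d →L[ℂ] L2 d :=
  timeFreqShift z ∘L A ∘L (timeFreqShift z).adjoint

/-- The operator `P A P`. -/
def opCheck (A : L2 d →L[ℂ] L2 d) : L2 d →L[ℂ] L2 d :=
  parityOp d ∘L A ∘L parityOp d

end Shifts

section Convolutions

variable {d : ℕ}

/-- `A` is the weak integral `∫ F(z) dz` of an operator-valued function on phase space. -/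
def IsWeakIntegral (F : PhaseSpace d → L2 d →L[ℂ] L2 d) (A : L2 d →L[ℂ] L2 d) : Prop :=
  ∀ ψ φ : L2 d, Integrable (fun z => inner ℂ φ (F z ψ)) volume ∧
    inner ℂ φ (A ψ) = ∫ z, inner ℂ φ (F z ψ)

theorem IsWeakIntegral.unique {F : PhaseSpace d → L2 d →L[ℂ] L2 d} {A B : L2 d →L[ℂ] L2 d}
    (hA : IsWeakIntegral F A) (hB : IsWeakIntegral F B) : A = B :=
  ContinuousLinearMap.ext fun ψ => ext_inner_left ℂ fun φ =>
    (hA ψ φ).2.trans (hB ψ φ).2.symm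

open Classical in
/-- The convolution `f ∗ S = ∫ f(z) α_z(S) dz` of a function and an operator, the integral being
the weak one (and `0` by convention if there is no such operator). -/
def funConv (f : PhaseSpace d → ℂ) (S : L2 d →L[ℂ] L2 d) : L2 d →L[ℂ] L2 d :=
  if h : ∃ A, IsWeakIntegral (fun z => f z • opShift z S) A then h.choose else 0

/-- The convolution `(T ∗ S)(z) = tr(T α_z(P S P))` of two operators, a function on phase space. -/
def opConv (T S : L2 d →L[ℂ] L2 d) (z : PhaseSpace d) : ℂ :=
  trace (T ∘L opShift z (opCheck S))

end Convolutions

section Density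

variable {d : ℕ}

/-- `D` is a dense subset of `L^p(ℝ^{2d})`: in the norm if `p < ∞`, and in the weak-* topology of
`L^∞` as the dual of `L^1` if `p = ∞`. -/
def LpDense (p : ℝ≥0∞) (D : Set (PhaseSpace d → ℂ)) : Prop :=
  (∀ g ∈ D, MemLp g p volume) ∧
    if p = ∞ then
      ∀ f : PhaseSpace d → ℂ, MemLp f ∞ volume →
        ∀ F : Finset (PhaseSpace d → ℂ), (∀ h ∈ F, MemLp h 1 volume) →
          ∀ ε : ℝ, 0 < ε → ∃ g ∈ D, ∀ h ∈ F, ‖∫ z, (f z - g z) * h z‖ < ε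
    else
      ∀ f : PhaseSpace d → ℂ, MemLp f p volume →
        ∀ ε : ℝ≥0∞, 0 < ε → ∃ g ∈ D, eLpNorm (f - g) p volume < ε

/-- `D` is a subset of `C₀(ℝ^{2d})`, dense there in the supremum norm. -/
def CZeroDense (D : Set (PhaseSpace d → ℂ)) : Prop :=
  (∀ g ∈ D, ∃ u : C₀(PhaseSpace d, ℂ), ⇑u = g) ∧
    Dense {u : C₀(PhaseSpace d, ℂ) | ⇑u ∈ D}

/-- `p`-regularity of a function: the translates `T_z g = g(· - z)` span a dense subspace of
`L^p(ℝ^{2d})` (weak-* dense if `p = ∞`). -/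
def IsRegularFun (p : ℝ≥0∞) (g : PhaseSpace d → ℂ) : Prop :=
  LpDense p (Submodule.span ℂ
    (Set.range fun z : PhaseSpace d => fun w : PhaseSpace d => g (w - z)) :
      Set (PhaseSpace d → ℂ))

/-- `p`-regularity of an operator: the translates `α_z(S)` span a norm dense subspace of `𝒯^p` if
`p < ∞`, and of the compact operators if `p = ∞`. -/
def IsRegularOp (p : ℝ≥0∞) (S : L2 d →L[ℂ] L2 d) : Prop :=
  if p = ∞ then
    CompactDense (Submodule.span ℂ (Set.range fun z : PhaseSpace d => opShift z S) :
      Set (L2 d →L[ℂ] L2 d))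
  else
    SchattenDense p (Submodule.span ℂ (Set.range fun z : PhaseSpace d => opShift z S) :
      Set (L2 d →L[ℂ] L2 d))

end Density

end QHA

end

open MeasureTheory
open scoped ENNReal ZeroAtInfty

noncomputable section

namespace QHA

open InnerProductSpace (rankOne)

/-! ### Schur's test for integral kernels -/

section Schur

variable {X Y : Type*} [MeasurableSpace X] [MeasurableSpace Y] {μ : Measure X} {ν : Measure Y}

/-! Every condition is compared with one statement, `OpInjective q S`: an operator T in 𝒯^q with
tr(T α_z(S)) = 0 for all z must vanish.

On the operator side the equivalences are duality. The trace pairing identifies continuous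
functionals for the p-norm with operators of the dual class (`exists_operator_of_functional`), and
the annihilator of the translates of S, or of the operators f ∗ S with f continuous of compact
support, is the kernel of T ↦ tr(T α_z(S)). Hahn–Banach then gives (1), (5) and (ii), through
`isRegularOp_iff`, `schattenDense_funConv_iff` and `compactDense_funConv_iff`. Condition (4) is the
same statement for PSP in place of S, and conjugation by P makes this harmless.

The function side is linked to it by the rank-one operator G = `gaussOp` of the standard Gaussian,
which plays the part of a function with nowhere vanishing Fourier transform. It has two injectivity
properties. For suitable Gaussians g and h, the function tr((g ⊗ h) α_z(G)) is a nonzero multiple of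
a plane wave times e^{-π|z|²} (`opPair_rankOne_gaussOp`); by Fourier inversion such waves span dense
subspaces, so f ∗ G = 0 forces f = 0. Moreover tr(T α_z(G)) is, up to a nonzero factor, ⟨g_a, T g_a⟩
for Gaussians g_a depending holomorphically on a ∈ ℂ^d; analytic continuation off the diagonal
yields ⟨g_a, T g_b⟩ = 0 for all a, b, hence T = 0 (`eq_zero_of_opPair_gaussOp`). So G is regular for
every exponent, which also settles the existence claim.

Commutativity and associativity of the convolutions transport injectivity. If f ∗ S = 0, then f ∗ G
is killed by convolution with S, so f ∗ G = 0 and f = 0. If T ∗ S = 0, then (T ∗ G) ∗ S = 0, so T ∗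
G = 0 and T = 0. The commutation is checked on translates of G, where it is a change of variables,
and extended by density (`integral_opPair_exchange`). For (3), (6), (7) and (i), a wave is a
multiple of F ∗ G with F of rank one: approximating F by translates of S, using α_w(S) ∗ G = α_w(G)
∗ S, and approximating α_w(G) by translates of T₀ puts it in the closed span of the translates of T₀
∗ S (`phaseWave_mem_lpClosure`).

The analysis rests on replacing the singular-value norm by `pairNorm`, a supremum of ℓ^p-norms of
matrix coefficients over orthonormal systems: `pairNorm` ≤ `schattenNorm` ≤ 4 `pairNorm`. This makes
the triangle inequality immediate, and Young's inequalities become Schur's test for a kernel whose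
marginals are bounded by Bessel's inequality and by Moyal's identity. -/

theorem lintegral_mul_rpow_le {W g : Y → ℝ≥0∞} (hW : AEMeasurable W ν) (hg : AEMeasurable g ν)
    {c : ℝ≥0∞} (hc : ∫⁻ y, W y ∂ν ≤ c) {p : ℝ} (hp : 1 ≤ p) :
    (∫⁻ y, W y * g y ∂ν) ^ p ≤ c ^ (p - 1) * ∫⁻ y, W y * g y ^ p ∂ν := by
  rcases hp.eq_or_lt with rfl | hp1
  · simp
  have hpq : p.HolderConjugate p.conjExponent := Real.HolderConjugate.conjExponent hp1
  set q := p.conjExponent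
  have hp0 : 0 < p := by linarith
  have hq0 : 0 < q := hpq.symm.pos
  have hinv : p⁻¹ + q⁻¹ = 1 := hpq.inv_add_inv_eq_one
  -- Hölder for the splitting W g = (W^{1/p} g) · W^{1/q}.
  have h := ENNReal.lintegral_mul_le_Lp_mul_Lq ν hpq
    (f := fun y => W y ^ p⁻¹ * g y) (g := fun y => W y ^ q⁻¹)
    ((hW.pow_const _).mul hg) (hW.pow_const _)
  have e1 : ∀ y, ((fun y => W y ^ p⁻¹ * g y) * fun y => W y ^ q⁻¹) y = W y * g y := by
    intro y
    have : W y ^ p⁻¹ * W y ^ q⁻¹ = W y := by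
      rw [← ENNReal.rpow_add_of_nonneg _ _ (by positivity) (by positivity), hinv, ENNReal.rpow_one]
    simp only [Pi.mul_apply]
    rw [mul_right_comm, this]
  have e2 : ∀ y, (W y ^ p⁻¹ * g y) ^ p = W y * g y ^ p := by
    intro y
    rw [ENNReal.mul_rpow_of_nonneg _ _ hp0.le, ← ENNReal.rpow_mul, inv_mul_cancel₀ hp0.ne',
      ENNReal.rpow_one]
  have e3 : ∀ y, (W y ^ q⁻¹) ^ q = W y := by
    intro y
    rw [← ENNReal.rpow_mul, inv_mul_cancel₀ hq0.ne', ENNReal.rpow_one]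
  simp only [e1, e2, e3] at h
  calc (∫⁻ y, W y * g y ∂ν) ^ p
      ≤ ((∫⁻ y, W y * g y ^ p ∂ν) ^ (1 / p) * (∫⁻ y, W y ∂ν) ^ (1 / q)) ^ p := by gcongr
    _ = (∫⁻ y, W y * g y ^ p ∂ν) * (∫⁻ y, W y ∂ν) ^ (p - 1) := by
        rw [ENNReal.mul_rpow_of_nonneg _ _ hp0.le, ← ENNReal.rpow_mul, ← ENNReal.rpow_mul,
          one_div_mul_cancel hp0.ne', ENNReal.rpow_one]
        congr 2
        have : q⁻¹ = 1 - p⁻¹ := by linarith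
        rw [one_div, this, sub_mul, inv_mul_cancel₀ hp0.ne', one_mul]
    _ ≤ c ^ (p - 1) * ∫⁻ y, W y * g y ^ p ∂ν := by
        rw [mul_comm]; gcongr

/-- Schur's test. -/
theorem eLpNorm_le_of_kernel [SFinite μ] [SFinite ν] {W : X → Y → ℝ≥0∞}
    (hW : Measurable (Function.uncurry W)) {c : ℝ≥0∞} (h1 : ∀ x, ∫⁻ y, W x y ∂ν ≤ c)
    (h2 : ∀ y, ∫⁻ x, W x y ∂μ ≤ c) {F : X → ℂ} {g : Y → ℂ} (hg : AEStronglyMeasurable g ν)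
    (hF : ∀ x, ‖F x‖ₑ ≤ ∫⁻ y, W x y * ‖g y‖ₑ ∂ν) {p : ℝ≥0∞} (hp : 1 ≤ p) :
    eLpNorm F p μ ≤ c * eLpNorm g p ν := by
  rcases eq_or_ne p ∞ with rfl | hpt
  · rw [eLpNorm_exponent_top, eLpNorm_exponent_top]
    refine essSup_le_of_ae_le _ (Filter.Eventually.of_forall fun x => ?_)
    calc ‖F x‖ₑ ≤ ∫⁻ y, W x y * ‖g y‖ₑ ∂ν := hF x
      _ ≤ ∫⁻ y, W x y * eLpNormEssSup g ν ∂ν := by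
          refine lintegral_mono_ae ?_
          filter_upwards [enorm_ae_le_eLpNormEssSup g ν] with y hy
          gcongr
      _ = (∫⁻ y, W x y ∂ν) * eLpNormEssSup g ν := by
          rw [lintegral_mul_const _ (hW.of_uncurry_left)]
      _ ≤ c * eLpNormEssSup g ν := by gcongr; exact h1 x
  have hp0 : p ≠ 0 := (zero_lt_one.trans_le hp).ne'
  have hp1 : 1 ≤ p.toReal := by
    rw [← ENNReal.toReal_one]; exact ENNReal.toReal_mono hpt hp
  have hpr : 0 < p.toReal := by linarith
  rw [eLpNorm_eq_lintegral_rpow_enorm_toReal hp0 hpt, eLpNorm_eq_lintegral_rpow_enorm_toReal hp0 hpt]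
  have hgm : AEMeasurable (fun y => ‖g y‖ₑ) ν := hg.enorm
  -- The weighted Hölder bound at each x uses one marginal and costs c^{p-1}; after Tonelli the
  -- other marginal supplies the remaining factor c.
  have key : ∫⁻ x, ‖F x‖ₑ ^ p.toReal ∂μ ≤ c ^ p.toReal * ∫⁻ y, ‖g y‖ₑ ^ p.toReal ∂ν := by
    calc ∫⁻ x, ‖F x‖ₑ ^ p.toReal ∂μ
        ≤ ∫⁻ x, c ^ (p.toReal - 1) * ∫⁻ y, W x y * ‖g y‖ₑ ^ p.toReal ∂ν ∂μ := by
          refine lintegral_mono fun x => ?_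
          refine le_trans (ENNReal.rpow_le_rpow (hF x) hpr.le) ?_
          exact lintegral_mul_rpow_le hW.of_uncurry_left.aemeasurable hgm (h1 x) hp1
      _ = c ^ (p.toReal - 1) * ∫⁻ x, ∫⁻ y, W x y * ‖g y‖ₑ ^ p.toReal ∂ν ∂μ := by
          rw [lintegral_const_mul'']
          refine AEMeasurable.lintegral_prod_right' (f := fun z : X × Y =>
            W z.1 z.2 * ‖g z.2‖ₑ ^ p.toReal) ?_
          exact hW.aemeasurable.mul (hgm.comp_snd.pow_const _)
      _ = c ^ (p.toReal - 1) * ∫⁻ y, ∫⁻ x, W x y * ‖g y‖ₑ ^ p.toReal ∂μ ∂ν := by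
          rw [lintegral_lintegral_swap]
          exact hW.aemeasurable.mul (hgm.comp_snd.pow_const _)
      _ ≤ c ^ (p.toReal - 1) * ∫⁻ y, c * ‖g y‖ₑ ^ p.toReal ∂ν := by
          gcongr with y
          rw [lintegral_mul_const _ hW.of_uncurry_right]
          gcongr
          exact h2 y
      _ = c ^ p.toReal * ∫⁻ y, ‖g y‖ₑ ^ p.toReal ∂ν := by
          rw [lintegral_const_mul'' _ (hgm.pow_const _), ← mul_assoc]
          congr 1
          nth_rewrite 2 [← ENNReal.rpow_one c]
          rw [← ENNReal.rpow_add_of_nonneg _ _ (by linarith) zero_le_one, sub_add_cancel]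
  calc (∫⁻ x, ‖F x‖ₑ ^ p.toReal ∂μ) ^ (1 / p.toReal)
      ≤ (c ^ p.toReal * ∫⁻ y, ‖g y‖ₑ ^ p.toReal ∂ν) ^ (1 / p.toReal) := by gcongr
    _ = _ := by
      rw [ENNReal.mul_rpow_of_nonneg _ _ (by positivity), ← ENNReal.rpow_mul,
        mul_one_div_cancel hpr.ne', ENNReal.rpow_one]

end Schur

/-! ### Cauchy–Schwarz and Bessel inequalities -/

section Bessel

variable {E : Type*} [NormedAddCommGroup E] [InnerProductSpace ℂ E]

theorem ennreal_tsum_mul_le_of_sq {ι : Type*} {f g : ι → ℝ≥0∞} {a b : ℝ≥0∞}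
    (hf : ∑' i, f i ^ 2 ≤ a ^ 2) (hg : ∑' i, g i ^ 2 ≤ b ^ 2) : ∑' i, f i * g i ≤ a * b := by
  rw [ENNReal.tsum_eq_iSup_sum]
  refine iSup_le fun s => ?_
  have h := ENNReal.inner_le_Lp_mul_Lq s f g Real.HolderConjugate.two_two
  have hs : ∀ (u : ι → ℝ≥0∞) (c : ℝ≥0∞), ∑' i, u i ^ 2 ≤ c ^ 2 →
      (∑ i ∈ s, u i ^ (2 : ℝ)) ^ (1 / (2 : ℝ)) ≤ c := by
    intro u c hu
    have : ∑ i ∈ s, u i ^ (2 : ℝ) ≤ c ^ (2 : ℝ) := by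
      simp only [ENNReal.rpow_ofNat]
      exact (ENNReal.sum_le_tsum s).trans hu
    calc _ ≤ (c ^ (2 : ℝ)) ^ (1 / (2 : ℝ)) := by gcongr
      _ = c := by rw [← ENNReal.rpow_mul]; norm_num
  exact h.trans (mul_le_mul' (hs f a hf) (hs g b hg))

theorem lintegral_mul_le_of_sq {X : Type*} [MeasurableSpace X] {μ : Measure X} {f g : X → ℝ≥0∞}
    (hfm : AEMeasurable f μ) (hgm : AEMeasurable g μ) {a b : ℝ≥0∞}
    (hf : ∫⁻ x, f x ^ 2 ∂μ ≤ a ^ 2) (hg : ∫⁻ x, g x ^ 2 ∂μ ≤ b ^ 2) :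
    ∫⁻ x, f x * g x ∂μ ≤ a * b := by
  have h := ENNReal.lintegral_mul_le_Lp_mul_Lq μ Real.HolderConjugate.two_two hfm hgm
  have hs : ∀ (u : X → ℝ≥0∞) (c : ℝ≥0∞), ∫⁻ x, u x ^ 2 ∂μ ≤ c ^ 2 →
      (∫⁻ x, u x ^ (2 : ℝ) ∂μ) ^ (1 / (2 : ℝ)) ≤ c := by
    intro u c hu
    simp only [ENNReal.rpow_ofNat]
    calc _ ≤ (c ^ 2) ^ (1 / (2 : ℝ)) := by gcongr
      _ = c := by rw [← ENNReal.rpow_ofNat, ← ENNReal.rpow_mul]; norm_num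
  exact h.trans (mul_le_mul' (hs f a hf) (hs g b hg))

theorem tsum_enorm_inner_sq_le {ι : Type*} {v : ι → E} (hv : Orthonormal ℂ v) (x : E) :
    ∑' i, ‖inner ℂ (v i) x‖ₑ ^ 2 ≤ ‖x‖ₑ ^ 2 := by
  have hs := hv.inner_products_summable (x := x)
  have h := hv.tsum_inner_products_le (x := x)
  have e : ∀ y : ℂ, ‖y‖ₑ ^ 2 = ENNReal.ofReal (‖y‖ ^ 2) := fun y => by
    rw [ENNReal.ofReal_pow (norm_nonneg _), ofReal_norm]
  have e' : ‖x‖ₑ ^ 2 = ENNReal.ofReal (‖x‖ ^ 2) := by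
    rw [ENNReal.ofReal_pow (norm_nonneg _), ofReal_norm]
  simp only [e]
  rw [e', ← ENNReal.ofReal_tsum_of_nonneg (fun _ => by positivity) hs]
  exact ENNReal.ofReal_le_ofReal h

theorem enorm_inner_comm (x y : E) : ‖inner ℂ x y‖ₑ = ‖inner ℂ y x‖ₑ := by
  rw [← ofReal_norm, norm_inner_symm, ofReal_norm]

theorem enorm_inner_le (x y : E) : ‖inner ℂ x y‖ₑ ≤ ‖x‖ₑ * ‖y‖ₑ := by
  rw [← ofReal_norm, ← ofReal_norm, ← ofReal_norm,
    ← ENNReal.ofReal_mul (norm_nonneg _)]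
  exact ENNReal.ofReal_le_ofReal (norm_inner_le_norm x y)

/-- Bessel's inequality for the product of two coefficient sequences. -/
theorem tsum_enorm_inner_mul_le {ι : Type*} {a b : ι → E} (ha : Orthonormal ℂ a)
    (hb : Orthonormal ℂ b) (x y : E) :
    ∑' i, ‖inner ℂ (a i) x‖ₑ * ‖inner ℂ y (b i)‖ₑ ≤ ‖x‖ₑ * ‖y‖ₑ := by
  refine ennreal_tsum_mul_le_of_sq (tsum_enorm_inner_sq_le ha x) ?_
  simp only [enorm_inner_comm y]
  exact tsum_enorm_inner_sq_le hb y

end Bessel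

/-! ### A norm built from matrix coefficients -/

section PairNorm

variable {E : Type*} [NormedAddCommGroup E] [InnerProductSpace ℂ E]

/-- The supremum of the `ℓ^p`-norms of `⟨a_k, T b_k⟩` over finite orthonormal systems. -/
def pairNorm (p : ℝ≥0∞) (T : E →L[ℂ] E) : ℝ≥0∞ :=
  ⨆ (n : ℕ) (a : Fin n → E) (b : Fin n → E) (_ : Orthonormal ℂ a) (_ : Orthonormal ℂ b),
    eLpNorm (fun k => inner ℂ (a k) (T (b k))) p Measure.count

theorem pairNorm_le {p : ℝ≥0∞} {T : E →L[ℂ] E} {C : ℝ≥0∞}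
    (h : ∀ (n : ℕ) (a b : Fin n → E), Orthonormal ℂ a → Orthonormal ℂ b →
      eLpNorm (fun k => inner ℂ (a k) (T (b k))) p Measure.count ≤ C) : pairNorm p T ≤ C :=
  iSup_le fun n => iSup_le fun a => iSup_le fun b => iSup_le fun ha => iSup_le fun hb =>
    h n a b ha hb

theorem le_pairNorm (p : ℝ≥0∞) (T : E →L[ℂ] E) {n : ℕ} {a b : Fin n → E} (ha : Orthonormal ℂ a)
    (hb : Orthonormal ℂ b) :
    eLpNorm (fun k => inner ℂ (a k) (T (b k))) p Measure.count ≤ pairNorm p T :=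
  le_iSup_of_le n <| le_iSup_of_le a <| le_iSup_of_le b <| le_iSup_of_le ha <|
    le_iSup_of_le hb le_rfl

/-- Minkowski applies to each pair of orthonormal systems. This is the advantage over singular
values, for which the triangle inequality is not apparent. -/
theorem pairNorm_add_le {p : ℝ≥0∞} (hp : 1 ≤ p) (A B : E →L[ℂ] E) :
    pairNorm p (A + B) ≤ pairNorm p A + pairNorm p B := by
  refine pairNorm_le fun n a b ha hb => ?_
  have : (fun k => inner ℂ (a k) ((A + B) (b k))) =
      (fun k => inner ℂ (a k) (A (b k))) + fun k => inner ℂ (a k) (B (b k)) := by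
    ext k; simp
  rw [this]
  refine (eLpNorm_add_le ?_ ?_ hp).trans (add_le_add (le_pairNorm p A ha hb) (le_pairNorm p B ha hb))
  all_goals exact (Measurable.of_discrete).aestronglyMeasurable

theorem pairNorm_smul_le (p : ℝ≥0∞) (c : ℂ) (A : E →L[ℂ] E) :
    pairNorm p (c • A) ≤ ‖c‖ₑ * pairNorm p A := by
  refine pairNorm_le fun n a b ha hb => ?_
  have : (fun k => inner ℂ (a k) ((c • A) (b k))) = c • fun k => inner ℂ (a k) (A (b k)) := by
    ext k; simp
  rw [this]
  refine (eLpNorm_const_smul_le).trans ?_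
  gcongr
  exact le_pairNorm p A ha hb

theorem pairNorm_zero (p : ℝ≥0∞) : pairNorm p (0 : E →L[ℂ] E) = 0 := by
  refine le_antisymm (pairNorm_le fun n a b ha hb => ?_) zero_le
  simp

theorem enorm_inner_le_pairNorm {p : ℝ≥0∞} (hp : 1 ≤ p) (T : E →L[ℂ] E) {x y : E}
    (hx : ‖x‖ = 1) (hy : ‖y‖ = 1) : ‖inner ℂ x (T y)‖ₑ ≤ pairNorm p T := by
  have ha : Orthonormal ℂ fun _ : Fin 1 => x :=
    ⟨fun _ => hx, fun i j h => absurd (Subsingleton.elim i j) h⟩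
  have hb : Orthonormal ℂ fun _ : Fin 1 => y :=
    ⟨fun _ => hy, fun i j h => absurd (Subsingleton.elim i j) h⟩
  refine le_trans ?_ (le_pairNorm p T ha hb)
  have hp0 : p ≠ 0 := (zero_lt_one.trans_le hp).ne'
  rw [eLpNorm_const _ hp0 (by simp)]
  simp

theorem norm_le_of_forall_unit {T : E →L[ℂ] E} {C : ℝ} (hC : 0 ≤ C)
    (h : ∀ x y : E, ‖x‖ = 1 → ‖y‖ = 1 → ‖inner ℂ x (T y)‖ ≤ C) : ‖T‖ ≤ C := by
  refine ContinuousLinearMap.opNorm_le_of_unit_norm hC fun y hy => ?_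
  rcases eq_or_ne (T y) 0 with h0 | h0
  · simpa [h0] using hC
  have h1 := h ((‖T y‖⁻¹ : ℂ) • T y) y (by rw [norm_smul]; simp [h0]) hy
  rw [inner_smul_left, inner_self_eq_norm_sq_to_K, norm_mul] at h1
  simp only [map_inv₀, Complex.conj_ofReal, norm_inv, Complex.norm_real, norm_norm,
    Complex.coe_algebraMap, norm_pow] at h1
  rwa [sq, ← mul_assoc, inv_mul_cancel₀ (norm_ne_zero_iff.mpr h0), one_mul] at h1

theorem enorm_le_pairNorm {p : ℝ≥0∞} (hp : 1 ≤ p) (T : E →L[ℂ] E) : ‖T‖ₑ ≤ pairNorm p T := by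
  rcases eq_or_ne (pairNorm p T) ∞ with h | h
  · rw [h]; exact le_top
  rw [← ofReal_norm, ENNReal.ofReal_le_iff_le_toReal h]
  refine norm_le_of_forall_unit ENNReal.toReal_nonneg fun x y hx hy => ?_
  rw [← ENNReal.ofReal_le_iff_le_toReal h, ofReal_norm]
  exact enorm_inner_le_pairNorm hp T hx hy

theorem pairNorm_top_le (T : E →L[ℂ] E) : pairNorm ∞ T ≤ ‖T‖ₑ := by
  refine pairNorm_le fun n a b ha hb => ?_
  rw [eLpNorm_exponent_top]
  refine essSup_le_of_ae_le _ (Filter.Eventually.of_forall fun k => ?_)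
  refine (enorm_inner_le _ _).trans ?_
  have h := T.le_opENorm (b k)
  rw [← ofReal_norm (b k), hb.1 k] at h
  rw [← ofReal_norm (a k), ha.1 k]
  simpa using h

/-- A weighted version of Schur's test with a one-point space on one side. -/
theorem pairNorm_le_of_weight {p : ℝ≥0∞} (hp : 1 ≤ p) {A : E →L[ℂ] E} {c : ℝ≥0∞}
    (h : ∀ (n : ℕ) (a b : Fin n → E), Orthonormal ℂ a → Orthonormal ℂ b →
      ∑ k, ‖inner ℂ (a k) (A (b k))‖ₑ ≤ c) : pairNorm p A ≤ c := by
  refine pairNorm_le fun n a b ha hb => ?_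
  have hsum := h n a b ha hb
  -- The coefficients form a kernel on `Fin n` × point applied to the constant 1. An ℓ¹ bound
  -- controls both marginals, hence the ℓ^p-norm for every p.
  have := eLpNorm_le_of_kernel (μ := (Measure.count : Measure (Fin n)))
    (ν := Measure.dirac ()) (W := fun k _ => ‖inner ℂ (a k) (A (b k))‖ₑ)
    (c := c) (F := fun k => inner ℂ (a k) (A (b k))) (g := fun _ => 1) (Measurable.of_discrete)
    (fun k => by
      simp only [lintegral_dirac]
      exact (Finset.single_le_sum (f := fun k => ‖inner ℂ (a k) (A (b k))‖ₑ)
        (fun _ _ => zero_le) (Finset.mem_univ k)).trans hsum)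
    (fun _ => by rw [lintegral_count, tsum_fintype]; exact hsum)
    (by fun_prop) (fun k => by simp) hp
  refine this.trans ?_
  have hp0 : p ≠ 0 := (zero_lt_one.trans_le hp).ne'
  rw [eLpNorm_const _ hp0 (by simp [Measure.dirac_ne_zero])]
  simp

end PairNorm

/-! ### Nuclear series and the trace -/

section Nuclear

variable {E : Type*} [NormedAddCommGroup E] [InnerProductSpace ℂ E]

/-- `A = ∑ uₙ ⊗ vₙ` with `∑ ‖uₙ‖ ‖vₙ‖ < ∞`. -/
structure NuclearSum (u v : ℕ → E) (A : E →L[ℂ] E) : Prop where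
  summable : Summable fun n => ‖u n‖ * ‖v n‖
  hasSum : HasSum (fun n => rankOne ℂ (u n) (v n)) A

theorem NuclearSum.of_apply [CompleteSpace E] {u v : ℕ → E} {A : E →L[ℂ] E}
    (h : Summable fun n => ‖u n‖ * ‖v n‖)
    (hA : ∀ x, HasSum (fun n => inner ℂ (v n) x • u n) (A x)) : NuclearSum u v A := by
  refine ⟨h, ?_⟩
  have hs : Summable fun n => rankOne ℂ (u n) (v n) := by
    refine Summable.of_norm ?_
    simpa using h
  have : (∑' n, rankOne ℂ (u n) (v n)) = A := by
    ext x
    have h1 := (hs.hasSum.mapL (ContinuousLinearMap.apply ℂ E x))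
    exact h1.unique (by simpa using hA x)
  rw [← this]
  exact hs.hasSum

theorem NuclearSum.hasSum_apply {u v : ℕ → E} {A : E →L[ℂ] E} (h : NuclearSum u v A) (x : E) :
    HasSum (fun n => inner ℂ (v n) x • u n) (A x) := by
  simpa using h.hasSum.mapL (ContinuousLinearMap.apply ℂ E x)

theorem NuclearSum.hasSum_inner {u v : ℕ → E} {A : E →L[ℂ] E} (h : NuclearSum u v A) (x y : E) :
    HasSum (fun n => inner ℂ x (u n) * inner ℂ (v n) y) (inner ℂ x (A y)) := by
  have := (h.hasSum_apply y).mapL (innerSL ℂ x)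
  simpa [inner_smul_right, mul_comm] using this

theorem NuclearSum.enorm_inner_le {u v : ℕ → E} {A : E →L[ℂ] E} (h : NuclearSum u v A) (x y : E) :
    ‖inner ℂ x (A y)‖ₑ ≤ ∑' n, ‖inner ℂ x (u n)‖ₑ * ‖inner ℂ (v n) y‖ₑ := by
  rw [← (h.hasSum_inner x y).tsum_eq]
  simpa using enorm_tsum_le_tsum_enorm (f := fun n => inner ℂ x (u n) * inner ℂ (v n) y)

theorem NuclearSum.tsum_enorm_ne_top {u v : ℕ → E} {A : E →L[ℂ] E} (h : NuclearSum u v A) :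
    ∑' n, ‖u n‖ₑ * ‖v n‖ₑ ≠ ∞ := by
  have := h.summable.tsum_ofReal_ne_top
  simpa [ENNReal.ofReal_mul, ofReal_norm] using this

/-- By Bessel each rank-one term adds at most ‖u n‖‖v n‖ to the ℓ¹-sum of matrix coefficients, and
ℓ¹ bounds ℓ^p. -/
theorem NuclearSum.pairNorm_le {p : ℝ≥0∞} (hp : 1 ≤ p) {u v : ℕ → E} {A : E →L[ℂ] E}
    (h : NuclearSum u v A) : pairNorm p A ≤ ∑' n, ‖u n‖ₑ * ‖v n‖ₑ := by
  refine pairNorm_le_of_weight hp fun m a b ha hb => ?_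
  calc ∑ k, ‖inner ℂ (a k) (A (b k))‖ₑ
      ≤ ∑ k, ∑' n, ‖inner ℂ (a k) (u n)‖ₑ * ‖inner ℂ (v n) (b k)‖ₑ :=
        Finset.sum_le_sum fun k _ => h.enorm_inner_le _ _
    _ = ∑' n, ∑ k, ‖inner ℂ (a k) (u n)‖ₑ * ‖inner ℂ (v n) (b k)‖ₑ :=
        (Summable.tsum_finsetSum fun _ _ => ENNReal.summable).symm
    _ ≤ ∑' n, ‖u n‖ₑ * ‖v n‖ₑ := by
        refine ENNReal.tsum_le_tsum fun n => ?_
        rw [← tsum_fintype (L := SummationFilter.unconditional _)]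
        exact tsum_enorm_inner_mul_le ha hb _ _

theorem nuclearSum_rankOne (x y : E) :
    NuclearSum (fun n => if n = 0 then x else 0) (fun n => if n = 0 then y else 0)
      (rankOne ℂ x y) := by
  refine ⟨summable_of_ne_finset_zero (s := {0}) fun n hn => ?_, ?_⟩
  · simp only [Finset.mem_singleton] at hn; simp [hn]
  · convert! hasSum_ite_eq 0 (rankOne ℂ x y) using 2 with n
    split_ifs <;> simp

theorem pairNorm_rankOne_le {p : ℝ≥0∞} (hp : 1 ≤ p) (x y : E) :
    pairNorm p (rankOne ℂ x y) ≤ ‖x‖ₑ * ‖y‖ₑ := by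
  refine ((nuclearSum_rankOne x y).pairNorm_le hp).trans (le_of_eq ?_)
  rw [tsum_eq_single 0]
  · simp
  · intro n hn; simp [hn]

variable [CompleteSpace E]

theorem NuclearSum.comp_left {u v : ℕ → E} {A : E →L[ℂ] E} (h : NuclearSum u v A)
    (B : E →L[ℂ] E) : NuclearSum (fun n => B (u n)) v (B ∘L A) := by
  refine NuclearSum.of_apply ?_ fun x => ?_
  · refine Summable.of_nonneg_of_le (fun _ => by positivity) (fun n => ?_) (h.summable.mul_left ‖B‖)
    rw [← mul_assoc]
    gcongr
    exact B.le_opNorm _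
  · simpa using (h.hasSum_apply x).mapL B

theorem NuclearSum.comp_right {u v : ℕ → E} {A : E →L[ℂ] E} (h : NuclearSum u v A)
    (B : E →L[ℂ] E) : NuclearSum u (fun n => B.adjoint (v n)) (A ∘L B) := by
  refine NuclearSum.of_apply ?_ fun x => ?_
  · refine Summable.of_nonneg_of_le (fun _ => by positivity) (fun n => ?_)
      (h.summable.mul_left ‖B.adjoint‖)
    rw [mul_left_comm]
    gcongr
    exact B.adjoint.le_opNorm _
  · simpa [ContinuousLinearMap.adjoint_inner_left] using h.hasSum_apply (B x)

/-- The orthonormal basis used in the definition of the trace. -/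
def traceBasis (E : Type*) [NormedAddCommGroup E] [InnerProductSpace ℂ E] [CompleteSpace E] :
    HilbertBasis (exists_hilbertBasis ℂ E).choose ℂ E :=
  (exists_hilbertBasis ℂ E).choose_spec.choose

theorem coe_traceBasis : ⇑(traceBasis E) = ((↑) : (exists_hilbertBasis ℂ E).choose → E) :=
  (exists_hilbertBasis ℂ E).choose_spec.choose_spec

theorem trace_eq_tsum (A : E →L[ℂ] E) :
    trace A = ∑' e, inner ℂ (traceBasis E e) (A (traceBasis E e)) := by
  rw [coe_traceBasis]; rfl

theorem summable_inner_mul_of_sq {ι : Type*} {a b : ι → E} (ha : Orthonormal ℂ a)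
    (hb : Orthonormal ℂ b) (x y : E) :
    Summable (fun i => ‖inner ℂ (a i) x * inner ℂ y (b i)‖) ∧
      ∑' i, ‖inner ℂ (a i) x * inner ℂ y (b i)‖ ≤ ‖x‖ * ‖y‖ := by
  have h := tsum_enorm_inner_mul_le ha hb x y
  simp only [← enorm_mul] at h
  have htop : ∑' i, ‖inner ℂ (a i) x * inner ℂ y (b i)‖ₑ ≠ ∞ :=
    (h.trans_lt (ENNReal.mul_lt_top (by simp) (by simp))).ne
  have hs : Summable (fun i => ‖inner ℂ (a i) x * inner ℂ y (b i)‖) := by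
    have := ENNReal.summable_toReal htop
    simpa using this
  refine ⟨hs, ?_⟩
  have h2 := ENNReal.toReal_mono (by finiteness) h
  rw [ENNReal.tsum_toReal_eq fun i => enorm_ne_top] at h2
  simpa using h2

/-- The double family ⟨b e, u n⟩⟨v n, b e⟩ is absolutely summable by Cauchy–Schwarz and Bessel.
Summing over e first gives ⟨v n, u n⟩ by Parseval, summing over n first gives the diagonal of A; so
the trace depends neither on the basis nor on the nuclear expansion. -/
theorem NuclearSum.hasSum_basis {u v : ℕ → E} {A : E →L[ℂ] E} (h : NuclearSum u v A)
    {ι : Type*} (b : HilbertBasis ι ℂ E) :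
    HasSum (fun e => inner ℂ (b e) (A (b e))) (∑' n, inner ℂ (v n) (u n)) := by
  set F : ℕ × ι → ℂ :=
    fun q => inner ℂ (b q.2) (u q.1) * inner ℂ (v q.1) (b q.2) with hF
  have hsum : Summable F := by
    refine Summable.of_norm ?_
    rw [summable_prod_of_nonneg (fun _ => norm_nonneg _)]
    refine ⟨fun n => (summable_inner_mul_of_sq b.orthonormal b.orthonormal (u n) (v n)).1, ?_⟩
    exact Summable.of_nonneg_of_le (fun _ => tsum_nonneg fun _ => norm_nonneg _)
      (fun n => (summable_inner_mul_of_sq b.orthonormal b.orthonormal (u n) (v n)).2) h.summable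
  have h1 : HasSum (fun n => inner ℂ (v n) (u n)) (∑' q, F q) := by
    refine hsum.hasSum.prod_fiberwise fun n => ?_
    have := b.hasSum_inner_mul_inner (v n) (u n)
    simp_rw [mul_comm (inner ℂ (v n) _)] at this
    exact this
  have hsum' : HasSum (F ∘ Prod.swap) (∑' q, F q) :=
    (Equiv.prodComm _ _).hasSum_iff.mpr hsum.hasSum
  rw [h1.tsum_eq]
  exact hsum'.prod_fiberwise fun e => h.hasSum_inner (b e) (b e)

theorem NuclearSum.summable_inner {u v : ℕ → E} {A : E →L[ℂ] E} (h : NuclearSum u v A) :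
    Summable fun n => inner ℂ (v n) (u n) := by
  refine Summable.of_norm_bounded h.summable fun n => ?_
  rw [mul_comm]
  exact norm_inner_le_norm _ _

theorem NuclearSum.hasSum_trace {u v : ℕ → E} {A : E →L[ℂ] E} (h : NuclearSum u v A) :
    HasSum (fun n => inner ℂ (v n) (u n)) (trace A) ∧
      HasSum (fun e => inner ℂ (traceBasis E e) (A (traceBasis E e))) (trace A) := by
  have h2 := h.hasSum_basis (traceBasis E)
  rw [trace_eq_tsum, h2.tsum_eq]
  exact ⟨h.summable_inner.hasSum, h2⟩

theorem NuclearSum.trace_comp_left {u v : ℕ → E} {A : E →L[ℂ] E} (h : NuclearSum u v A)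
    (T : E →L[ℂ] E) : HasSum (fun n => inner ℂ (v n) (T (u n))) (trace (T ∘L A)) :=
  (h.comp_left T).hasSum_trace.1

theorem NuclearSum.trace_comp_comm {u v : ℕ → E} {A : E →L[ℂ] E} (h : NuclearSum u v A)
    (T : E →L[ℂ] E) : trace (T ∘L A) = trace (A ∘L T) := by
  refine (h.trace_comp_left T).unique ?_
  simpa [ContinuousLinearMap.adjoint_inner_left] using (h.comp_right T).hasSum_trace.1

theorem NuclearSum.norm_trace_le {u v : ℕ → E} {A : E →L[ℂ] E} (h : NuclearSum u v A)
    (T : E →L[ℂ] E) : ‖trace (T ∘L A)‖ₑ ≤ ‖T‖ₑ * ∑' n, ‖u n‖ₑ * ‖v n‖ₑ := by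
  rw [← (h.trace_comp_left T).tsum_eq, ← ENNReal.tsum_mul_left]
  refine enorm_tsum_le_tsum_enorm.trans (ENNReal.tsum_le_tsum fun n => ?_)
  calc _ ≤ ‖v n‖ₑ * ‖T (u n)‖ₑ := QHA.enorm_inner_le _ _
    _ ≤ ‖v n‖ₑ * (‖T‖ₑ * ‖u n‖ₑ) := by gcongr; exact T.le_opENorm _
    _ = _ := by ring

theorem trace_comp_rankOne (T : E →L[ℂ] E) (x y : E) :
    trace (T ∘L rankOne ℂ x y) = inner ℂ y (T x) := by
  refine ((nuclearSum_rankOne x y).trace_comp_left T).unique ?_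
  convert! hasSum_ite_eq 0 (inner ℂ y (T x)) using 2 with n
  split_ifs <;> simp

/-- Nuclear operators. -/
def IsNuclear (A : E →L[ℂ] E) : Prop := ∃ u v, NuclearSum u v A

theorem IsNuclear.rankOne (x y : E) : IsNuclear (rankOne ℂ x y) := ⟨_, _, nuclearSum_rankOne x y⟩

theorem IsNuclear.comp_left {A : E →L[ℂ] E} (h : IsNuclear A) (B : E →L[ℂ] E) :
    IsNuclear (B ∘L A) := by
  obtain ⟨u, v, h⟩ := h; exact ⟨_, _, h.comp_left B⟩

theorem IsNuclear.comp_right {A : E →L[ℂ] E} (h : IsNuclear A) (B : E →L[ℂ] E) :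
    IsNuclear (A ∘L B) := by
  obtain ⟨u, v, h⟩ := h; exact ⟨_, _, h.comp_right B⟩

theorem IsNuclear.hasSum_trace {A : E →L[ℂ] E} (h : IsNuclear A) :
    HasSum (fun e => inner ℂ (traceBasis E e) (A (traceBasis E e))) (trace A) := by
  obtain ⟨u, v, h⟩ := h; exact h.hasSum_trace.2

theorem IsNuclear.trace_add {A B : E →L[ℂ] E} (hA : IsNuclear A) (hB : IsNuclear B) :
    trace (A + B) = trace A + trace B := by
  rw [trace_eq_tsum (A + B), ← (hA.hasSum_trace.add hB.hasSum_trace).tsum_eq]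
  simp

theorem trace_smul (c : ℂ) (A : E →L[ℂ] E) : trace (c • A) = c * trace A := by
  rw [trace_eq_tsum, trace_eq_tsum, ← tsum_mul_left]
  simp

theorem IsNuclear.trace_comp_comm {A : E →L[ℂ] E} (h : IsNuclear A) (T : E →L[ℂ] E) :
    trace (T ∘L A) = trace (A ∘L T) := by
  obtain ⟨u, v, h⟩ := h; exact h.trace_comp_comm T

end Nuclear

/-! ### Singular values against matrix coefficients -/

section SingularValues

variable {E : Type*} [NormedAddCommGroup E] [InnerProductSpace ℂ E]

theorem bddBelow_norm_sub (T : E →L[ℂ] E) (n : ℕ) :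
    BddBelow (Set.range fun F : {F : E →L[ℂ] E //
      LinearMap.rank (F : E →ₗ[ℂ] E) ≤ (n : Cardinal)} => ‖T - F.1‖) :=
  ⟨0, by rintro _ ⟨F, rfl⟩; exact norm_nonneg _⟩

instance (n : ℕ) : Nonempty {F : E →L[ℂ] E // LinearMap.rank (F : E →ₗ[ℂ] E) ≤ (n : Cardinal)} :=
  ⟨⟨0, by simp⟩⟩

theorem singularValue_nonneg (T : E →L[ℂ] E) (n : ℕ) : 0 ≤ singularValue T n :=
  Real.iInf_nonneg fun _ => norm_nonneg _

theorem singularValue_le {T F : E →L[ℂ] E} {n : ℕ}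
    (hF : LinearMap.rank (F : E →ₗ[ℂ] E) ≤ (n : Cardinal)) : singularValue T n ≤ ‖T - F‖ :=
  ciInf_le (bddBelow_norm_sub T n) ⟨F, hF⟩

theorem le_singularValue {T : E →L[ℂ] E} {n : ℕ} {c : ℝ}
    (h : ∀ F : E →L[ℂ] E, LinearMap.rank (F : E →ₗ[ℂ] E) ≤ (n : Cardinal) → c ≤ ‖T - F‖) :
    c ≤ singularValue T n :=
  le_ciInf fun F => h F.1 F.2

theorem singularValue_antitone (T : E →L[ℂ] E) : Antitone (singularValue T) := fun m n hmn =>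
  le_singularValue fun _ hF => singularValue_le (hF.trans (by exact_mod_cast hmn))

theorem singularValue_le_norm (T : E →L[ℂ] E) (n : ℕ) : singularValue T n ≤ ‖T‖ := by
  simpa using singularValue_le (T := T) (F := 0) (n := n) (by simp)

theorem enorm_singularValue (T : E →L[ℂ] E) (n : ℕ) :
    ‖singularValue T n‖ₑ = ENNReal.ofReal (singularValue T n) :=
  Real.enorm_of_nonneg (singularValue_nonneg T n)

theorem exists_unit_lt {R : E →L[ℂ] E} (hR : 0 < ‖R‖) :
    ∃ x y : E, ‖x‖ = 1 ∧ ‖y‖ = 1 ∧ ‖R‖ / 2 < ‖inner ℂ x (R y)‖ := by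
  by_contra! h
  have := norm_le_of_forall_unit (by positivity) h
  linarith

instance hasOrthogonalProjection_span_range {n : ℕ} (a : Fin n → E) :
    (Submodule.span ℂ (Set.range a)).HasOrthogonalProjection := by
  have : FiniteDimensional ℂ (Submodule.span ℂ (Set.range a)) :=
    FiniteDimensional.span_of_finite ℂ (Set.finite_range a)
  infer_instance

theorem rank_starProjection_comp_le {n : ℕ} (a : Fin n → E) :
    LinearMap.rank ((Submodule.span ℂ (Set.range a)).starProjection : E →ₗ[ℂ] E) ≤
      (n : Cardinal) := by
  have h : LinearMap.range ((Submodule.span ℂ (Set.range a)).starProjection : E →ₗ[ℂ] E) =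
    Submodule.span ℂ (Set.range a) := Submodule.range_starProjection _
  rw [LinearMap.rank, h]
  refine (rank_span_le _).trans ?_
  simpa using Cardinal.mk_range_le_lift (f := a)

/-- Greedy selection. Once n pairs are chosen, T is compressed to the complements of their spans;
this changes T by an operator of rank at most 2n, so the compression still has norm at least the
singular value of index 2n, and half of that norm is exceeded by some matrix coefficient. Each new
pair is put in front of the old ones, whence `Fin.rev`. -/
theorem exists_orthonormal_pair_aux (T : E →L[ℂ] E) (n : ℕ)
    (h : ∀ k < n, 0 < singularValue T (2 * k)) :
    ∃ a b : Fin n → E, Orthonormal ℂ a ∧ Orthonormal ℂ b ∧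
      ∀ k, singularValue T (2 * (Fin.rev k : Fin n)) ≤ 2 * ‖inner ℂ (a k) (T (b k))‖ := by
  induction n with
  | zero => exact ⟨Fin.elim0, Fin.elim0, ⟨fun i => i.elim0, fun i => i.elim0⟩,
      ⟨fun i => i.elim0, fun i => i.elim0⟩, fun i => i.elim0⟩
  | succ n ih =>
    obtain ⟨a, b, ha, hb, hab⟩ := ih fun k hk => h k (by omega)
    set U := Submodule.span ℂ (Set.range a) with hU
    set V := Submodule.span ℂ (Set.range b) with hV
    have : U.HasOrthogonalProjection := hasOrthogonalProjection_span_range a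
    have : V.HasOrthogonalProjection := hasOrthogonalProjection_span_range b
    set R : E →L[ℂ] E := Uᗮ.starProjection ∘L T ∘L Vᗮ.starProjection with hR
    -- With P and Q the projections onto U and V, T = P T + P^⊥ T Q + P^⊥ T Q^⊥. The first two terms
    -- have rank at most n each.
    have hsub : T - (U.starProjection ∘L T + Uᗮ.starProjection ∘L T ∘L V.starProjection) = R := by
      ext x
      have h1 := fun y : E => congrArg (fun L : E →L[ℂ] E => L y) (Submodule.starProjection_orthogonal U)
      have h2 := fun y : E => congrArg (fun L : E →L[ℂ] E => L y) (Submodule.starProjection_orthogonal V)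
      simp only [FunLike.coe_sub, Pi.sub_apply, ContinuousLinearMap.coe_id', id_eq]
        at h1 h2
      simp only [hR, FunLike.coe_sub, ContinuousLinearMap.coe_comp, Pi.sub_apply,
        Function.comp_apply, add_apply, h1, h2, map_sub]
      abel
    have hRn : singularValue T (2 * n) ≤ ‖R‖ := by
      rw [← hsub]
      refine singularValue_le ?_
      have e : ((U.starProjection ∘L T + Uᗮ.starProjection ∘L T ∘L V.starProjection :
          E →L[ℂ] E) : E →ₗ[ℂ] E) = (U.starProjection : E →ₗ[ℂ] E) ∘ₗ (T : E →ₗ[ℂ] E) +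
          ((Uᗮ.starProjection ∘L T : E →L[ℂ] E) : E →ₗ[ℂ] E) ∘ₗ (V.starProjection : E →ₗ[ℂ] E) := rfl
      rw [e]
      refine (LinearMap.rank_add_le _ _).trans ?_
      have h1 := (LinearMap.rank_comp_le_left (T : E →ₗ[ℂ] E)
        (U.starProjection : E →ₗ[ℂ] E)).trans (rank_starProjection_comp_le a)
      have h2 := (LinearMap.rank_comp_le_right (V.starProjection : E →ₗ[ℂ] E)
        ((Uᗮ.starProjection ∘L T : E →L[ℂ] E) : E →ₗ[ℂ] E)).trans (rank_starProjection_comp_le b)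
      refine (add_le_add h1 h2).trans ?_
      rw [← Nat.cast_add, two_mul]
    have hpos : 0 < ‖R‖ := (h n (by omega)).trans_le hRn
    obtain ⟨x, y, hx, hy, hxy⟩ := exists_unit_lt hpos
    set x' := Uᗮ.starProjection x with hx'
    set y' := Vᗮ.starProjection y with hy'
    have hin : inner ℂ x (R y) = inner ℂ x' (T y') := by
      simp only [hR, ContinuousLinearMap.coe_comp, Function.comp_apply]
      rw [hx', Submodule.inner_starProjection_left_eq_right]
    rw [hin] at hxy
    have hx1 : ‖x'‖ ≤ 1 := hx ▸ Submodule.norm_starProjection_apply_le _ x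
    have hy1 : ‖y'‖ ≤ 1 := hy ▸ Submodule.norm_starProjection_apply_le _ y
    have hne : 0 < ‖inner ℂ x' (T y')‖ := (by positivity : (0:ℝ) ≤ ‖R‖ / 2).trans_lt hxy
    have hx0 : x' ≠ 0 := by rintro h0; simp [h0] at hne
    have hy0 : y' ≠ 0 := by rintro h0; simp [h0] at hne
    have hxU : ∀ i, inner ℂ x' (a i) = 0 := fun i =>
      (Submodule.mem_orthogonal' U x').mp (Submodule.starProjection_apply_mem _ x) _
        (Submodule.subset_span ⟨i, rfl⟩)
    have hyV : ∀ i, inner ℂ y' (b i) = 0 := fun i =>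
      (Submodule.mem_orthogonal' V y').mp (Submodule.starProjection_apply_mem _ y) _
        (Submodule.subset_span ⟨i, rfl⟩)
    refine ⟨Matrix.vecCons (((‖x'‖⁻¹ : ℝ) : ℂ) • x') a, Matrix.vecCons (((‖y'‖⁻¹ : ℝ) : ℂ) • y') b,
      ?_, ?_, ?_⟩
    · rw [orthonormal_vecCons_iff]
      refine ⟨?_, fun i => by rw [inner_smul_left, hxU, mul_zero], ha⟩
      rw [norm_smul, Complex.norm_real, norm_inv, norm_norm, inv_mul_cancel₀ (norm_ne_zero_iff.mpr hx0)]
    · rw [orthonormal_vecCons_iff]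
      refine ⟨?_, fun i => by rw [inner_smul_left, hyV, mul_zero], hb⟩
      rw [norm_smul, Complex.norm_real, norm_inv, norm_norm, inv_mul_cancel₀ (norm_ne_zero_iff.mpr hy0)]
    · intro k
      refine Fin.cases ?_ (fun k => ?_) k
      · simp only [Fin.rev_zero, Fin.val_last, Matrix.cons_val_zero]
        rw [map_smul, inner_smul_left, inner_smul_right, norm_mul, norm_mul, Complex.conj_ofReal,
          Complex.norm_real, Complex.norm_real, norm_inv, norm_inv, norm_norm, norm_norm]
        -- The projected vectors have norm at most one, so normalising them can only increase the
        -- coefficient.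
        have i1 : 1 ≤ ‖x'‖⁻¹ := (one_le_inv₀ (norm_pos_iff.mpr hx0)).mpr hx1
        have i2 : 1 ≤ ‖y'‖⁻¹ := (one_le_inv₀ (norm_pos_iff.mpr hy0)).mpr hy1
        have : ‖inner ℂ x' (T y')‖ ≤ ‖x'‖⁻¹ * (‖y'‖⁻¹ * ‖inner ℂ x' (T y')‖) := by
          rw [← mul_assoc]
          exact le_mul_of_one_le_left (norm_nonneg _) (one_le_mul_of_one_le_of_one_le i1 i2)
        linarith
      · simpa [Fin.rev_succ] using hab k

theorem exists_orthonormal_pair (T : E →L[ℂ] E) (n : ℕ)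
    (h : ∀ k < n, 0 < singularValue T (2 * k)) :
    ∃ a b : Fin n → E, Orthonormal ℂ a ∧ Orthonormal ℂ b ∧
      ∀ k : Fin n, singularValue T (2 * k) ≤ 2 * ‖inner ℂ (a k) (T (b k))‖ := by
  obtain ⟨a, b, ha, hb, hab⟩ := exists_orthonormal_pair_aux T n h
  refine ⟨a ∘ Fin.rev, b ∘ Fin.rev, ha.comp _ Fin.rev_injective, hb.comp _ Fin.rev_injective,
    fun k => ?_⟩
  simpa using hab (Fin.rev k)

theorem eLpNorm_count_rpow {ι F : Type*} [MeasurableSpace ι] [MeasurableSingletonClass ι]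
    [NormedAddCommGroup F] {p : ℝ≥0∞} (hp : 1 ≤ p) (hpt : p ≠ ∞) (f : ι → F) :
    eLpNorm f p Measure.count ^ p.toReal = ∑' i, ‖f i‖ₑ ^ p.toReal := by
  have hp0 : p ≠ 0 := (zero_lt_one.trans_le hp).ne'
  have hpr : p.toReal ≠ 0 := (ENNReal.toReal_pos hp0 hpt).ne'
  rw [eLpNorm_eq_lintegral_rpow_enorm_toReal hp0 hpt, ← ENNReal.rpow_mul,
    one_div_mul_cancel hpr, ENNReal.rpow_one, lintegral_count]

/-- The selected pairs bound the singular values of even index up to a factor 2, and each odd one is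
at most its even predecessor. The sum of r-th powers is thus at most 2 (2N)^r ≤ (4N)^r, because r ≥
1. -/
theorem schattenNorm_le_pairNorm {p : ℝ≥0∞} (hp : 1 ≤ p) (T : E →L[ℂ] E) :
    schattenNorm p T ≤ 4 * pairNorm p T := by
  rcases eq_or_ne p ∞ with rfl | hpt
  · rw [schattenNorm, eLpNorm_exponent_top]
    refine essSup_le_of_ae_le _ (Filter.Eventually.of_forall fun n => ?_)
    calc ‖singularValue T n‖ₑ ≤ ‖T‖ₑ := by
          rw [enorm_singularValue, ← ofReal_norm]
          exact ENNReal.ofReal_le_ofReal (singularValue_le_norm T n)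
      _ ≤ pairNorm ∞ T := enorm_le_pairNorm hp T
      _ ≤ 4 * pairNorm ∞ T := le_mul_of_one_le_left zero_le (by norm_num)
  have hp0 : p ≠ 0 := (zero_lt_one.trans_le hp).ne'
  have hr1 : 1 ≤ p.toReal := by
    rw [← ENNReal.toReal_one]; exact ENNReal.toReal_mono hpt hp
  set r := p.toReal with hr
  have hr0 : 0 < r := by linarith
  set x : ℕ → ℝ≥0∞ := fun n => ‖singularValue T n‖ₑ ^ r with hx
  have hanti : Antitone x := fun m n hmn => by
    simp only [hx, enorm_singularValue]
    gcongr
    exact singularValue_antitone T hmn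
  have hpart : ∀ n, ∑ k ∈ Finset.range n, x (2 * k) ≤ (2 * pairNorm p T) ^ r := by
    intro n
    induction n with
    | zero => simp
    | succ n ih =>
      -- A vanishing last term adds nothing; otherwise monotonicity makes all earlier terms
      -- positive, as the selection lemma requires.
      rcases (singularValue_nonneg T (2 * n)).eq_or_lt with h0 | h0
      · rw [Finset.sum_range_succ]
        have : x (2 * n) = 0 := by simp [hx, ← h0, hr0]
        rw [this, add_zero]; exact ih
      obtain ⟨a, b, ha, hb, hab⟩ := exists_orthonormal_pair T (n + 1) fun k hk =>
        h0.trans_le (singularValue_antitone T (by omega))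
      have h1 := le_pairNorm p T ha hb
      calc ∑ k ∈ Finset.range (n + 1), x (2 * k)
          = ∑ k : Fin (n + 1), x (2 * k) := (Fin.sum_univ_eq_sum_range (fun k => x (2 * k)) _).symm
        _ ≤ ∑ k : Fin (n + 1), (2 * ‖inner ℂ (a k) (T (b k))‖ₑ) ^ r := by
            refine Finset.sum_le_sum fun k _ => ?_
            simp only [hx, enorm_singularValue]
            refine ENNReal.rpow_le_rpow ?_ hr0.le
            calc _ ≤ ENNReal.ofReal (2 * ‖inner ℂ (a k) (T (b k))‖) :=
                  ENNReal.ofReal_le_ofReal (hab k)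
              _ = _ := by rw [ENNReal.ofReal_mul zero_le_two, ofReal_norm]; simp
        _ = 2 ^ r * eLpNorm (fun k => inner ℂ (a k) (T (b k))) p Measure.count ^ r := by
            rw [hr, eLpNorm_count_rpow hp hpt, tsum_fintype, Finset.mul_sum]
            simp only [ENNReal.mul_rpow_of_nonneg _ _ ENNReal.toReal_nonneg]
        _ ≤ (2 * pairNorm p T) ^ r := by
            rw [ENNReal.mul_rpow_of_nonneg _ _ hr0.le]
            gcongr
  have heven : ∑' k, x (2 * k) ≤ (2 * pairNorm p T) ^ r := ENNReal.tsum_le_of_sum_range_le hpart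
  have htot : ∑' k, x k ≤ 2 * (2 * pairNorm p T) ^ r := by
    rw [← tsum_even_add_odd ENNReal.summable ENNReal.summable, two_mul]
    refine add_le_add heven (le_trans (ENNReal.tsum_le_tsum fun k => ?_) heven)
    exact hanti (by omega)
  have h2 : (2 : ℝ≥0∞) ≤ 2 ^ r := by
    calc (2 : ℝ≥0∞) = 2 ^ (1 : ℝ) := by simp
      _ ≤ 2 ^ r := ENNReal.rpow_le_rpow_of_exponent_le (by norm_num) hr1
  have hfin : schattenNorm p T ^ r ≤ (4 * pairNorm p T) ^ r := by
    rw [schattenNorm, hr, eLpNorm_count_rpow hp hpt]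
    calc _ ≤ 2 * (2 * pairNorm p T) ^ r := htot
      _ ≤ 2 ^ r * (2 * pairNorm p T) ^ r := by gcongr
      _ = (4 * pairNorm p T) ^ r := by
        rw [← ENNReal.mul_rpow_of_nonneg _ _ hr0.le, ← mul_assoc]; norm_num
  exact (ENNReal.rpow_le_rpow_iff hr0).mp hfin

/-- A lower bound for the singular values. -/
theorem le_singularValue_of_orthogonal {T : E →L[ℂ] E} {n : ℕ} {v : Fin (n + 1) → E}
    (hv : Orthonormal ℂ v) (hT : Pairwise fun i j => inner ℂ (T (v i)) (T (v j)) = 0) {c : ℝ}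
    (hc0 : 0 ≤ c) (hc : ∀ i, c ≤ ‖T (v i)‖) : c ≤ singularValue T n := by
  refine le_singularValue fun F hF => ?_
  let L : (Fin (n + 1) → ℂ) →ₗ[ℂ] E := Fintype.linearCombination ℂ v
  have hrk : Module.rank ℂ (LinearMap.range (F : E →ₗ[ℂ] E)) ≤ (n : Cardinal) := hF
  have : FiniteDimensional ℂ (LinearMap.range (F : E →ₗ[ℂ] E)) :=
    Module.rank_lt_aleph0_iff.mp (hrk.trans_lt (Cardinal.natCast_lt_aleph0))
  let f : (Fin (n + 1) → ℂ) →ₗ[ℂ] LinearMap.range (F : E →ₗ[ℂ] E) :=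
    (F : E →ₗ[ℂ] E).rangeRestrict ∘ₗ L
  -- The n + 1 vectors span a space on which F, of rank at most n, has a kernel. On a kernel vector
  -- T - F agrees with T, and orthogonality of both the v i and the T (v i) gives ‖T w‖ ≥ c ‖w‖.
  have hker : LinearMap.ker f ≠ ⊥ := by
    refine LinearMap.ker_ne_bot_of_finrank_lt ?_
    rw [Module.finrank_fin_fun]
    exact Nat.lt_succ_of_le (Module.finrank_le_of_rank_le hrk)
  obtain ⟨w, hw, hw0⟩ := Submodule.exists_mem_ne_zero_of_ne_bot hker
  have hFw : F (∑ i, w i • v i) = 0 := by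
    have := congrArg Subtype.val (LinearMap.mem_ker.mp hw)
    simpa [f, L, Fintype.linearCombination_apply] using this
  have hnorm : ‖∑ i, w i • v i‖ ^ 2 = ∑ i, ‖w i‖ ^ 2 := by
    have h := hv.inner_sum w w Finset.univ
    rw [inner_self_eq_norm_sq_to_K] at h
    have h2 : ∀ i, (starRingEnd ℂ) (w i) * w i = ((‖w i‖ ^ 2 : ℝ) : ℂ) := fun i => by
      rw [← Complex.normSq_eq_conj_mul_self, Complex.normSq_eq_norm_sq]
    simp only [h2] at h
    exact Complex.ofReal_injective (by simpa using h)
  have hTnorm : ‖T (∑ i, w i • v i)‖ ^ 2 = ∑ i, ‖w i‖ ^ 2 * ‖T (v i)‖ ^ 2 := by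
    have : (‖T (∑ i, w i • v i)‖ ^ 2 : ℂ) = ∑ i, (‖w i‖ ^ 2 * ‖T (v i)‖ ^ 2 : ℂ) := by
      have h0 := inner_self_eq_norm_sq_to_K (𝕜 := ℂ) (T (∑ i, w i • v i))
      rw [map_sum] at h0
      simp only [sum_inner, inner_sum, map_smul, inner_smul_left, inner_smul_right] at h0
      rw [map_sum]
      simp only [map_smul]
      refine (h0.symm.trans (Finset.sum_congr rfl fun i _ => ?_))
      rw [Finset.sum_eq_single i]
      · rw [inner_self_eq_norm_sq_to_K, ← mul_assoc, mul_comm (w i), ← Complex.normSq_eq_conj_mul_self,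
          Complex.normSq_eq_norm_sq]
        simp
      · intro j _ hj
        rw [hT hj]
        simp
      · simp
    exact_mod_cast this
  have hle : c ^ 2 * ‖∑ i, w i • v i‖ ^ 2 ≤ ‖T (∑ i, w i • v i)‖ ^ 2 := by
    rw [hnorm, hTnorm, Finset.mul_sum]
    refine Finset.sum_le_sum fun i _ => ?_
    rw [mul_comm]
    gcongr
    exact hc i
  have hpos : 0 < ‖∑ i, w i • v i‖ := by
    obtain ⟨i, hi⟩ := Function.ne_iff.mp hw0
    have hs : 0 < ∑ i, ‖w i‖ ^ 2 := Finset.sum_pos' (fun _ _ => by positivity)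
      ⟨i, Finset.mem_univ _, by have := norm_pos_iff.mpr hi; positivity⟩
    refine lt_of_le_of_ne (norm_nonneg _) fun h0 => ?_
    rw [← hnorm, ← h0] at hs
    simp at hs
  have h1 : c * ‖∑ i, w i • v i‖ ≤ ‖T (∑ i, w i • v i)‖ := by
    rw [← mul_pow] at hle
    exact (sq_le_sq₀ (by positivity) (norm_nonneg _)).mp hle
  have h2 : ‖T (∑ i, w i • v i)‖ ≤ ‖T - F‖ * ‖∑ i, w i • v i‖ := by
    have := (T - F).le_opNorm (∑ i, w i • v i)
    rwa [sub_apply, hFw, sub_zero] at this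
  exact le_of_mul_le_mul_right (h1.trans h2) hpos

end SingularValues

/-! ### Singular value decomposition -/

section SVD

universe w
variable {E : Type w} [NormedAddCommGroup E] [InnerProductSpace ℂ E]

theorem isCompactOperator_of_rank_le {F : E →L[ℂ] E} {n : ℕ}
    (hF : LinearMap.rank (F : E →ₗ[ℂ] E) ≤ (n : Cardinal)) : IsCompactOperator F := by
  have hrk : Module.rank ℂ (LinearMap.range (F : E →ₗ[ℂ] E)) ≤ (n : Cardinal) := hF
  have : FiniteDimensional ℂ (LinearMap.range (F : E →ₗ[ℂ] E)) :=
    Module.rank_lt_aleph0_iff.mp (hrk.trans_lt (Cardinal.natCast_lt_aleph0))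
  have hP : ProperSpace (LinearMap.range (F : E →ₗ[ℂ] E)) := FiniteDimensional.proper_rclike ℂ _
  let G : E →L[ℂ] LinearMap.range (F : E →ₗ[ℂ] E) := F.codRestrict _ fun x => ⟨x, rfl⟩
  have hG : IsCompactOperator G := isCompactOperator_of_locallyCompactSpace_dom G
  exact hG.clm_comp (Submodule.subtypeL _)

/-- For finite p the singular values tend to 0, so finite-rank operators approximate T in norm. -/
theorem isCompactOperator_of_memSchatten [CompleteSpace E] {p : ℝ≥0∞} (hp : 1 ≤ p) (hpt : p ≠ ∞)
    {T : E →L[ℂ] E} (hT : MemSchatten p T) : IsCompactOperator T := by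
  have hcl : IsClosed {f : E →L[ℂ] E | IsCompactOperator f} := isClosed_setOfPred_isCompactOperator
  have hr : 0 < p.toReal := ENNReal.toReal_pos (zero_lt_one.trans_le hp).ne' hpt
  have hmem : T ∈ closure {f : E →L[ℂ] E | IsCompactOperator f} := by
    refine Metric.mem_closure_iff.mpr fun ε hε => ?_
    have hsum : ∑' n, ‖singularValue T n‖ₑ ^ p.toReal ≠ ∞ := by
      rw [← eLpNorm_count_rpow hp hpt]
      exact (ENNReal.rpow_lt_top_of_nonneg hr.le hT.ne).ne
    have h0 := ENNReal.tendsto_atTop_zero_of_tsum_ne_top hsum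
    have h1 : ∀ᶠ n in Filter.atTop, ‖singularValue T n‖ₑ ^ p.toReal < ENNReal.ofReal ε ^ p.toReal :=
      h0.eventually_lt_const (ENNReal.rpow_pos (by simpa using hε) (by simp))
    obtain ⟨n, hn⟩ := h1.exists
    rw [ENNReal.rpow_lt_rpow_iff hr, enorm_singularValue, ENNReal.ofReal_lt_ofReal_iff hε] at hn
    obtain ⟨⟨F, hF⟩, hlt⟩ := exists_lt_of_ciInf_lt hn
    exact ⟨F, isCompactOperator_of_rank_le hF, by rwa [dist_eq_norm]⟩
  rwa [hcl.closure_eq] at hmem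

theorem singularValue_zero (T : E →L[ℂ] E) : singularValue T 0 = ‖T‖ := by
  refine le_antisymm (singularValue_le_norm T 0) (le_singularValue fun F hF => ?_)
  have h0 : F = 0 := by
    have : Module.rank ℂ (LinearMap.range (F : E →ₗ[ℂ] E)) = 0 := by simpa using! hF
    rw [Submodule.rank_eq_zero, LinearMap.range_eq_bot] at this
    exact ContinuousLinearMap.coe_injective this
  simp [h0]

/-- A compact operator maps some Hilbert basis to an orthogonal family. -/
theorem exists_basis_orthogonal [CompleteSpace E] {T : E →L[ℂ] E} (hT : IsCompactOperator T) :
    ∃ (ι : Type w) (b : HilbertBasis ι ℂ E),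
      Pairwise fun i j => inner ℂ (T (b i)) (T (b j)) = 0 := by
  set A : E →L[ℂ] E := T.adjoint ∘L T with hA
  have hAc : IsCompactOperator A := hT.clm_comp T.adjoint
  have hAs : (A : E →ₗ[ℂ] E).IsSymmetric := fun x y => by
    simp [hA, ContinuousLinearMap.adjoint_inner_left, ContinuousLinearMap.adjoint_inner_right]
  have hbot := ContinuousLinearMap.orthogonalComplement_iSup_eigenspaces_eq_bot hAc hAs
  -- Every eigenspace of T*T, the possibly infinite-dimensional kernel included, is complete and so
  -- has its own Hilbert basis. Gluing these bases diagonalises T*T, which makes the images under T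
  -- orthogonal.
  have hcl : ∀ μ : ℂ, IsClosed (Module.End.eigenspace (A : Module.End ℂ E) μ : Set E) := fun μ => by
    have : (Module.End.eigenspace (A : Module.End ℂ E) μ : Set E) = {x | A x = μ • x} := by
      ext x; simp
    rw [this]
    exact isClosed_eq A.continuous (continuous_const_smul μ)
  have hcomp : ∀ μ : ℂ, CompleteSpace (Module.End.eigenspace (A : Module.End ℂ E) μ) := fun μ =>
    (hcl μ).completeSpace_coe
  choose W β hβ using fun μ : ℂ => exists_hilbertBasis ℂ (Module.End.eigenspace (A : Module.End ℂ E) μ)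
  have hon := hAs.orthogonalFamily_eigenspaces.orthonormal_sigma_orthonormal
    (α := fun μ => W μ) (v_family := fun μ => β μ) fun μ => (β μ).orthonormal
  have hort : (Submodule.span ℂ (Set.range fun a : Σ μ, W μ =>
      (Module.End.eigenspace (A : Module.End ℂ E) a.1).subtypeₗᵢ (β a.1 a.2)))ᗮ = ⊥ := by
    rw [eq_bot_iff, ← hbot]
    intro x hx
    rw [Submodule.mem_orthogonal'] at hx ⊢
    suffices h : (⨆ μ, Module.End.eigenspace (A : Module.End ℂ E) μ) ≤
        LinearMap.ker (innerSL ℂ x : E →ₗ[ℂ] ℂ) from fun u hu => by simpa using h hu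
    refine iSup_le fun μ y hy => ?_
    have h1 := ((β μ).hasSum_repr ⟨y, hy⟩).mapL
      ((innerSL ℂ x).comp (Submodule.subtypeL (Module.End.eigenspace (A : Module.End ℂ E) μ)))
    have h2 : ∀ i, ((innerSL ℂ x).comp (Submodule.subtypeL
        (Module.End.eigenspace (A : Module.End ℂ E) μ))) ((β μ).repr ⟨y, hy⟩ i • β μ i) = 0 := by
      intro i
      have := hx _ (Submodule.subset_span ⟨⟨μ, i⟩, rfl⟩)
      rw [map_smul]
      simpa using Or.inr this
    simp only [h2] at h1
    have := h1.unique hasSum_zero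
    simpa using this
  refine ⟨_, HilbertBasis.mkOfOrthogonalEqBot hon hort, fun i j hij => ?_⟩
  rw [HilbertBasis.coe_mkOfOrthogonalEqBot]
  have h1 : ∀ x y : E, inner ℂ (T x) (T y) = inner ℂ (A x) y := fun x y => by
    simp [hA, ContinuousLinearMap.adjoint_inner_left]
  have h2 : ∀ a : Σ μ, W μ, A ((Module.End.eigenspace (A : Module.End ℂ E) a.1).subtypeₗᵢ
      (β a.1 a.2)) = a.1 • (Module.End.eigenspace (A : Module.End ℂ E) a.1).subtypeₗᵢ
      (β a.1 a.2) := fun a => Module.End.mem_eigenspace_iff.mp (β a.1 a.2).2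
  beta_reduce
  rw [h1, h2, inner_smul_left, hon.2 hij, mul_zero]

/-- A singular value decomposition `T = ∑ sᵢ uᵢ ⊗ vᵢ`, with coefficients of arbitrary phase. -/
structure IsSVD {ι : Type*} (s : ι → ℂ) (u v : ι → E) (T : E →L[ℂ] E) : Prop where
  left : Orthonormal ℂ u
  right : Orthonormal ℂ v
  hasSum : ∀ x, HasSum (fun i => (s i * inner ℂ (v i) x) • u i) (T x)

/-- Induction on the number of indices, removing one with the smallest ‖T b i‖: the n + 1 basis
vectors at hand have orthogonal images of at least that norm, so it is at most the singular value of
index n. -/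
theorem sum_enorm_rpow_le {ι : Type*} {b : ι → E} (hb : Orthonormal ℂ b) {T : E →L[ℂ] E}
    (hT : Pairwise fun i j => inner ℂ (T (b i)) (T (b j)) = 0) {r : ℝ} (hr : 0 ≤ r) (n : ℕ) :
    ∀ I : Finset ι, I.card = n →
      ∑ i ∈ I, ‖T (b i)‖ₑ ^ r ≤ ∑ k ∈ Finset.range n, ‖singularValue T k‖ₑ ^ r := by
  classical
  induction n with
  | zero => intro I hI; simp [Finset.card_eq_zero.mp hI]
  | succ n ih =>
    intro I hI
    obtain ⟨i0, hi0, hmin⟩ := Finset.exists_min_image I (fun i => ‖T (b i)‖)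
      (Finset.card_pos.mp (by omega))
    rw [← Finset.sum_erase_add I _ hi0, Finset.sum_range_succ]
    refine add_le_add (ih _ (by rw [Finset.card_erase_of_mem hi0, hI]; rfl)) ?_
    gcongr
    rw [enorm_singularValue, ← ofReal_norm]
    refine ENNReal.ofReal_le_ofReal ?_
    let e := I.equivFinOfCardEq hI
    have hinj : Function.Injective fun k => (e.symm k : ι) :=
      Subtype.val_injective.comp e.symm.injective
    exact le_singularValue_of_orthogonal (v := fun k => b (e.symm k)) (hb.comp _ hinj)
      (fun k l hkl => hT (hinj.ne hkl)) (norm_nonneg _) fun k => hmin _ (e.symm k).2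

/-- Take u as the normalised T (b i) and drop the indices with T (b i) = 0; countably many remain
because the p-th powers of their norms have finite sum. The bound covers all finite exponents at
once, since Hölder for the trace needs exponents 1 and p for the same decomposition. -/
theorem exists_isSVD [CompleteSpace E] {p : ℝ≥0∞} (hp : 1 ≤ p) (hpt : p ≠ ∞) {T : E →L[ℂ] E}
    (hT : MemSchatten p T) : ∃ (ι : Type w) (_ : Countable ι) (s : ι → ℂ) (u v : ι → E),
      IsSVD s u v T ∧ ∀ r : ℝ≥0∞, 1 ≤ r → r ≠ ∞ →
        ∑' i, ‖s i‖ₑ ^ r.toReal ≤ schattenNorm r T ^ r.toReal := by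
  obtain ⟨ι, b, hb⟩ := exists_basis_orthogonal (isCompactOperator_of_memSchatten hp hpt hT)
  let J := {i : ι // T (b i) ≠ 0}
  have hbound : ∀ r : ℝ≥0∞, 1 ≤ r → r ≠ ∞ →
      ∑' i, ‖T (b i)‖ₑ ^ r.toReal ≤ schattenNorm r T ^ r.toReal := fun r hr hrt => by
    rw [ENNReal.tsum_eq_iSup_sum, schattenNorm, eLpNorm_count_rpow hr hrt]
    exact iSup_le fun I => (sum_enorm_rpow_le b.orthonormal hb ENNReal.toReal_nonneg _ I rfl).trans
      (ENNReal.sum_le_tsum _)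
  have hpr : 0 < p.toReal := ENNReal.toReal_pos (zero_lt_one.trans_le hp).ne' hpt
  have hJ : Countable J := by
    have h1 : ∑' i, ‖T (b i)‖ₑ ^ p.toReal ≠ ∞ :=
      ((hbound p hp hpt).trans_lt (ENNReal.rpow_lt_top_of_nonneg hpr.le hT.ne)).ne
    have h2 := (ENNReal.summable_toReal h1).countable_support
    refine Set.Countable.to_subtype (h2.mono fun i hi => ?_)
    simp only [Function.mem_support, ENNReal.toReal_ne_zero]
    refine ⟨?_, (ENNReal.rpow_lt_top_of_nonneg hpr.le enorm_ne_top).ne⟩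
    have hi' : T (b i) ≠ 0 := hi
    simp [hi', hpr.not_gt]
  refine ⟨J, hJ, fun i => (‖T (b i.1)‖ : ℂ), fun i => ((‖T (b i.1)‖ : ℂ)⁻¹) • T (b i.1),
    fun i => b i.1, ⟨⟨fun i => ?_, fun i j hij => ?_⟩,
    b.orthonormal.comp _ Subtype.val_injective, fun x => ?_⟩, fun r hr hrt => ?_⟩
  · rw [norm_smul, norm_inv, Complex.norm_real, norm_norm,
      inv_mul_cancel₀ (norm_ne_zero_iff.mpr i.2)]
  · beta_reduce
    rw [inner_smul_left, inner_smul_right, hb (Subtype.val_injective.ne hij), mul_zero, mul_zero]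
  · have h1 := (b.hasSum_repr x).mapL T
    have h2 : HasSum ((fun i => T (b.repr x i • b i)) ∘ (Subtype.val : J → ι)) (T x) := by
      rw [Subtype.val_injective.hasSum_iff]
      · exact h1
      · intro i hi
        have : T (b i) = 0 := by
          by_contra h0
          exact hi ⟨⟨i, h0⟩, rfl⟩
        simp [this]
    refine h2.congr_fun fun i => ?_
    have hi : (‖T (b i.1)‖ : ℂ) ≠ 0 := by simpa using i.2
    rw [Function.comp_apply, smul_smul, map_smul, HilbertBasis.repr_apply_apply, mul_right_comm,
      mul_inv_cancel₀ hi, one_mul]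
  · calc _ ≤ ∑' i, ‖T (b i)‖ₑ ^ r.toReal := by
          have := ENNReal.tsum_comp_le_tsum_of_injective (Subtype.val_injective (p := fun i => T (b i) ≠ 0))
            (fun i => ‖T (b i)‖ₑ ^ r.toReal)
          have e : ∀ i : J, ‖((‖T (b i.1)‖ : ℝ) : ℂ)‖ₑ = ‖T (b i.1)‖ₑ := fun i => by
            rw [← ofReal_norm, Complex.norm_real, norm_norm, ofReal_norm]
          simp only [e]
          exact this
      _ ≤ _ := hbound r hr hrt

theorem IsSVD.hasSum_inner {ι : Type*} {s : ι → ℂ} {u v : ι → E} {T : E →L[ℂ] E}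
    (h : IsSVD s u v T) (x y : E) :
    HasSum (fun i => s i * (inner ℂ x (u i) * inner ℂ (v i) y)) (inner ℂ x (T y)) := by
  have := (h.hasSum y).mapL (innerSL ℂ x)
  simpa [inner_smul_right, mul_comm, mul_left_comm, mul_assoc] using this

theorem IsSVD.enorm_inner_le {ι : Type*} {s : ι → ℂ} {u v : ι → E} {T : E →L[ℂ] E}
    (h : IsSVD s u v T) (x y : E) :
    ‖inner ℂ x (T y)‖ₑ ≤ ∑' i, ‖inner ℂ x (u i)‖ₑ * ‖inner ℂ (v i) y‖ₑ * ‖s i‖ₑ := by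
  rw [← (h.hasSum_inner x y).tsum_eq]
  refine enorm_tsum_le_tsum_enorm.trans_eq ?_
  simp [mul_comm]

/-- Matrix coefficients of T arise from the sequence s through the kernel |⟨a_k, u_i⟩| |⟨v_i, b_k⟩|,
both of whose marginals are at most 1 by Bessel; Schur's test applies. -/
theorem IsSVD.pairNorm_le {ι : Type*} [Countable ι] [MeasurableSpace ι] [DiscreteMeasurableSpace ι]
    {s : ι → ℂ} {u v : ι → E} {T : E →L[ℂ] E} (h : IsSVD s u v T) {p : ℝ≥0∞} (hp : 1 ≤ p) :
    pairNorm p T ≤ eLpNorm s p Measure.count := by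
  refine QHA.pairNorm_le fun n a b ha hb => ?_
  have := eLpNorm_le_of_kernel (μ := (Measure.count : Measure (Fin n)))
    (ν := (Measure.count : Measure ι))
    (W := fun k i => ‖inner ℂ (a k) (u i)‖ₑ * ‖inner ℂ (v i) (b k)‖ₑ)
    (c := 1) (F := fun k => inner ℂ (a k) (T (b k))) (g := s) (Measurable.of_discrete)
    (fun k => by
      rw [lintegral_count]
      have h1 := tsum_enorm_inner_mul_le h.left h.right (a k) (b k)
      simp only [enorm_inner_comm (a k), enorm_inner_comm (v _)]
      simpa [← ofReal_norm, ha.1 k, hb.1 k] using h1)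
    (fun i => by
      rw [lintegral_count]
      have h1 := tsum_enorm_inner_mul_le ha hb (u i) (v i)
      simpa [← ofReal_norm, h.left.1 i, h.right.1 i] using h1)
    (Measurable.of_discrete).aestronglyMeasurable
    (fun k => by rw [lintegral_count]; exact h.enorm_inner_le _ _) hp
  simpa using this

theorem eLpNorm_count_le_of_tsum_le {ι : Type*} [MeasurableSpace ι] [MeasurableSingletonClass ι]
    {p : ℝ≥0∞} (hp : 1 ≤ p) (hpt : p ≠ ∞) {s : ι → ℂ} {C : ℝ≥0∞}
    (h : ∑' i, ‖s i‖ₑ ^ p.toReal ≤ C ^ p.toReal) : eLpNorm s p Measure.count ≤ C := by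
  have hpr : 0 < p.toReal := ENNReal.toReal_pos (zero_lt_one.trans_le hp).ne' hpt
  rwa [← ENNReal.rpow_le_rpow_iff hpr, eLpNorm_count_rpow hp hpt]

theorem pairNorm_le_schattenNorm [CompleteSpace E] {p : ℝ≥0∞} (hp : 1 ≤ p) (T : E →L[ℂ] E) :
    pairNorm p T ≤ schattenNorm p T := by
  rcases eq_or_ne (schattenNorm p T) ∞ with htop | htop
  · rw [htop]; exact le_top
  rcases eq_or_ne p ∞ with rfl | hpt
  · refine (pairNorm_top_le T).trans ?_
    rw [schattenNorm, eLpNorm_exponent_top]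
    have : ‖T‖ₑ = ‖singularValue T 0‖ₑ := by
      rw [singularValue_zero, Real.enorm_of_nonneg (norm_nonneg _), ofReal_norm]
    rw [this]
    -- Counting measure has no nonempty null set, so the essential supremum dominates the term of
    -- index 0, which is ‖T‖.
    have h1 := enorm_ae_le_eLpNormEssSup (singularValue T) Measure.count
    rw [Filter.eventually_iff, mem_ae_iff, Measure.count_eq_zero_iff] at h1
    by_contra h2
    have : (0 : ℕ) ∈ ({n | ‖singularValue T n‖ₑ ≤ eLpNormEssSup (singularValue T) Measure.count}ᶜ
      : Set ℕ) := h2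
    rw [h1] at this
    exact this
  obtain ⟨ι, _, s, u, v, h, hs⟩ := exists_isSVD hp hpt (lt_top_iff_ne_top.mpr htop)
  let _ : MeasurableSpace ι := ⊤
  exact (h.pairNorm_le hp).trans (eLpNorm_count_le_of_tsum_le hp hpt (hs p hp hpt))

theorem memSchatten_iff [CompleteSpace E] {p : ℝ≥0∞} (hp : 1 ≤ p) (T : E →L[ℂ] E) :
    MemSchatten p T ↔ pairNorm p T < ∞ :=
  ⟨fun h => (pairNorm_le_schattenNorm hp T).trans_lt h, fun h =>
    (schattenNorm_le_pairNorm hp T).trans_lt (ENNReal.mul_lt_top (by simp) h)⟩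

end SVD

/-! ### Trace class as nuclear operators, Hölder for the trace, finite-rank approximation -/

section Nuclear

universe w
variable {E : Type w} [NormedAddCommGroup E] [InnerProductSpace ℂ E] [CompleteSpace E]

/-- The countable index set is injected into ℕ and the family extended by zero, which turns an
absolutely summable decomposition into a nuclear series. -/
theorem IsSVD.nuclear {ι : Type*} [Countable ι] {s : ι → ℂ} {u v : ι → E} {A : E →L[ℂ] E}
    (h : IsSVD s u v A) (hs : ∑' i, ‖s i‖ₑ ≠ ∞) :
    (∃ u' v', NuclearSum u' v' A ∧ ∑' n, ‖u' n‖ₑ * ‖v' n‖ₑ = ∑' i, ‖s i‖ₑ) ∧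
      ∀ T : E →L[ℂ] E, HasSum (fun i => s i * inner ℂ (v i) (T (u i))) (trace (T ∘L A)) := by
  obtain ⟨f, hf⟩ := exists_injective_nat ι
  set u' : ℕ → E := Function.extend f (fun i => s i • u i) 0 with hu'
  set v' : ℕ → E := Function.extend f v 0 with hv'
  have eu : ∀ i, u' (f i) = s i • u i := fun i => hf.extend_apply _ _ i
  have ev : ∀ i, v' (f i) = v i := fun i => hf.extend_apply _ _ i
  have e0 : ∀ n, n ∉ Set.range f → u' n = 0 := fun n hn => by
    rw [hu', Function.extend_apply' _ _ _ (by simpa using hn)]; rfl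
  have hnorm : ∑' n, ‖u' n‖ₑ * ‖v' n‖ₑ = ∑' i, ‖s i‖ₑ := by
    rw [← hf.tsum_eq (f := fun n => ‖u' n‖ₑ * ‖v' n‖ₑ)]
    · refine tsum_congr fun i => ?_
      rw [eu, ev, enorm_smul, ← ofReal_norm (u i), ← ofReal_norm (v i), h.left.1, h.right.1]
      simp
    · intro n hn
      by_contra h0
      simp [e0 n h0] at hn
  have hN : NuclearSum u' v' A := by
    refine NuclearSum.of_apply ?_ fun x => ?_
    · rw [← hnorm] at hs
      simpa using ENNReal.summable_toReal hs
    · rw [← hf.hasSum_iff]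
      · refine (h.hasSum x).congr_fun fun i => ?_
        simp only [Function.comp_apply, eu, ev]
        rw [smul_smul, mul_comm]
      · intro n hn; simp [e0 n hn]
  refine ⟨⟨u', v', hN, hnorm⟩, fun T => ?_⟩
  have h1 := hN.trace_comp_left T
  rw [← hf.hasSum_iff (fun n hn => by simp [e0 n hn])] at h1
  refine h1.congr_fun fun i => ?_
  simp only [Function.comp_apply, eu, ev]
  rw [map_smul, inner_smul_right]

theorem exists_nuclearSum {A : E →L[ℂ] E} (hA : MemSchatten 1 A) :
    ∃ u v, NuclearSum u v A ∧ ∑' n, ‖u n‖ₑ * ‖v n‖ₑ ≤ schattenNorm 1 A := by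
  obtain ⟨ι, _, s, u, v, h, hs⟩ := exists_isSVD le_rfl ENNReal.one_ne_top hA
  have h1 := hs 1 le_rfl ENNReal.one_ne_top
  simp only [ENNReal.toReal_one, ENNReal.rpow_one] at h1
  obtain ⟨⟨u', v', hN, hn⟩, -⟩ := h.nuclear (h1.trans_lt hA).ne
  exact ⟨u', v', hN, hn.trans_le h1⟩

theorem isNuclear_iff {A : E →L[ℂ] E} : IsNuclear A ↔ MemSchatten 1 A := by
  refine ⟨fun ⟨u, v, h⟩ => ?_, fun h => ?_⟩
  · rw [memSchatten_iff le_rfl]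
    exact (h.pairNorm_le le_rfl).trans_lt (lt_top_iff_ne_top.mpr h.tsum_enorm_ne_top)
  · obtain ⟨u, v, h, -⟩ := exists_nuclearSum h
    exact ⟨u, v, h⟩

theorem IsNuclear.pairNorm_lt_top {A : E →L[ℂ] E} (hA : IsNuclear A) {p : ℝ≥0∞} (hp : 1 ≤ p) :
    pairNorm p A < ∞ := by
  obtain ⟨u, v, h⟩ := hA
  exact (h.pairNorm_le hp).trans_lt (lt_top_iff_ne_top.mpr h.tsum_enorm_ne_top)

theorem IsNuclear.memSchatten {A : E →L[ℂ] E} (hA : IsNuclear A) {p : ℝ≥0∞} (hp : 1 ≤ p) :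
    MemSchatten p A := (memSchatten_iff hp A).mpr (hA.pairNorm_lt_top hp)

/-- The Schatten class as a subspace. -/
def schattenSubmodule (E : Type w) [NormedAddCommGroup E] [InnerProductSpace ℂ E] [CompleteSpace E]
    {p : ℝ≥0∞} (hp : 1 ≤ p) : Submodule ℂ (E →L[ℂ] E) where
  carrier := {A | pairNorm p A < ∞}
  add_mem' hA hB := (pairNorm_add_le hp _ _).trans_lt (ENNReal.add_lt_top.mpr ⟨hA, hB⟩)
  zero_mem' := by simp [pairNorm_zero]
  smul_mem' c A hA := (pairNorm_smul_le p c A).trans_lt (ENNReal.mul_lt_top enorm_lt_top hA)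

theorem mem_schattenSubmodule {p : ℝ≥0∞} (hp : 1 ≤ p) {A : E →L[ℂ] E} :
    A ∈ schattenSubmodule E hp ↔ MemSchatten p A := (memSchatten_iff hp A).symm

theorem mem_schattenSubmodule_one {A : E →L[ℂ] E} :
    A ∈ schattenSubmodule E le_rfl ↔ IsNuclear A := by
  rw [mem_schattenSubmodule, isNuclear_iff]

theorem IsNuclear.smul {A : E →L[ℂ] E} (hA : IsNuclear A) (c : ℂ) : IsNuclear (c • A) := by
  rw [← mem_schattenSubmodule_one] at *; exact Submodule.smul_mem _ c hA

theorem IsNuclear.sub {A B : E →L[ℂ] E} (hA : IsNuclear A) (hB : IsNuclear B) :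
    IsNuclear (A - B) := by
  rw [← mem_schattenSubmodule_one] at *; exact Submodule.sub_mem _ hA hB

theorem IsNuclear.trace_sub {A B : E →L[ℂ] E} (hA : IsNuclear A) (hB : IsNuclear B) :
    trace (A - B) = trace A - trace B := by
  rw [trace_eq_tsum (A - B), ← (hA.hasSum_trace.sub hB.hasSum_trace).tsum_eq]
  simp [inner_sub_right]

theorem IsNuclear.isCompactOperator {A : E →L[ℂ] E} (hA : IsNuclear A) : IsCompactOperator A :=
  isCompactOperator_of_memSchatten le_rfl ENNReal.one_ne_top (isNuclear_iff.mp hA)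

omit [CompleteSpace E] in
theorem eLpNorm_inner_le_pairNorm {ι : Type*} [Countable ι] [MeasurableSpace ι]
    [DiscreteMeasurableSpace ι] {q : ℝ≥0∞} (hq : 1 ≤ q) (T : E →L[ℂ] E) {u v : ι → E}
    (hu : Orthonormal ℂ u) (hv : Orthonormal ℂ v) :
    eLpNorm (fun i => inner ℂ (v i) (T (u i))) q Measure.count ≤ pairNorm q T := by
  rcases eq_or_ne q ∞ with rfl | hqt
  · rw [eLpNorm_exponent_top]
    exact essSup_le_of_ae_le _ (Filter.Eventually.of_forall fun i =>
      enorm_inner_le_pairNorm hq T (hv.1 i) (hu.1 i))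
  refine eLpNorm_count_le_of_tsum_le hq hqt ?_
  rw [ENNReal.tsum_eq_iSup_sum]
  refine iSup_le fun I => ?_
  have hinj : Function.Injective fun k : Fin I.card => (I.equivFin.symm k : ι) :=
    Subtype.val_injective.comp I.equivFin.symm.injective
  have h := le_pairNorm q T (hv.comp _ hinj) (hu.comp _ hinj)
  calc ∑ i ∈ I, ‖inner ℂ (v i) (T (u i))‖ₑ ^ q.toReal
      = ∑ k : Fin I.card, ‖inner ℂ (v (I.equivFin.symm k)) (T (u (I.equivFin.symm k)))‖ₑ ^ q.toReal := by
        rw [← Finset.sum_coe_sort I]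
        exact (Equiv.sum_comp I.equivFin.symm (fun i : I =>
          ‖inner ℂ (v i) (T (u i))‖ₑ ^ q.toReal)).symm
    _ = eLpNorm (fun k : Fin I.card =>
          inner ℂ (v (I.equivFin.symm k)) (T (u (I.equivFin.symm k)))) q Measure.count ^ q.toReal := by
        rw [eLpNorm_count_rpow hq hqt, tsum_fintype]
    _ ≤ _ := ENNReal.rpow_le_rpow h ENNReal.toReal_nonneg

/-- Hölder's inequality for the trace. -/
theorem IsNuclear.enorm_trace_le {A : E →L[ℂ] E} (hA : IsNuclear A) {p q : ℝ≥0∞} (hp : 1 ≤ p)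
    (hpt : p ≠ ∞) (hpq : p⁻¹ + q⁻¹ = 1) (T : E →L[ℂ] E) :
    ‖trace (T ∘L A)‖ₑ ≤ schattenNorm p A * pairNorm q T := by
  obtain ⟨ι, _, s, u, v, h, hs⟩ := exists_isSVD le_rfl ENNReal.one_ne_top (isNuclear_iff.mp hA)
  let _ : MeasurableSpace ι := ⊤
  have hconj : ENNReal.HolderConjugate p q := ENNReal.holderConjugate_iff.mpr hpq
  have hq : 1 ≤ q := ENNReal.HolderConjugate.one_le q p
  have h1 := hs 1 le_rfl ENNReal.one_ne_top
  simp only [ENNReal.toReal_one, ENNReal.rpow_one] at h1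
  -- The trace becomes ∑ s_i ⟨v_i, T u_i⟩, to which Hölder for sequences applies.
  have h2 := (h.nuclear (h1.trans_lt (isNuclear_iff.mp hA)).ne).2 T
  rw [← h2.tsum_eq]
  refine enorm_tsum_le_tsum_enorm.trans ?_
  have h3 := eLpNorm_smul_le_mul_eLpNorm (p := p) (q := q) (r := 1)
    (μ := (Measure.count : Measure ι)) (φ := s)
    (f := fun i => inner ℂ (v i) (T (u i))) (Measurable.of_discrete).aestronglyMeasurable
    (Measurable.of_discrete).aestronglyMeasurable
  rw [eLpNorm_one_eq_lintegral_enorm, lintegral_count] at h3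
  refine h3.trans (mul_le_mul' ?_ (eLpNorm_inner_le_pairNorm hq T h.left h.right))
  exact eLpNorm_count_le_of_tsum_le hp hpt (hs p hp hpt)

/-- Operators of finite rank are dense in the Schatten classes. -/
theorem exists_isNuclear_pairNorm_sub_lt {p : ℝ≥0∞} (hp : 1 ≤ p) (hpt : p ≠ ∞) {T : E →L[ℂ] E}
    (hT : MemSchatten p T) {ε : ℝ≥0∞} (hε : 0 < ε) :
    ∃ F, IsNuclear F ∧ pairNorm p (T - F) < ε := by
  classical
  obtain ⟨ι, _, s, u, v, h, hs⟩ := exists_isSVD hp hpt hT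
  let _ : MeasurableSpace ι := ⊤
  have hpr : 0 < p.toReal := ENNReal.toReal_pos (zero_lt_one.trans_le hp).ne' hpt
  have hfin : ∑' i, ‖s i‖ₑ ^ p.toReal ≠ ∞ :=
    ((hs p hp hpt).trans_lt (ENNReal.rpow_lt_top_of_nonneg hpr.le hT.ne)).ne
  have hev := (ENNReal.tendsto_tsum_compl_atTop_zero hfin).eventually_lt_const
    (ENNReal.rpow_pos_of_nonneg hε hpr.le : 0 < ε ^ p.toReal)
  obtain ⟨I, hI⟩ := hev.exists
  set F : E →L[ℂ] E := ∑ i ∈ I, s i • rankOne ℂ (u i) (v i) with hF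
  refine ⟨F, ?_, ?_⟩
  · rw [← mem_schattenSubmodule_one]
    exact Submodule.sum_mem _ fun i _ => Submodule.smul_mem _ _
      (mem_schattenSubmodule_one.mpr (IsNuclear.rankOne _ _))
  -- The remainder keeps the same vectors, with coefficients set to zero on I, so its norm is
  -- controlled by a tail of the series.
  have hsvd : IsSVD (fun i => if i ∈ I then 0 else s i) u v (T - F) := by
    refine ⟨h.left, h.right, fun x => ?_⟩
    have h1 : HasSum (fun i => if i ∈ I then (s i * inner ℂ (v i) x) • u i else 0) (F x) := by
      have := hasSum_sum_of_ne_finset_zero (s := I) (L := SummationFilter.unconditional _)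
        (f := fun i => if i ∈ I then (s i * inner ℂ (v i) x) • u i else 0) (by
          intro i hi; simp [hi])
      convert! this using 1
      rw [hF, sum_apply, Finset.sum_congr rfl]
      intro i hi
      simp [hi, smul_smul]
    refine ((h.hasSum x).sub h1).congr_fun fun i => ?_
    split_ifs <;> simp
  refine (hsvd.pairNorm_le hp).trans_lt ?_
  rw [← ENNReal.rpow_lt_rpow_iff hpr, eLpNorm_count_rpow hp hpt]
  refine lt_of_eq_of_lt ?_ hI
  have e : ∀ i, ‖(if i ∈ I then 0 else s i)‖ₑ ^ p.toReal =
      ({i | i ∉ I} : Set ι).indicator (fun i => ‖s i‖ₑ ^ p.toReal) i := fun i => by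
    by_cases hi : i ∈ I <;> simp [hi, hpr]
  simp only [e]
  exact (tsum_subtype ({i | i ∉ I} : Set ι) fun i => ‖s i‖ₑ ^ p.toReal).symm

/-- Project onto the span of a finite ε/2-net y of the image of the unit ball: T x - P T x = P^⊥ (T
x - y) for a net point y near T x. -/
theorem exists_isNuclear_norm_sub_lt {T : E →L[ℂ] E} (hT : IsCompactOperator T) {ε : ℝ}
    (hε : 0 < ε) : ∃ F, IsNuclear F ∧ ‖T - F‖ < ε := by
  have hK := hT.isCompact_closure_image_closedBall 1
  obtain ⟨t, -, htf, ht⟩ := Metric.finite_approx_of_totallyBounded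
    hK.totallyBounded (ε / 2) (by positivity)
  set U := Submodule.span ℂ t with hU
  have hfd : FiniteDimensional ℂ U := FiniteDimensional.span_of_finite ℂ htf
  have hproj : U.HasOrthogonalProjection := inferInstance
  refine ⟨U.starProjection ∘L T, ?_, ?_⟩
  · refine IsNuclear.comp_right ?_ T
    let b := stdOrthonormalBasis ℂ U
    have : U.starProjection = ∑ i, rankOne ℂ (b i : E) (b i : E) := by
      ext x
      rw [Submodule.starProjection_apply, b.orthogonalProjectionOnto_apply_eq_sum]
      simp
    rw [this, ← mem_schattenSubmodule_one]
    exact Submodule.sum_mem _ fun i _ => mem_schattenSubmodule_one.mpr (IsNuclear.rankOne _ _)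
  · refine lt_of_le_of_lt (ContinuousLinearMap.opNorm_le_of_unit_norm (C := ε / 2) (by positivity)
      fun x hx => ?_) (by linarith)
    have hmem : T x ∈ closure (T '' Metric.closedBall 0 1) :=
      subset_closure ⟨x, by simp [hx], rfl⟩
    obtain ⟨y, hy, hxy⟩ := Set.mem_iUnion₂.mp (ht hmem)
    have hyU : U.starProjection y = y := Submodule.starProjection_eq_self_iff.mpr
      (Submodule.subset_span hy)
    have e : (T - U.starProjection ∘L T) x = Uᗮ.starProjection (T x - y) := by
      rw [Submodule.starProjection_orthogonal]
      simp [hyU]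
    rw [e]
    refine (Submodule.norm_starProjection_apply_le _ _).trans ?_
    rw [← dist_eq_norm]
    exact hxy.le

end Nuclear

/-! ### Separation from subspaces -/

section HahnBanach

/-- A norming functional for the class of x in V/D, pulled back to V. The positive distance makes
that class nonzero in norm even though D need not be closed and V is only seminormed. -/
theorem exists_dual_of_norm_sub_ge {V : Type*} [SeminormedAddCommGroup V] [NormedSpace ℂ V]
    (D : Submodule ℂ V) {x : V} {ε : ℝ} (hε : 0 < ε) (hx : ∀ y ∈ D, ε ≤ ‖x - y‖) :
    ∃ f : V →ₗ[ℂ] ℂ, (∀ y ∈ D, f y = 0) ∧ f x ≠ 0 ∧ ∀ y, ‖f y‖ ≤ ‖y‖ := by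
  have h0 : ε ≤ ‖D.mkQ x‖ := by
    by_contra! h
    obtain ⟨m, hm, hlt⟩ := QuotientAddGroup.exists_norm_mk_lt (S := D.toAddSubgroup) (D.mkQ x)
      (sub_pos.mpr h)
    have hmx : x - m ∈ D := by
      rw [← Submodule.Quotient.eq]
      exact hm.symm
    have := hx _ hmx
    rw [sub_sub_cancel] at this
    exact absurd (hlt.trans_eq (add_sub_cancel _ _)) (not_lt.mpr this)
  obtain ⟨g, hg, hgx⟩ := exists_dual_vector ℂ (D.mkQ x) (hε.trans_le h0).ne'
  refine ⟨g.toLinearMap ∘ₗ D.mkQ, fun y hy => ?_, ?_, fun y => ?_⟩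
  · have : D.mkQ y = 0 := (Submodule.Quotient.mk_eq_zero D).mpr hy
    simp [this]
  · change g (D.mkQ x) ≠ 0
    rw [hgx]
    simpa using (hε.trans_le h0).ne'
  · refine (g.le_opNorm _).trans ?_
    rw [hg, one_mul]
    exact Submodule.Quotient.norm_mk_le D y

/-- The seminorm is installed as a local norm structure, so that one space, the trace class, can
carry the p-norm for every p without completion. -/
theorem Seminorm.exists_dual_of_sub_ge {V : Type*} [AddCommGroup V] [Module ℂ V]
    (n : Seminorm ℂ V) (D : Submodule ℂ V) {x : V} {ε : ℝ} (hε : 0 < ε)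
    (hx : ∀ y ∈ D, ε ≤ n (x - y)) :
    ∃ f : V →ₗ[ℂ] ℂ, (∀ y ∈ D, f y = 0) ∧ f x ≠ 0 ∧ ∀ y, ‖f y‖ ≤ n y := by
  let _ : SeminormedAddCommGroup V := n.toAddGroupSeminorm.toSeminormedAddCommGroup
  let _ : NormedSpace ℂ V := ⟨fun c y => (map_smul_eq_mul n c y).le⟩
  exact exists_dual_of_norm_sub_ge D hε hx

/-- Finite-dimensional separation in ℂ^ι: a point outside the image of D is detected by a linear
functional, that is, by a combination of the L i which kills D. It yields weak-* density with exact
agreement on finitely many functionals. -/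
theorem exists_mem_eq_of_annihilator {V ι : Type*} [Finite ι] [AddCommGroup V] [Module ℂ V]
    (L : ι → V →ₗ[ℂ] ℂ) (D : Submodule ℂ V)
    (h : ∀ c : ι → ℂ, (∀ d ∈ D, ∑ᶠ i, c i * L i d = 0) → ∀ x, ∑ᶠ i, c i * L i x = 0) (x : V) :
    ∃ d ∈ D, ∀ i, L i d = L i x := by
  classical
  have := Fintype.ofFinite ι
  by_contra! hne
  have hx : LinearMap.pi L x ∉ D.map (LinearMap.pi L) := by
    rintro ⟨d, hd, hdx⟩
    obtain ⟨i, hi⟩ := hne d hd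
    exact hi (congrFun hdx i)
  obtain ⟨f, hfx, hf⟩ := Submodule.exists_le_ker_of_notMem hx
  have e : ∀ y, f (LinearMap.pi L y) = ∑ᶠ i, f (Pi.single i 1) * L i y := fun y => by
    rw [finsum_eq_sum_of_fintype, LinearMap.pi_apply_eq_sum_univ f]
    refine Finset.sum_congr rfl fun i _ => ?_
    rw [smul_eq_mul, mul_comm, LinearMap.pi_apply]
    congr 2
    ext j
    simp [Pi.single_apply, eq_comm]
  refine hfx ?_
  rw [e]
  refine h _ (fun d hd => ?_) x
  rw [← e]
  exact hf ⟨d, hd, rfl⟩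

end HahnBanach

/-! ### Operators from sesquilinear forms, and the converse of Hölder -/

section Representation

variable {E : Type*} [NormedAddCommGroup E] [InnerProductSpace ℂ E] [CompleteSpace E]

theorem exists_operator_of_sesquilinear (B : E → E → ℂ) {C : ℝ}
    (h1 : ∀ v v' u, B (v + v') u = B v u + B v' u)
    (h2 : ∀ (c : ℂ) v u, B (c • v) u = starRingEnd ℂ c * B v u)
    (h3 : ∀ v u u', B v (u + u') = B v u + B v u')
    (h4 : ∀ (c : ℂ) v u, B v (c • u) = c * B v u)
    (hC : ∀ v u, ‖B v u‖ ≤ C * ‖v‖ * ‖u‖) : ∃ T : E →L[ℂ] E, ∀ v u, inner ℂ v (T u) = B v u := by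
  let L : E →ₗ⋆[ℂ] E →ₗ[ℂ] ℂ := LinearMap.mk₂'ₛₗ (starRingEnd ℂ) (RingHom.id ℂ) B h1 h2 h3 h4
  let M : E →L⋆[ℂ] E →L[ℂ] ℂ := L.mkContinuous₂ C hC
  -- The representation theorem puts the operator in the first slot of the inner product; the
  -- adjoint moves it to the second.
  refine ⟨(InnerProductSpace.continuousLinearMapOfBilin M).adjoint, fun v u => ?_⟩
  rw [ContinuousLinearMap.adjoint_inner_right,
    InnerProductSpace.continuousLinearMapOfBilin_apply]
  rfl

theorem exists_phase (c : ℂ) : ∃ θ : ℂ, ‖θ‖ ≤ 1 ∧ θ * c = ‖c‖ := by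
  rcases eq_or_ne c 0 with rfl | hc
  · exact ⟨0, by simp, by simp⟩
  · have hn : (‖c‖ : ℂ) ≠ 0 := by simpa using hc
    refine ⟨starRingEnd ℂ c / ‖c‖, ?_, ?_⟩
    · rw [norm_div, RCLike.norm_conj, Complex.norm_real, norm_norm,
        div_self (norm_ne_zero_iff.mpr hc)]
    · rw [div_mul_eq_mul_div, mul_comm, Complex.mul_conj, Complex.normSq_eq_norm_sq]
      push_cast
      field_simp

/-- Converse of Hölder on finite sequences. Multiplying by phases reduces the test to nonnegative
weights: a unit vector for q = ∞, the constant 1 for q = 1, and the extremal weight of Hölder in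
between. -/
theorem eLpNorm_le_of_forall_sum_mul_le {n : ℕ} {p q : ℝ≥0∞} (hp : 1 ≤ p) (hpq : p⁻¹ + q⁻¹ = 1)
    {c : Fin n → ℂ} {C : ℝ≥0∞}
    (h : ∀ γ : Fin n → ℂ, ‖∑ k, γ k * c k‖ₑ ≤ C * eLpNorm γ p Measure.count) :
    eLpNorm c q Measure.count ≤ C := by
  choose θ hθ1 hθ2 using fun k => exists_phase (c k)
  have hconj : ENNReal.HolderConjugate p q := ENNReal.holderConjugate_iff.mpr hpq
  have hq : 1 ≤ q := ENNReal.HolderConjugate.one_le q p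
  have key : ∀ g : Fin n → NNReal,
      ((∑ k, g k * ‖c k‖₊ : NNReal) : ℝ≥0∞) ≤ C * eLpNorm (fun k => (g k : ℝ)) p Measure.count := by
    intro g
    have e : ∑ k, (g k * θ k : ℂ) * c k = ((∑ k, g k * ‖c k‖₊ : NNReal) : ℝ) := by
      push_cast
      refine Finset.sum_congr rfl fun k _ => ?_
      rw [mul_assoc, hθ2]
    have := h fun k => g k * θ k
    rw [e] at this
    refine le_trans (le_of_eq ?_) (this.trans ?_)
    · rw [← ofReal_norm, Complex.norm_real, NNReal.norm_eq, ENNReal.ofReal_coe_nnreal]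
    · gcongr
      refine eLpNorm_mono fun k => ?_
      rw [norm_mul, Complex.norm_real]
      exact mul_le_of_le_one_right (norm_nonneg _) (hθ1 k)
  rcases eq_or_ne q ∞ with rfl | hqt
  · have hp1 : p = 1 := by simpa using hpq
    subst hp1
    rw [eLpNorm_exponent_top]
    refine essSup_le_of_ae_le _ (Filter.Eventually.of_forall fun k => ?_)
    have := key (Pi.single k 1)
    rw [eLpNorm_one_eq_lintegral_enorm, lintegral_count, tsum_fintype,
      Finset.sum_eq_single k (by intro j _ hj; simp [hj]) (by simp),
      Finset.sum_eq_single k (by intro j _ hj; simp [hj]) (by simp)] at this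
    simpa [← enorm_eq_nnnorm] using this
  rcases eq_or_ne p ∞ with rfl | hpt
  · have hq1 : q = 1 := by simpa using hpq
    subst hq1
    have := key fun _ => 1
    rw [eLpNorm_one_eq_lintegral_enorm, lintegral_count, tsum_fintype]
    refine le_trans (le_of_eq ?_) (this.trans ?_)
    · push_cast
      simp [enorm_eq_nnnorm]
    · rw [eLpNorm_exponent_top]
      calc _ ≤ C * 1 := by
            gcongr
            exact essSup_le_of_ae_le _ (Filter.Eventually.of_forall fun k => by simp)
        _ = C := mul_one _
  have hr : q.toReal.HolderConjugate p.toReal := by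
    have := hconj.symm
    exact ENNReal.HolderConjugate.toReal_of_ne_top hqt hpt
  obtain ⟨⟨g, hg, hgs⟩, -⟩ := NNReal.isGreatest_Lp Finset.univ (fun k => ‖c k‖₊) hr
  have hkey := key g
  have hqr : 0 < q.toReal := ENNReal.toReal_pos (zero_lt_one.trans_le hq).ne' hqt
  have hpr : 0 < p.toReal := ENNReal.toReal_pos (zero_lt_one.trans_le hp).ne' hpt
  have hg1 : eLpNorm (fun k => (g k : ℝ)) p Measure.count ≤ 1 := by
    rw [eLpNorm_eq_lintegral_rpow_enorm_toReal (zero_lt_one.trans_le hp).ne' hpt, lintegral_count,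
      tsum_fintype]
    refine ENNReal.rpow_le_one ?_ (by positivity)
    have : (∑ k, g k ^ p.toReal : NNReal) ≤ 1 := hg
    refine le_trans (le_of_eq ?_) (ENNReal.coe_le_coe.mpr this)
    push_cast
    refine Finset.sum_congr rfl fun k _ => ?_
    rw [ENNReal.coe_rpow_of_nonneg _ hpr.le]
    simp [enorm_eq_nnnorm]
  calc eLpNorm c q Measure.count
      = (((∑ k, ‖c k‖₊ ^ q.toReal) ^ (1 / q.toReal) : NNReal) : ℝ≥0∞) := by
        rw [eLpNorm_eq_lintegral_rpow_enorm_toReal (zero_lt_one.trans_le hq).ne' hqt,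
          lintegral_count, tsum_fintype, ENNReal.coe_rpow_of_nonneg _ (by positivity)]
        push_cast
        congr 1
        refine Finset.sum_congr rfl fun k _ => ?_
        rw [ENNReal.coe_rpow_of_nonneg _ hqr.le, enorm_eq_nnnorm]
    _ = ((∑ k, g k * ‖c k‖₊ : NNReal) : ℝ≥0∞) := by
        rw [← hgs]
        simp [mul_comm]
    _ ≤ C * 1 := hkey.trans (by gcongr)
    _ = C := mul_one C

end Representation

/-! ### Duality of Schatten classes and density by annihilators -/

section Separation

universe w
variable {E : Type w} [NormedAddCommGroup E] [InnerProductSpace ℂ E] [CompleteSpace E]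

/-- The seminorm `pairNorm p` on the trace class. -/
def pairSeminorm (E : Type w) [NormedAddCommGroup E] [InnerProductSpace ℂ E] [CompleteSpace E]
    {p : ℝ≥0∞} (hp : 1 ≤ p) : Seminorm ℂ (schattenSubmodule E le_rfl) :=
  Seminorm.ofSMulLE (fun A => (pairNorm p (A : E →L[ℂ] E)).toReal) (by simp [pairNorm_zero])
    (fun A B => by
      have hA := ((mem_schattenSubmodule_one.mp A.2).pairNorm_lt_top hp).ne
      have hB := ((mem_schattenSubmodule_one.mp B.2).pairNorm_lt_top hp).ne
      rw [← ENNReal.toReal_add hA hB]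
      exact ENNReal.toReal_mono (ENNReal.add_ne_top.mpr ⟨hA, hB⟩) (pairNorm_add_le hp A.1 B.1))
    (fun c A => by
      have hA := ((mem_schattenSubmodule_one.mp A.2).pairNorm_lt_top hp).ne
      have h := ENNReal.toReal_mono (ENNReal.mul_ne_top enorm_ne_top hA)
        (pairNorm_smul_le p c A.1)
      rwa [ENNReal.toReal_mul, toReal_enorm] at h)

theorem pairSeminorm_apply {p : ℝ≥0∞} (hp : 1 ≤ p) (A : schattenSubmodule E le_rfl) :
    pairSeminorm E hp A = (pairNorm p (A : E →L[ℂ] E)).toReal := rfl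

theorem ofReal_pairSeminorm {p : ℝ≥0∞} (hp : 1 ≤ p) (A : schattenSubmodule E le_rfl) :
    ENNReal.ofReal (pairSeminorm E hp A) = pairNorm p (A : E →L[ℂ] E) :=
  ENNReal.ofReal_toReal ((mem_schattenSubmodule_one.mp A.2).pairNorm_lt_top hp).ne

/-- A continuous functional on the trace class, for the `p`-norm, is given by a bounded operator
in the dual class. -/
theorem exists_operator_of_functional {p q : ℝ≥0∞} (hp : 1 ≤ p) (hpq : p⁻¹ + q⁻¹ = 1)
    (f : schattenSubmodule E le_rfl →ₗ[ℂ] ℂ) (hf : ∀ A, ‖f A‖ ≤ pairSeminorm E hp A) :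
    ∃ T : E →L[ℂ] E, pairNorm q T ≤ 1 ∧ ∀ A, f A = trace (T ∘L (A : E →L[ℂ] E)) := by
  let R : E → E → schattenSubmodule E le_rfl := fun u v =>
    ⟨rankOne ℂ u v, mem_schattenSubmodule_one.mpr (IsNuclear.rankOne u v)⟩
  have hfe : ∀ A, ‖f A‖ₑ ≤ pairNorm p (A : E →L[ℂ] E) := fun A => by
    rw [← ofReal_norm, ← ofReal_pairSeminorm hp]
    exact ENNReal.ofReal_le_ofReal (hf A)
  -- The operator is dictated by rank-one arguments: ⟨v, T u⟩ = f(u ⊗ v).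
  obtain ⟨T, hT⟩ := exists_operator_of_sesquilinear (fun v u => f (R u v)) (C := 1)
    (fun v v' u => by
      rw [← map_add]; congr 1; ext1; simp [R])
    (fun c v u => by
      rw [← smul_eq_mul, ← map_smul]; congr 1; ext1; simp [R])
    (fun v u u' => by
      rw [← map_add]; congr 1; ext1; simp [R])
    (fun c v u => by
      rw [← smul_eq_mul, ← map_smul]; congr 1; ext1; simp [R])
    (fun v u => by
      refine (hf _).trans ?_
      have := ENNReal.toReal_mono (ENNReal.mul_ne_top enorm_ne_top enorm_ne_top)
        (pairNorm_rankOne_le hp u v)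
      rw [pairSeminorm_apply]
      refine this.trans (le_of_eq ?_)
      simp [mul_comm])
  refine ⟨T, pairNorm_le fun n a b ha hb => ?_, fun A => ?_⟩
  · refine eLpNorm_le_of_forall_sum_mul_le hp hpq fun γ => ?_
    have e : ∑ k, γ k * inner ℂ (a k) (T (b k)) = f (∑ k, γ k • R (b k) (a k)) := by
      simp [hT]
    rw [e, one_mul]
    refine (hfe _).trans ?_
    -- The test operator ∑ γ_k b_k ⊗ a_k is its own singular value decomposition, so its p-norm is
    -- at most the ℓ^p-norm of γ and duality of sequences bounds the q-norm of T.
    have hs : IsSVD γ b a ((∑ k, γ k • R (b k) (a k) : schattenSubmodule E le_rfl) : E →L[ℂ] E) := by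
      refine ⟨hb, ha, fun x => ?_⟩
      have : ((∑ k, γ k • R (b k) (a k) : schattenSubmodule E le_rfl) : E →L[ℂ] E) x =
          ∑ k, (γ k * inner ℂ (a k) x) • b k := by
        rw [Submodule.coe_sum, sum_apply]
        refine Finset.sum_congr rfl fun k _ => ?_
        simp [R, smul_smul]
      rw [this]
      exact hasSum_fintype _
    exact hs.pairNorm_le hp
  · obtain ⟨u, v, h⟩ := mem_schattenSubmodule_one.mp A.2
    have h1 := (h.trace_comp_left T).tendsto_sum_nat
    refine tendsto_nhds_unique ?_ h1
    have e : ∀ N, ∑ n ∈ Finset.range N, inner ℂ (v n) (T (u n)) =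
        f (∑ n ∈ Finset.range N, R (u n) (v n)) := fun N => by simp [hT]
    simp only [e]
    rw [tendsto_iff_norm_sub_tendsto_zero]
    -- The two functionals agree on partial sums of a nuclear series, and the remainder tends to 0
    -- in the p-norm because ∑ ‖u n‖‖v n‖ converges.
    have htail : ∀ N, ‖f (∑ n ∈ Finset.range N, R (u n) (v n)) - f A‖ₑ ≤
        ∑' n, ‖u (n + N)‖ₑ * ‖v (n + N)‖ₑ := fun N => by
      rw [← map_sub, ← neg_sub, map_neg, enorm_neg]
      refine (hfe _).trans ?_
      have hN : NuclearSum (fun n => u (n + N)) (fun n => v (n + N))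
          ((A - ∑ n ∈ Finset.range N, R (u n) (v n) : schattenSubmodule E le_rfl) : E →L[ℂ] E) := by
        refine ⟨(summable_nat_add_iff N).mpr h.summable, ?_⟩
        have := (hasSum_nat_add_iff' N).mpr h.hasSum
        simpa [R] using this
      exact hN.pairNorm_le hp
    have h0 := ENNReal.tendsto_sum_nat_add (fun n => ‖u n‖ₑ * ‖v n‖ₑ) h.tsum_enorm_ne_top
    have h2 := tendsto_of_tendsto_of_tendsto_of_le_of_le tendsto_const_nhds h0
      (fun _ => zero_le) htail
    have := (ENNReal.tendsto_toReal ENNReal.zero_ne_top).comp h2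
    simpa [Function.comp_def] using this

/-- A subspace of the trace class which no nonzero operator of the dual class annihilates is dense
in the trace class for the `p`-norm. -/
theorem exists_mem_pairNorm_sub_lt {p q : ℝ≥0∞} (hp : 1 ≤ p) (hpq : p⁻¹ + q⁻¹ = 1)
    (D : Submodule ℂ (E →L[ℂ] E)) (hD : ∀ A ∈ D, IsNuclear A)
    (h : ∀ T : E →L[ℂ] E, pairNorm q T < ∞ → (∀ A ∈ D, trace (T ∘L A) = 0) → T = 0)
    {A : E →L[ℂ] E} (hA : IsNuclear A) {ε : ℝ≥0∞} (hε : 0 < ε) :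
    ∃ B ∈ D, pairNorm p (A - B) < ε := by
  by_contra! hne
  have hεt : ε ≠ ∞ := fun h => by
    have h1 := hne 0 D.zero_mem
    rw [sub_zero, h, top_le_iff] at h1
    exact (hA.pairNorm_lt_top hp).ne h1
  obtain ⟨f, hf0, hfx, hf⟩ := Seminorm.exists_dual_of_sub_ge (pairSeminorm E hp)
    (D.comap (schattenSubmodule E le_rfl).subtype) (x := ⟨A, mem_schattenSubmodule_one.mpr hA⟩)
    (ENNReal.toReal_pos hε.ne' hεt) (fun B hB => by
      rw [pairSeminorm_apply]
      refine ENNReal.toReal_mono ?_ (hne _ hB)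
      exact ((mem_schattenSubmodule_one.mp (Subtype.prop _)).pairNorm_lt_top hp).ne)
  obtain ⟨T, hT, hTf⟩ := exists_operator_of_functional hp hpq f hf
  have hT0 := h T (hT.trans_lt ENNReal.one_lt_top) fun B hB => by
    rw [← hf0 ⟨B, mem_schattenSubmodule_one.mpr (hD B hB)⟩ hB, hTf]
  refine hfx ?_
  rw [hTf, hT0]
  simp [trace_eq_tsum]

end Separation

/-! ### Conjugation by isometries -/

section Conjugation

variable {E : Type*} [NormedAddCommGroup E] [InnerProductSpace ℂ E]

theorem eq_of_comp_eq_one {A B C : E →L[ℂ] E} (h1 : A ∘L B = 1) (h2 : B ∘L C = 1) : A = C :=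
  left_inv_eq_right_inv (M := E →L[ℂ] E) h1 h2

/-- A unimodular factor cancels against its conjugate. Hence α is a genuine action although π is
only a projective representation. -/
theorem comp_conj_of_smul [CompleteSpace E] {U V W : E →L[ℂ] E} {c : ℂ} (hc : ‖c‖ = 1)
    (h : U ∘L V = c • W) (A : E →L[ℂ] E) :
    U ∘L (V ∘L A ∘L V.adjoint) ∘L U.adjoint = W ∘L A ∘L W.adjoint := by
  have h' := congrArg ContinuousLinearMap.adjoint h
  rw [ContinuousLinearMap.adjoint_comp, map_smulₛₗ] at h'
  have hcc : starRingEnd ℂ c * c = 1 := by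
    rw [mul_comm, Complex.mul_conj, Complex.normSq_eq_norm_sq, hc]
    simp
  calc U ∘L (V ∘L A ∘L V.adjoint) ∘L U.adjoint = (U ∘L V) ∘L A ∘L (V.adjoint ∘L U.adjoint) := by
        simp only [ContinuousLinearMap.comp_assoc]
    _ = _ := by
        rw [h, h', ContinuousLinearMap.smul_comp, ContinuousLinearMap.comp_smul,
          ContinuousLinearMap.comp_smul, smul_smul, mul_comm, hcc, one_smul]

theorem comp_conj_of_comp_eq_one {U V : E →L[ℂ] E} (h : V ∘L U = 1) (A : E →L[ℂ] E) :
    V ∘L (U ∘L A ∘L V) ∘L U = A := by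
  calc V ∘L (U ∘L A ∘L V) ∘L U = (V ∘L U) ∘L A ∘L (V ∘L U) := by
        simp only [ContinuousLinearMap.comp_assoc]
    _ = A := by rw [h]; rfl

theorem adjoint_comp_self_of_norm_map [CompleteSpace E] {U : E →L[ℂ] E} (h : ∀ x, ‖U x‖ = ‖x‖) :
    U.adjoint ∘L U = 1 := (ContinuousLinearMap.norm_map_iff_adjoint_comp_self _).mp h

theorem pairNorm_comp_le [CompleteSpace E] (p : ℝ≥0∞) {U V : E →L[ℂ] E}
    (hU : ∀ x, ‖U.adjoint x‖ = ‖x‖) (hV : ∀ x, ‖V x‖ = ‖x‖) (A : E →L[ℂ] E) :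
    pairNorm p (U ∘L A ∘L V) ≤ pairNorm p A := by
  refine pairNorm_le fun n a b ha hb => ?_
  let L : E →ₗᵢ[ℂ] E := ⟨U.adjoint, hU⟩
  let M : E →ₗᵢ[ℂ] E := ⟨V, hV⟩
  have h := le_pairNorm p A (ha.comp_linearIsometry L) (hb.comp_linearIsometry M)
  refine le_trans (le_of_eq ?_) h
  congr 1
  ext k
  exact (ContinuousLinearMap.adjoint_inner_left U (A (V (b k))) (a k)).symm

theorem comp_rankOne_comp [CompleteSpace E] (U V : E →L[ℂ] E) (x y : E) :
    U ∘L rankOne ℂ x y ∘L V = rankOne ℂ (U x) (V.adjoint y) := by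
  ext u
  simp [ContinuousLinearMap.adjoint_inner_left]

end Conjugation

/-! ### Time-frequency shifts and the action on operators -/

section Shifts

variable {d : ℕ}

theorem character_add_left (ω η t : EuclideanSpace ℝ (Fin d)) :
    character (ω + η) t = character ω t * character η t := by
  simp only [character, ← Complex.exp_add, inner_add_left]
  push_cast
  ring_nf

theorem character_add_right (ω s t : EuclideanSpace ℝ (Fin d)) :
    character ω (s + t) = character ω s * character ω t := by
  simp only [character, ← Complex.exp_add, inner_add_right]
  push_cast
  ring_nf

theorem character_neg_left (ω t : EuclideanSpace ℝ (Fin d)) :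
    character (-ω) t = character ω (-t) := by
  simp [character]

theorem character_zero_left (t : EuclideanSpace ℝ (Fin d)) : character 0 t = 1 := by
  simp [character]

theorem continuous_character_left (t : EuclideanSpace ℝ (Fin d)) :
    Continuous fun ω => character ω t := by
  unfold character
  fun_prop

theorem coeFn_translationOp (x : EuclideanSpace ℝ (Fin d)) (ψ : L2 d) :
    translationOp x ψ =ᵐ[volume] fun t => ψ (t - x) :=
  Lp.coeFn_compMeasurePreserving ψ (measurePreserving_sub_right volume x)

theorem coeFn_parityOp (ψ : L2 d) : parityOp d ψ =ᵐ[volume] fun t => ψ (-t) :=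
  Lp.coeFn_compMeasurePreserving ψ (Measure.measurePreserving_neg volume)

theorem coeFn_modulationOp (ω : EuclideanSpace ℝ (Fin d)) (ψ : L2 d) :
    modulationOp ω ψ =ᵐ[volume] fun t => character ω t * ψ t :=
  MemLp.coeFn_toLp (memLp_character_mul ω ψ)

theorem coeFn_timeFreqShift (z : PhaseSpace d) (ψ : L2 d) :
    timeFreqShift z ψ =ᵐ[volume] fun t => character z.2 t * ψ (t - z.1) := by
  filter_upwards [coeFn_modulationOp z.2 (translationOp z.1 ψ), coeFn_translationOp z.1 ψ]
    with t h1 h2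
  rw [timeFreqShift, ContinuousLinearMap.comp_apply, h1, h2]

theorem norm_modulationOp (ω : EuclideanSpace ℝ (Fin d)) (ψ : L2 d) :
    ‖modulationOp ω ψ‖ = ‖ψ‖ := by
  refine le_antisymm (Lp.norm_le_norm_of_ae_le ?_) (Lp.norm_le_norm_of_ae_le ?_)
  all_goals
    filter_upwards [coeFn_modulationOp ω ψ] with t h
    rw [h, norm_mul, norm_character, one_mul]

theorem norm_timeFreqShift (z : PhaseSpace d) (ψ : L2 d) : ‖timeFreqShift z ψ‖ = ‖ψ‖ := by
  rw [timeFreqShift, ContinuousLinearMap.comp_apply, norm_modulationOp]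
  exact LinearIsometry.norm_map _ ψ

/-- The phase arises from moving the translation past the modulation: the character is evaluated at
t - z.1 instead of t. -/
theorem timeFreqShift_comp (z w : PhaseSpace d) :
    timeFreqShift z ∘L timeFreqShift w = character w.2 (-z.1) • timeFreqShift (z + w) := by
  refine ContinuousLinearMap.ext fun ψ => Lp.ext ?_
  have h2 : ∀ᵐ t, (timeFreqShift w ψ) (t - z.1) = character w.2 (t - z.1) * ψ (t - z.1 - w.1) :=
    (measurePreserving_sub_right volume z.1).quasiMeasurePreserving.ae (coeFn_timeFreqShift w ψ)
  filter_upwards [coeFn_timeFreqShift z (timeFreqShift w ψ), h2, coeFn_timeFreqShift (z + w) ψ,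
    Lp.coeFn_smul (character w.2 (-z.1)) (timeFreqShift (z + w) ψ)] with t h1 h2 h3 h4
  rw [ContinuousLinearMap.comp_apply, h1, h2, smul_apply, h4, Pi.smul_apply, h3,
    sub_eq_add_neg t z.1, character_add_right, Prod.snd_add, Prod.fst_add, character_add_left,
    smul_eq_mul, ← sub_eq_add_neg, sub_sub]
  ring

theorem timeFreqShift_zero : timeFreqShift (0 : PhaseSpace d) = 1 := by
  refine ContinuousLinearMap.ext fun ψ => Lp.ext ?_
  filter_upwards [coeFn_timeFreqShift (0 : PhaseSpace d) ψ] with t h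
  simp [h, character_zero_left]

theorem adjoint_timeFreqShift_comp (z : PhaseSpace d) :
    (timeFreqShift z).adjoint ∘L timeFreqShift z = 1 :=
  adjoint_comp_self_of_norm_map (norm_timeFreqShift z)

theorem timeFreqShift_comp_smul_neg (z : PhaseSpace d) :
    timeFreqShift z ∘L (character z.2 (-z.1) • timeFreqShift (-z)) = 1 := by
  have h := timeFreqShift_comp z (-z)
  rw [add_neg_cancel, timeFreqShift_zero] at h
  rw [ContinuousLinearMap.comp_smul, h, smul_smul, Prod.snd_neg, character_neg_left,
    ← character_add_right]
  simp [character]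

theorem adjoint_timeFreqShift (z : PhaseSpace d) :
    (timeFreqShift z).adjoint = character z.2 (-z.1) • timeFreqShift (-z) :=
  eq_of_comp_eq_one (adjoint_timeFreqShift_comp z) (timeFreqShift_comp_smul_neg z)

theorem opShift_zero (A : L2 d →L[ℂ] L2 d) : opShift 0 A = A := by
  rw [opShift, timeFreqShift_zero, ContinuousLinearMap.one_def, ContinuousLinearMap.adjoint_id]
  rfl

theorem opShift_opShift (z w : PhaseSpace d) (A : L2 d →L[ℂ] L2 d) :
    opShift z (opShift w A) = opShift (z + w) A :=
  comp_conj_of_smul (norm_character _ _) (timeFreqShift_comp z w) A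

theorem opShift_add (z : PhaseSpace d) (A B : L2 d →L[ℂ] L2 d) :
    opShift z (A + B) = opShift z A + opShift z B := by
  simp [opShift, ContinuousLinearMap.add_comp, ContinuousLinearMap.comp_add]

theorem opShift_smul (z : PhaseSpace d) (c : ℂ) (A : L2 d →L[ℂ] L2 d) :
    opShift z (c • A) = c • opShift z A := by
  simp [opShift]

theorem inner_opShift (z : PhaseSpace d) (A : L2 d →L[ℂ] L2 d) (a b : L2 d) :
    inner ℂ a (opShift z A b) =
      inner ℂ ((timeFreqShift z).adjoint a) (A ((timeFreqShift z).adjoint b)) := by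
  rw [opShift, ContinuousLinearMap.comp_apply, ContinuousLinearMap.comp_apply,
    ContinuousLinearMap.adjoint_inner_left]

theorem opShift_rankOne (z : PhaseSpace d) (x y : L2 d) :
    opShift z (rankOne ℂ x y) = rankOne ℂ (timeFreqShift z x) (timeFreqShift z y) := by
  rw [opShift, comp_rankOne_comp, ContinuousLinearMap.adjoint_adjoint]

theorem NuclearSum.shift {u v : ℕ → L2 d} {A : L2 d →L[ℂ] L2 d} (h : NuclearSum u v A)
    (z : PhaseSpace d) :
    NuclearSum (fun n => timeFreqShift z (u n)) (fun n => timeFreqShift z (v n)) (opShift z A) := by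
  have := (h.comp_right (timeFreqShift z).adjoint).comp_left (timeFreqShift z)
  rwa [ContinuousLinearMap.adjoint_adjoint] at this

theorem IsNuclear.shift {A : L2 d →L[ℂ] L2 d} (h : IsNuclear A) (z : PhaseSpace d) :
    IsNuclear (opShift z A) := by
  obtain ⟨u, v, h⟩ := h; exact ⟨_, _, h.shift z⟩

theorem opShift_neg_eq (z : PhaseSpace d) (A : L2 d →L[ℂ] L2 d) :
    opShift (-z) A = (timeFreqShift z).adjoint ∘L A ∘L timeFreqShift z := by
  have h := comp_conj_of_comp_eq_one (adjoint_timeFreqShift_comp z) (opShift (-z) A)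
  rw [← h]
  change _ = (timeFreqShift z).adjoint ∘L A ∘L timeFreqShift z
  rw [show timeFreqShift z ∘L opShift (-z) A ∘L (timeFreqShift z).adjoint = A by
    change opShift z (opShift (-z) A) = A
    rw [opShift_opShift, add_neg_cancel, opShift_zero]]

theorem trace_comp_opShift {S : L2 d →L[ℂ] L2 d} (hS : IsNuclear S) (T : L2 d →L[ℂ] L2 d)
    (z : PhaseSpace d) : trace (T ∘L opShift z S) = trace (opShift (-z) T ∘L S) := by
  have h : IsNuclear ((T ∘L timeFreqShift z) ∘L S) := hS.comp_left _
  rw [opShift_neg_eq]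
  exact (h.trace_comp_comm (timeFreqShift z).adjoint).symm

theorem trace_opShift_comp {S : L2 d →L[ℂ] L2 d} (hS : IsNuclear S) (T : L2 d →L[ℂ] L2 d)
    (z w : PhaseSpace d) :
    trace (opShift w T ∘L opShift z S) = trace (T ∘L opShift (z - w) S) := by
  rw [trace_comp_opShift hS, trace_comp_opShift hS, opShift_opShift]
  congr 3
  abel

end Shifts

/-! ### Parity -/

section Parity

variable {d : ℕ}

theorem parityOp_comp_self : parityOp d ∘L parityOp d = 1 := by
  refine ContinuousLinearMap.ext fun ψ => Lp.ext ?_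
  have h2 : ∀ᵐ t, (parityOp d ψ) (-t) = ψ (- -t) :=
    (Measure.measurePreserving_neg volume).quasiMeasurePreserving.ae (coeFn_parityOp ψ)
  filter_upwards [coeFn_parityOp (parityOp d ψ), h2] with t h1 h2
  rw [ContinuousLinearMap.comp_apply, h1, h2, neg_neg]
  rfl

theorem norm_parityOp (ψ : L2 d) : ‖parityOp d ψ‖ = ‖ψ‖ := LinearIsometry.norm_map _ ψ

theorem adjoint_parityOp : (parityOp d).adjoint = parityOp d :=
  eq_of_comp_eq_one (adjoint_comp_self_of_norm_map norm_parityOp) parityOp_comp_self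

theorem parityOp_comp_timeFreqShift (z : PhaseSpace d) :
    parityOp d ∘L timeFreqShift z = timeFreqShift (-z) ∘L parityOp d := by
  refine ContinuousLinearMap.ext fun ψ => Lp.ext ?_
  have h2 : ∀ᵐ t, (timeFreqShift z ψ) (-t) = character z.2 (-t) * ψ (-t - z.1) :=
    (Measure.measurePreserving_neg volume).quasiMeasurePreserving.ae (coeFn_timeFreqShift z ψ)
  have h4 : ∀ᵐ t, (parityOp d ψ) (t - (-z).1) = ψ (-(t - (-z).1)) :=
    (measurePreserving_sub_right volume (-z).1).quasiMeasurePreserving.ae (coeFn_parityOp ψ)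
  filter_upwards [coeFn_parityOp (timeFreqShift z ψ), h2, coeFn_timeFreqShift (-z) (parityOp d ψ),
    h4] with t h1 h2 h3 h4
  rw [ContinuousLinearMap.comp_apply, h1, h2, ContinuousLinearMap.comp_apply, h3, h4, Prod.snd_neg,
    character_neg_left, Prod.fst_neg]
  congr 2
  abel

theorem opCheck_opCheck (A : L2 d →L[ℂ] L2 d) : opCheck (opCheck A) = A :=
  comp_conj_of_comp_eq_one parityOp_comp_self A

theorem opCheck_opShift (z : PhaseSpace d) (A : L2 d →L[ℂ] L2 d) :
    opCheck (opShift z A) = opShift (-z) (opCheck A) := by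
  have h := parityOp_comp_timeFreqShift z
  have h' := congrArg ContinuousLinearMap.adjoint (parityOp_comp_timeFreqShift z)
  rw [ContinuousLinearMap.adjoint_comp, ContinuousLinearMap.adjoint_comp, adjoint_parityOp] at h'
  rw [opCheck, opShift, opShift, opCheck, ContinuousLinearMap.comp_assoc,
    ContinuousLinearMap.comp_assoc, h', ← ContinuousLinearMap.comp_assoc, h]
  simp only [ContinuousLinearMap.comp_assoc]

theorem opCheck_rankOne (x y : L2 d) :
    opCheck (rankOne ℂ x y) = rankOne ℂ (parityOp d x) (parityOp d y) := by
  rw [opCheck, comp_rankOne_comp, adjoint_parityOp]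

theorem NuclearSum.check {u v : ℕ → L2 d} {A : L2 d →L[ℂ] L2 d} (h : NuclearSum u v A) :
    NuclearSum (fun n => parityOp d (u n)) (fun n => parityOp d (v n)) (opCheck A) := by
  have := (h.comp_right (parityOp d)).comp_left (parityOp d)
  rwa [adjoint_parityOp] at this

theorem IsNuclear.check {A : L2 d →L[ℂ] L2 d} (h : IsNuclear A) : IsNuclear (opCheck A) := by
  obtain ⟨u, v, h⟩ := h; exact ⟨_, _, h.check⟩

theorem trace_comp_opCheck {S : L2 d →L[ℂ] L2 d} (hS : IsNuclear S) (T : L2 d →L[ℂ] L2 d) :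
    trace (T ∘L opCheck S) = trace (opCheck T ∘L S) := by
  have h : IsNuclear ((T ∘L parityOp d) ∘L S) := hS.comp_left _
  exact (h.trace_comp_comm (parityOp d)).symm

theorem pairNorm_opCheck (p : ℝ≥0∞) (A : L2 d →L[ℂ] L2 d) :
    pairNorm p (opCheck A) = pairNorm p A := by
  have h : ∀ A : L2 d →L[ℂ] L2 d, pairNorm p (opCheck A) ≤ pairNorm p A := fun A =>
    pairNorm_comp_le p (by rw [adjoint_parityOp]; exact norm_parityOp) norm_parityOp A
  refine le_antisymm (h A) ?_
  have := h (opCheck A)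
  rwa [opCheck_opCheck] at this

end Parity

/-! ### Strong continuity of the shifts -/

section Continuity

variable {d : ℕ}

/-- On a sphere weak continuity is strong continuity: ‖f x - f x₀‖² = 2r² - 2 Re⟨f x₀, f x⟩. -/
theorem continuous_of_continuous_inner {X H : Type*} [TopologicalSpace X] [NormedAddCommGroup H]
    [InnerProductSpace ℂ H] {f : X → H} {r : ℝ} (hr : ∀ x, ‖f x‖ = r)
    (hf : ∀ a, Continuous fun x => inner ℂ a (f x)) : Continuous f := by
  refine continuous_iff_continuousAt.mpr fun x₀ => tendsto_iff_norm_sub_tendsto_zero.mpr ?_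
  have h2 : ∀ x, ‖f x - f x₀‖ = √(2 * r ^ 2 - 2 * (inner ℂ (f x₀) (f x)).re) := fun x => by
    rw [← Real.sqrt_sq (norm_nonneg (f x - f x₀)), norm_sub_sq (𝕜 := ℂ), hr, hr,
      ← inner_conj_symm (f x) (f x₀)]
    simp only [RCLike.re_to_complex, Complex.conj_re]
    ring_nf
  simp only [h2]
  have hc : Continuous fun x => √(2 * r ^ 2 - 2 * (inner ℂ (f x₀) (f x)).re) := by
    have := hf (f x₀)
    fun_prop
  have h0 := hc.tendsto x₀
  rw [← h2 x₀, sub_self, norm_zero] at h0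
  exact h0

theorem continuous_modulationOp (ψ : L2 d) : Continuous fun ω => modulationOp ω ψ := by
  refine continuous_of_continuous_inner (fun ω => norm_modulationOp ω ψ) fun a => ?_
  have e : ∀ ω, inner ℂ a (modulationOp ω ψ) =
      ∫ t, character ω t * inner ℂ (a t) (ψ t) := fun ω => by
    rw [L2.inner_def]
    refine integral_congr_ae ?_
    filter_upwards [coeFn_modulationOp ω ψ] with t h
    rw [h, ← smul_eq_mul, inner_smul_right]
  simp only [e]
  refine continuous_of_dominated (bound := fun t => ‖inner ℂ (a t) (ψ t)‖) ?_ ?_ ?_ ?_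
  · exact fun ω => (continuous_character ω).aestronglyMeasurable.mul
      (L2.integrable_inner (𝕜 := ℂ) a ψ).aestronglyMeasurable
  · refine fun ω => Filter.Eventually.of_forall fun t => ?_
    rw [norm_mul, norm_character, one_mul]
  · exact (L2.integrable_inner (𝕜 := ℂ) a ψ).norm
  · exact Filter.Eventually.of_forall fun t => (continuous_character_left t).mul continuous_const

theorem continuous_translationOp (ψ : L2 d) : Continuous fun x => translationOp x ψ := by
  let τ : EuclideanSpace ℝ (Fin d) → C(EuclideanSpace ℝ (Fin d), EuclideanSpace ℝ (Fin d)) :=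
    fun x => ⟨fun t => t - x, by fun_prop⟩
  have hτ : Continuous τ := ContinuousMap.continuous_of_continuous_uncurry _
    (by change Continuous fun q : EuclideanSpace ℝ (Fin d) × EuclideanSpace ℝ (Fin d) => q.2 - q.1
        fun_prop)
  have hm : ∀ x, MeasurePreserving (τ x) volume volume :=
    fun x => measurePreserving_sub_right volume x
  exact Continuous.compMeasurePreservingLp (p := 2) (g := τ) (f := fun _ => ψ) continuous_const hτ
    hm (by norm_num)

theorem continuous_timeFreqShift (ψ : L2 d) :
    Continuous fun z : PhaseSpace d => timeFreqShift z ψ := by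
  refine continuous_iff_continuousAt.mpr fun z₀ => tendsto_iff_norm_sub_tendsto_zero.mpr ?_
  have hb : ∀ z : PhaseSpace d, ‖timeFreqShift z ψ - timeFreqShift z₀ ψ‖ ≤
      ‖translationOp z.1 ψ - translationOp z₀.1 ψ‖ +
      ‖modulationOp z.2 (translationOp z₀.1 ψ) - modulationOp z₀.2 (translationOp z₀.1 ψ)‖ := by
    intro z
    rw [← norm_modulationOp z.2 (translationOp z.1 ψ - translationOp z₀.1 ψ), map_sub]
    exact norm_sub_le_norm_sub_add_norm_sub _ _ _
  have hc : Continuous fun z : PhaseSpace d =>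
      ‖translationOp z.1 ψ - translationOp z₀.1 ψ‖ +
      ‖modulationOp z.2 (translationOp z₀.1 ψ) - modulationOp z₀.2 (translationOp z₀.1 ψ)‖ := by
    have h1 := (continuous_translationOp ψ).comp (continuous_fst (Y := EuclideanSpace ℝ (Fin d)))
    have h2 := (continuous_modulationOp (translationOp z₀.1 ψ)).comp
      (continuous_snd (X := EuclideanSpace ℝ (Fin d)))
    exact (h1.sub continuous_const).norm.add (h2.sub continuous_const).norm
  have h0 := hc.tendsto z₀
  simp only [sub_self, norm_zero, add_zero] at h0
  exact squeeze_zero (fun _ => norm_nonneg _) hb h0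

theorem continuous_adjoint_timeFreqShift (ψ : L2 d) :
    Continuous fun z : PhaseSpace d => (timeFreqShift z).adjoint ψ := by
  have h : ∀ z : PhaseSpace d, (timeFreqShift z).adjoint ψ =
      character z.2 (-z.1) • timeFreqShift (-z) ψ := fun z => by rw [adjoint_timeFreqShift]; rfl
  simp only [h]
  have h1 : Continuous fun z : PhaseSpace d => character z.2 (-z.1) := by
    unfold character
    fun_prop
  exact h1.smul ((continuous_timeFreqShift ψ).comp continuous_neg)

end Continuity

/-! ### The Fourier integral and Plancherel's theorem -/

section Plancherel

open FourierTransform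

variable {V : Type*} [NormedAddCommGroup V] [InnerProductSpace ℝ V] [FiniteDimensional ℝ V]
  [MeasurableSpace V] [BorelSpace V]

/-- Both sides have the same integrals against smooth functions of compact support: the L² transform
through tempered distributions, the integral transform through the self-adjointness of the Fourier
integral. -/
theorem fourier_toLp_ae_eq {h : V → ℂ} (h1 : MemLp h 1 volume) (h2 : MemLp h 2 volume) :
    (𝓕 (h2.toLp h) : Lp ℂ 2 (volume : Measure V)) =ᵐ[volume] 𝓕 h := by
  have hint := memLp_one_iff_integrable.mp h1
  have hc : Continuous (𝓕 h) := VectorFourier.fourierIntegral_continuous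
    Real.continuous_fourierChar (by exact continuous_inner) hint
  refine ae_eq_of_integral_contDiff_smul_eq ((Lp.memLp _).locallyIntegrable
    (p := 2) (by norm_num))
    hc.locallyIntegrable fun g hg hgc => ?_
  have hg₁ : HasCompactSupport (Complex.ofRealCLM ∘ g) := hgc.comp_left rfl
  have hg₂ : ContDiff ℝ ((⊤ : ℕ∞) : WithTop ℕ∞) (Complex.ofRealCLM ∘ g) :=
    Complex.ofRealCLM.contDiff.comp hg
  set G := hg₁.toSchwartzMap hg₂ with hG
  have e1 : ∫ x, g x • (𝓕 (h2.toLp h) : Lp ℂ 2 (volume : Measure V)) x =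
      (Lp.toTemperedDistribution (𝓕 (h2.toLp h) : Lp ℂ 2 (volume : Measure V))) G := by
    simp [hG]
  have e2 : ∫ x, g x • 𝓕 h x = ∫ x, G x • 𝓕 h x := by simp [hG]
  rw [e1, e2, ← Lp.fourier_toTemperedDistribution_eq, TemperedDistribution.fourier_apply,
    Lp.toTemperedDistribution_apply]
  have e3 : ∫ x, (𝓕 G) x • (h2.toLp h) x = ∫ x, 𝓕 (G : V → ℂ) x • h x := by
    refine integral_congr_ae ?_
    filter_upwards [h2.coeFn_toLp] with x hx
    rw [hx, SchwartzMap.fourier_coe]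
  rw [e3]
  simpa using! VectorFourier.integral_fourierIntegral_smul_eq_flip (L := innerₗ V)
      Real.continuous_fourierChar continuous_inner G.integrable hint

/-- Only the inequality is needed, and it is trivial when h is not square integrable; so
integrability suffices, and products of two L² functions can be inserted directly. -/
theorem lintegral_enorm_fourier_sq_le {h : V → ℂ} (h1 : Integrable h volume) :
    ∫⁻ ω, ‖𝓕 h ω‖ₑ ^ 2 ≤ ∫⁻ t, ‖h t‖ₑ ^ 2 := by
  have e : ∀ f : V → ℂ, ∫⁻ t, ‖f t‖ₑ ^ 2 = eLpNorm f 2 volume ^ 2 := fun f => by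
    rw [← ENNReal.rpow_natCast, eLpNorm_eq_lintegral_rpow_enorm_toReal (by norm_num) (by norm_num),
      ← ENNReal.rpow_mul]
    simp
  by_cases h2 : eLpNorm h 2 volume < ∞
  · have h2 : MemLp h 2 volume := ⟨h1.aestronglyMeasurable, h2⟩
    rw [e, e]
    gcongr
    rw [← eLpNorm_congr_ae (fourier_toLp_ae_eq (memLp_one_iff_integrable.mpr h1) h2),
      ← Lp.enorm_def, ← ofReal_norm, Lp.norm_fourier_eq, ofReal_norm, Lp.enorm_toLp]
  · rw [e h, not_lt_top_iff.mp h2]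
    simp

end Plancherel

/-! ### Moyal's inequality -/

section Moyal

open FourierTransform

variable {d : ℕ}

theorem lintegral_enorm_sq_L2 (a : L2 d) : ∫⁻ t, ‖a t‖ₑ ^ 2 = ‖a‖ₑ ^ 2 := by
  rw [Lp.enorm_def, ← ENNReal.rpow_natCast,
    eLpNorm_eq_lintegral_rpow_enorm_toReal (by norm_num) (by norm_num), ← ENNReal.rpow_mul]
  simp

theorem inner_timeFreqShift_eq_fourier (a u : L2 d) (z : PhaseSpace d) :
    inner ℂ a (timeFreqShift z u) =
      𝓕 (fun t => starRingEnd ℂ (a t) * u (t - z.1)) (-z.2) := by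
  rw [L2.inner_def, Real.fourier_eq']
  refine integral_congr_ae ?_
  filter_upwards [coeFn_timeFreqShift z u] with t h
  rw [h, RCLike.inner_apply, character, smul_eq_mul, inner_neg_right, real_inner_comm]
  push_cast
  ring_nf

/-- One half of Moyal's identity. -/
theorem lintegral_enorm_inner_sq_le (a u : L2 d) :
    ∫⁻ z : PhaseSpace d, ‖inner ℂ a (timeFreqShift z u)‖ₑ ^ 2 ≤ (‖a‖ₑ * ‖u‖ₑ) ^ 2 := by
  have hc : Continuous fun z : PhaseSpace d => inner ℂ a (timeFreqShift z u) :=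
    continuous_const.inner (continuous_timeFreqShift u)
  have hme : Measurable fun z : PhaseSpace d => ‖inner ℂ a (timeFreqShift z u)‖ₑ ^ 2 :=
    hc.enorm.measurable.pow_const 2
  rw [Measure.volume_eq_prod, lintegral_prod _ hme.aemeasurable]
  have hint : ∀ x : EuclideanSpace ℝ (Fin d),
      Integrable (fun t => starRingEnd ℂ (a t) * u (t - x)) volume := fun x => by
    have := L2.integrable_inner (𝕜 := ℂ) a (translationOp x u)
    refine this.congr ?_
    filter_upwards [coeFn_translationOp x u] with t h
    rw [h, RCLike.inner_apply, mul_comm]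
  -- For fixed x the integral over ω is Plancherel for the function conj(a(t)) u(t - x).
  have h1 : ∀ x : EuclideanSpace ℝ (Fin d),
      ∫⁻ ω, ‖inner ℂ a (timeFreqShift (x, ω) u)‖ₑ ^ 2 ≤ ∫⁻ t, ‖a t‖ₑ ^ 2 * ‖u (t - x)‖ₑ ^ 2 := by
    intro x
    simp only [inner_timeFreqShift_eq_fourier]
    rw [lintegral_neg_eq_self (μ := volume)
      (fun ω => ‖𝓕 (fun t => starRingEnd ℂ (a t) * u (t - x)) ω‖ₑ ^ 2)]
    refine (lintegral_enorm_fourier_sq_le (hint x)).trans (le_of_eq ?_)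
    simp [enorm_mul, mul_pow]
  refine (lintegral_mono h1).trans ?_
  have hm : AEMeasurable (Function.uncurry fun x t : EuclideanSpace ℝ (Fin d) =>
      ‖a t‖ₑ ^ 2 * ‖u (t - x)‖ₑ ^ 2) (volume.prod volume) := by
    have h1 := (Lp.stronglyMeasurable a).measurable
    have h2 := (Lp.stronglyMeasurable u).measurable
    exact Measurable.aemeasurable (by unfold Function.uncurry; fun_prop)
  -- With the order exchanged, invariance of Lebesgue measure makes the inner x-integral independent
  -- of t, leaving a product of norms.
  rw [lintegral_lintegral_swap hm]
  have h3 : ∀ t : EuclideanSpace ℝ (Fin d),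
      ∫⁻ x, ‖a t‖ₑ ^ 2 * ‖u (t - x)‖ₑ ^ 2 = ‖a t‖ₑ ^ 2 * ‖u‖ₑ ^ 2 := fun t => by
    have h2 := (Lp.stronglyMeasurable u).measurable
    rw [lintegral_const_mul _ (by fun_prop), lintegral_sub_left_eq_self (fun s => ‖u s‖ₑ ^ 2) t,
      lintegral_enorm_sq_L2]
  simp only [h3]
  rw [lintegral_mul_const' _ _ (by finiteness), lintegral_enorm_sq_L2, mul_pow]

theorem lintegral_enorm_inner_mul_le (a b u v : L2 d) :
    ∫⁻ z : PhaseSpace d, ‖inner ℂ a (timeFreqShift z u)‖ₑ * ‖inner ℂ (timeFreqShift z v) b‖ₑ ≤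
      (‖a‖ₑ * ‖b‖ₑ) * (‖u‖ₑ * ‖v‖ₑ) := by
  have hc : ∀ a u : L2 d, Continuous fun z : PhaseSpace d => inner ℂ a (timeFreqShift z u) :=
    fun a u => continuous_const.inner (continuous_timeFreqShift u)
  have := lintegral_mul_le_of_sq (μ := (volume : Measure (PhaseSpace d)))
    (f := fun z => ‖inner ℂ a (timeFreqShift z u)‖ₑ)
    (g := fun z => ‖inner ℂ b (timeFreqShift z v)‖ₑ)
    (a := ‖a‖ₑ * ‖u‖ₑ) (b := ‖b‖ₑ * ‖v‖ₑ)
    (hc a u).enorm.measurable.aemeasurable (hc b v).enorm.measurable.aemeasurable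
    (lintegral_enorm_inner_sq_le a u) (lintegral_enorm_inner_sq_le b v)
  simp only [enorm_inner_comm (timeFreqShift _ v) b]
  refine this.trans (le_of_eq ?_)
  ring

end Moyal

/-! ### Auxiliary facts on integrals and exponents -/

section General

/-- Schur's test against a one-point space: a common bound in L¹ and pointwise passes to every L^p
with the same constant. -/
theorem eLpNorm_le_of_le_of_lintegral_le {X : Type*} [MeasurableSpace X] {μ : Measure X} [SFinite μ]
    {g : X → ℂ} (hg : Measurable g) {C : ℝ≥0∞} (h1 : ∀ x, ‖g x‖ₑ ≤ C) (h2 : ∫⁻ x, ‖g x‖ₑ ∂μ ≤ C)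
    {p : ℝ≥0∞} (hp : 1 ≤ p) : eLpNorm g p μ ≤ C := by
  have := eLpNorm_le_of_kernel (μ := μ) (ν := Measure.dirac ()) (W := fun x _ => ‖g x‖ₑ)
    (c := C) (F := g) (g := fun _ => 1) (by unfold Function.uncurry; fun_prop)
    (fun x => by simpa using h1 x) (fun _ => h2) (by fun_prop) (fun x => by simp) hp
  refine this.trans ?_
  rw [eLpNorm_const _ (zero_lt_one.trans_le hp).ne' (by simp [Measure.dirac_ne_zero])]
  simp

theorem lintegral_enorm_mul_le {X : Type*} [MeasurableSpace X] {μ : Measure X} {f g : X → ℂ}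
    (hf : AEStronglyMeasurable f μ) (hg : AEStronglyMeasurable g μ) {p q : ℝ≥0∞}
    (hpq : p⁻¹ + q⁻¹ = 1) :
    ∫⁻ x, ‖f x * g x‖ₑ ∂μ ≤ eLpNorm f p μ * eLpNorm g q μ := by
  have : ENNReal.HolderConjugate p q := ENNReal.holderConjugate_iff.mpr hpq
  have h := eLpNorm_smul_le_mul_eLpNorm (p := p) (q := q) (r := 1) (μ := μ) (φ := f) (f := g) hg hf
  rwa [eLpNorm_one_eq_lintegral_enorm] at h

theorem integrable_mul_of_memLp {X : Type*} [MeasurableSpace X] {μ : Measure X} {f g : X → ℂ}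
    {p q : ℝ≥0∞} (hf : MemLp f p μ) (hg : MemLp g q μ) (hpq : p⁻¹ + q⁻¹ = 1) :
    Integrable (fun x => f x * g x) μ :=
  ⟨hf.aestronglyMeasurable.mul hg.aestronglyMeasurable,
    (lintegral_enorm_mul_le hf.aestronglyMeasurable hg.aestronglyMeasurable hpq).trans_lt
      (ENNReal.mul_lt_top hf.2 hg.2)⟩

/-- Distinct orthonormal vectors are √2 apart, so the balls of radius 1/2 are disjoint open sets in
a separable space. -/
theorem countable_of_orthonormal {E ι : Type*} [NormedAddCommGroup E] [InnerProductSpace ℂ E]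
    [TopologicalSpace.SeparableSpace E] {b : ι → E} (hb : Orthonormal ℂ b) : Countable ι := by
  refine Pairwise.countable_of_isOpen_disjoint (s := fun i => Metric.ball (b i) (1 / 2)) ?_
    (fun i => Metric.isOpen_ball) (fun i => ⟨b i, Metric.mem_ball_self (by norm_num)⟩)
  intro i j hij
  refine Metric.ball_disjoint_ball ?_
  have h := norm_sub_sq (𝕜 := ℂ) (b i) (b j)
  rw [hb.2 hij, hb.1, hb.1] at h
  rw [dist_eq_norm]
  norm_num at h ⊢
  nlinarith [norm_nonneg (b i - b j)]

theorem exists_conjugate {r : ℝ≥0∞} (hr : 1 ≤ r) : ∃ s : ℝ≥0∞, 1 ≤ s ∧ r⁻¹ + s⁻¹ = 1 := by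
  refine ⟨(1 - r⁻¹)⁻¹, ?_, ?_⟩
  · rw [ENNReal.one_le_inv]; exact tsub_le_self
  · rw [inv_inv]
    exact add_tsub_cancel_of_le (ENNReal.inv_le_one.mpr hr)

end General

/-! ### The kernel behind Young's inequalities -/

section Weight

variable {d : ℕ} {u v : ℕ → L2 d} {S : L2 d →L[ℂ] L2 d}

/-- A majorant of `⟨a, α_z(S) b⟩` for `S = ∑ uₙ ⊗ vₙ`. -/
def shiftWeight (u v : ℕ → L2 d) (a b : L2 d) (z : PhaseSpace d) : ℝ≥0∞ :=
  ∑' n, ‖inner ℂ a (timeFreqShift z (u n))‖ₑ * ‖inner ℂ (timeFreqShift z (v n)) b‖ₑ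

theorem measurable_shiftWeight (u v : ℕ → L2 d) (a b : L2 d) :
    Measurable (shiftWeight u v a b) := by
  refine Measurable.ennreal_tsum fun n => ?_
  exact (continuous_const.inner (continuous_timeFreqShift (u n))).enorm.measurable.mul
    ((continuous_timeFreqShift (v n)).inner continuous_const).enorm.measurable

theorem NuclearSum.enorm_inner_opShift_le (h : NuclearSum u v S) (a b : L2 d) (z : PhaseSpace d) :
    ‖inner ℂ a (opShift z S b)‖ₑ ≤ shiftWeight u v a b z := (h.shift z).enorm_inner_le a b

/-- Moyal, term by term. This is the phase-space marginal of the kernel used in both Young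
inequalities; `tsum_shiftWeight_le` is the discrete one, obtained from Bessel. -/
theorem lintegral_shiftWeight_le (u v : ℕ → L2 d) (a b : L2 d) :
    ∫⁻ z, shiftWeight u v a b z ≤ ‖a‖ₑ * ‖b‖ₑ * ∑' n, ‖u n‖ₑ * ‖v n‖ₑ := by
  unfold shiftWeight
  rw [lintegral_tsum, ← ENNReal.tsum_mul_left]
  · exact ENNReal.tsum_le_tsum fun n => lintegral_enorm_inner_mul_le a b (u n) (v n)
  · exact fun n =>
      ((continuous_const.inner (continuous_timeFreqShift (u n))).enorm.measurable.mul
        ((continuous_timeFreqShift (v n)).inner continuous_const).enorm.measurable).aemeasurable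

theorem enorm_timeFreqShift (z : PhaseSpace d) (ψ : L2 d) : ‖timeFreqShift z ψ‖ₑ = ‖ψ‖ₑ := by
  rw [← ofReal_norm, norm_timeFreqShift, ofReal_norm]

theorem shiftWeight_le (u v : ℕ → L2 d) (a b : L2 d) (z : PhaseSpace d) :
    shiftWeight u v a b z ≤ ‖a‖ₑ * ‖b‖ₑ * ∑' n, ‖u n‖ₑ * ‖v n‖ₑ := by
  rw [← ENNReal.tsum_mul_left]
  refine ENNReal.tsum_le_tsum fun n => ?_
  have h := mul_le_mul' (enorm_inner_le a (timeFreqShift z (u n)))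
    (enorm_inner_le (timeFreqShift z (v n)) b)
  rw [enorm_timeFreqShift, enorm_timeFreqShift] at h
  refine h.trans (le_of_eq ?_)
  ring

theorem tsum_shiftWeight_le {ι : Type*} {a b : ι → L2 d} (ha : Orthonormal ℂ a)
    (hb : Orthonormal ℂ b) (u v : ℕ → L2 d) (z : PhaseSpace d) :
    ∑' i, shiftWeight u v (a i) (b i) z ≤ ∑' n, ‖u n‖ₑ * ‖v n‖ₑ := by
  unfold shiftWeight
  rw [ENNReal.tsum_comm]
  refine ENNReal.tsum_le_tsum fun n => ?_
  have := tsum_enorm_inner_mul_le ha hb (timeFreqShift z (u n)) (timeFreqShift z (v n))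
  rwa [enorm_timeFreqShift, enorm_timeFreqShift] at this

theorem continuous_inner_opShift (a b : L2 d) (S : L2 d →L[ℂ] L2 d) :
    Continuous fun z : PhaseSpace d => inner ℂ a (opShift z S b) := by
  simp only [inner_opShift]
  exact (continuous_adjoint_timeFreqShift a).inner
    (S.continuous.comp (continuous_adjoint_timeFreqShift b))

/-- The matrix coefficient is bounded and integrable with the same constant, hence in every L^r;
this is what makes f ∗ S exist for f in any L^p. -/
theorem NuclearSum.eLpNorm_inner_opShift_le (h : NuclearSum u v S) (a b : L2 d) {r : ℝ≥0∞}
    (hr : 1 ≤ r) : eLpNorm (fun z : PhaseSpace d => inner ℂ a (opShift z S b)) r volume ≤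
      ‖a‖ₑ * ‖b‖ₑ * ∑' n, ‖u n‖ₑ * ‖v n‖ₑ :=
  eLpNorm_le_of_le_of_lintegral_le (continuous_inner_opShift a b S).measurable
    (fun z => (h.enorm_inner_opShift_le a b z).trans (shiftWeight_le u v a b z))
    ((lintegral_mono (h.enorm_inner_opShift_le a b)).trans (lintegral_shiftWeight_le u v a b)) hr

theorem NuclearSum.lintegral_mul_inner_opShift_le (h : NuclearSum u v S) (a b : L2 d) {r : ℝ≥0∞}
    (hr : 1 ≤ r) {f : PhaseSpace d → ℂ} (hf : AEStronglyMeasurable f volume) :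
    ∫⁻ z, ‖f z * inner ℂ a (opShift z S b)‖ₑ ≤
      eLpNorm f r volume * (‖a‖ₑ * ‖b‖ₑ * ∑' n, ‖u n‖ₑ * ‖v n‖ₑ) := by
  obtain ⟨s, hs, hrs⟩ := exists_conjugate hr
  refine (lintegral_enorm_mul_le hf
    (continuous_inner_opShift a b S).aestronglyMeasurable hrs).trans ?_
  gcongr
  exact h.eLpNorm_inner_opShift_le a b hs

theorem IsNuclear.integrable_mul_inner_opShift (h : IsNuclear S) (a b : L2 d) {r : ℝ≥0∞}
    (hr : 1 ≤ r) {f : PhaseSpace d → ℂ} (hf : MemLp f r volume) :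
    Integrable (fun z => f z * inner ℂ a (opShift z S b)) volume := by
  obtain ⟨u, v, h⟩ := h
  refine ⟨hf.aestronglyMeasurable.mul (continuous_inner_opShift a b S).aestronglyMeasurable,
    (h.lintegral_mul_inner_opShift_le a b hr hf.aestronglyMeasurable).trans_lt ?_⟩
  have := h.tsum_enorm_ne_top
  have := hf.2.ne
  rw [lt_top_iff_ne_top]
  exact ENNReal.mul_ne_top this (ENNReal.mul_ne_top (by simp [ENNReal.mul_eq_top]) ‹_›)

end Weight

/-! ### Convolution of a function and an operator -/

section FunConv

variable {d : ℕ} {S : L2 d →L[ℂ] L2 d}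

theorem exists_isWeakIntegral (hS : IsNuclear S) {r : ℝ≥0∞} (hr : 1 ≤ r) {f : PhaseSpace d → ℂ}
    (hf : MemLp f r volume) : ∃ A, IsWeakIntegral (fun z => f z • opShift z S) A := by
  have hint := fun a b => hS.integrable_mul_inner_opShift a b hr hf
  obtain ⟨u, v, h⟩ := hS
  set c := (eLpNorm f r volume).toReal * (∑' n, ‖u n‖ₑ * ‖v n‖ₑ).toReal
  obtain ⟨A, hA⟩ := exists_operator_of_sesquilinear
    (fun a b => ∫ z, f z * inner ℂ a (opShift z S b)) (C := c)
    (fun a a' b => by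
      rw [← integral_add (hint a b) (hint a' b)]
      simp only [inner_add_left, mul_add])
    (fun k a b => by
      rw [← integral_const_mul]
      simp only [inner_smul_left]
      congr 1; ext z; ring)
    (fun a b b' => by
      rw [← integral_add (hint a b) (hint a b')]
      simp only [map_add, inner_add_right, mul_add])
    (fun k a b => by
      rw [← integral_const_mul]
      simp only [map_smul, inner_smul_right]
      congr 1; ext z; ring)
    (fun a b => by
      have h1 := (enorm_integral_le_lintegral_enorm _).trans
        (h.lintegral_mul_inner_opShift_le a b hr hf.aestronglyMeasurable)
      have h2 := ENNReal.toReal_mono (ENNReal.mul_ne_top hf.2.ne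
        (ENNReal.mul_ne_top (by simp [ENNReal.mul_eq_top]) h.tsum_enorm_ne_top)) h1
      rw [toReal_enorm] at h2
      refine h2.trans (le_of_eq ?_)
      simp only [ENNReal.toReal_mul, toReal_enorm, c]
      ring)
  refine ⟨A, fun ψ φ => ?_⟩
  simp only [smul_apply, inner_smul_right]
  exact ⟨hint φ ψ, hA φ ψ⟩

theorem isWeakIntegral_funConv (hS : IsNuclear S) {r : ℝ≥0∞} (hr : 1 ≤ r) {f : PhaseSpace d → ℂ}
    (hf : MemLp f r volume) : IsWeakIntegral (fun z => f z • opShift z S) (funConv f S) := by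
  have h := exists_isWeakIntegral hS hr hf
  rw [funConv, dif_pos h]
  exact h.choose_spec

theorem inner_funConv (hS : IsNuclear S) {r : ℝ≥0∞} (hr : 1 ≤ r) {f : PhaseSpace d → ℂ}
    (hf : MemLp f r volume) (a b : L2 d) :
    inner ℂ a (funConv f S b) = ∫ z, f z * inner ℂ a (opShift z S b) := by
  have := (isWeakIntegral_funConv hS hr hf b a).2
  simpa only [smul_apply, inner_smul_right] using this

theorem clm_ext_inner {A B : L2 d →L[ℂ] L2 d} (h : ∀ a b, inner ℂ a (A b) = inner ℂ a (B b)) :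
    A = B :=
  ContinuousLinearMap.ext fun b => ext_inner_left ℂ fun a => h a b

theorem funConv_add (hS : IsNuclear S) {r : ℝ≥0∞} (hr : 1 ≤ r) {f g : PhaseSpace d → ℂ}
    (hf : MemLp f r volume) (hg : MemLp g r volume) :
    funConv (f + g) S = funConv f S + funConv g S := by
  refine clm_ext_inner fun a b => ?_
  rw [inner_funConv hS hr (hf.add hg), add_apply, inner_add_right, inner_funConv hS hr hf,
    inner_funConv hS hr hg, ← integral_add (hS.integrable_mul_inner_opShift a b hr hf)
      (hS.integrable_mul_inner_opShift a b hr hg)]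
  simp only [Pi.add_apply, add_mul]

theorem funConv_smul (hS : IsNuclear S) {r : ℝ≥0∞} (hr : 1 ≤ r) (c : ℂ) {f : PhaseSpace d → ℂ}
    (hf : MemLp f r volume) : funConv (c • f) S = c • funConv f S := by
  refine clm_ext_inner fun a b => ?_
  rw [inner_funConv hS hr (hf.const_smul c), smul_apply, inner_smul_right, inner_funConv hS hr hf,
    ← integral_const_mul]
  simp only [Pi.smul_apply, smul_eq_mul, mul_assoc]

theorem funConv_sub (hS : IsNuclear S) {r : ℝ≥0∞} (hr : 1 ≤ r) {f g : PhaseSpace d → ℂ}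
    (hf : MemLp f r volume) (hg : MemLp g r volume) :
    funConv (f - g) S = funConv f S - funConv g S := by
  have : f - g = f + (-1 : ℂ) • g := by simp [sub_eq_add_neg]
  rw [this, funConv_add hS hr hf (hg.const_smul _), funConv_smul hS hr _ hg]
  simp [sub_eq_add_neg]

theorem funConv_zero (hS : IsNuclear S) : funConv (0 : PhaseSpace d → ℂ) S = 0 := by
  refine clm_ext_inner fun a b => ?_
  rw [inner_funConv hS le_rfl MemLp.zero]
  simp

/-- Young's inequality for the convolution of a function and an operator. -/
theorem pairNorm_funConv_le (hS : IsNuclear S) {r : ℝ≥0∞} (hr : 1 ≤ r) {f : PhaseSpace d → ℂ}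
    (hf : MemLp f r volume) :
    pairNorm r (funConv f S) ≤ schattenNorm 1 S * eLpNorm f r volume := by
  obtain ⟨u, v, h, hc⟩ := exists_nuclearSum (isNuclear_iff.mp hS)
  refine le_trans (pairNorm_le fun n a b ha hb => ?_) (mul_le_mul_left hc _)
  -- Schur's test between the finite index set and phase space, with `shiftWeight` as kernel.
  refine eLpNorm_le_of_kernel (μ := (Measure.count : Measure (Fin n)))
    (W := fun k z => shiftWeight u v (a k) (b k) z) ?_ (fun k => ?_) (fun z => ?_)
    hf.aestronglyMeasurable (fun k => ?_) hr
  · exact measurable_from_prod_countable_right fun k => measurable_shiftWeight u v (a k) (b k)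
  · refine (lintegral_shiftWeight_le u v (a k) (b k)).trans (le_of_eq ?_)
    rw [← ofReal_norm (a k), ← ofReal_norm (b k), ha.1, hb.1]
    simp
  · rw [lintegral_count]
    exact tsum_shiftWeight_le ha hb u v z
  · rw [inner_funConv hS hr hf]
    refine (enorm_integral_le_lintegral_enorm _).trans (lintegral_mono fun z => ?_)
    rw [enorm_mul, mul_comm]
    exact mul_le_mul_left (h.enorm_inner_opShift_le (a k) (b k) z) _

end FunConv

/-! ### Convolution of two operators, and the trace formulas -/

section OpPair

variable {d : ℕ} {S T : L2 d →L[ℂ] L2 d}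

/-- The function `z ↦ tr(T α_z(S))`. -/
def opPair (T S : L2 d →L[ℂ] L2 d) (z : PhaseSpace d) : ℂ := trace (T ∘L opShift z S)

theorem opConv_eq_opPair (T S : L2 d →L[ℂ] L2 d) : opConv T S = opPair T (opCheck S) := rfl

theorem NuclearSum.hasSum_opPair {u v : ℕ → L2 d} (h : NuclearSum u v S) (T : L2 d →L[ℂ] L2 d)
    (z : PhaseSpace d) : HasSum
      (fun n => inner ℂ (timeFreqShift z (v n)) (T (timeFreqShift z (u n)))) (opPair T S z) :=
  (h.shift z).trace_comp_left T

theorem continuous_opPair (hS : IsNuclear S) (T : L2 d →L[ℂ] L2 d) : Continuous (opPair T S) := by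
  obtain ⟨u, v, h⟩ := hS
  have e : opPair T S = fun z =>
      ∑' n, inner ℂ (timeFreqShift z (v n)) (T (timeFreqShift z (u n))) :=
    funext fun z => (h.hasSum_opPair T z).tsum_eq.symm
  rw [e]
  refine continuous_tsum (fun n => (continuous_timeFreqShift (v n)).inner
    (T.continuous.comp (continuous_timeFreqShift (u n)))) (h.summable.mul_left ‖T‖) fun n z => ?_
  refine (norm_inner_le_norm _ _).trans ?_
  rw [norm_timeFreqShift]
  calc ‖v n‖ * ‖T (timeFreqShift z (u n))‖ ≤ ‖v n‖ * (‖T‖ * ‖timeFreqShift z (u n)‖) := by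
        gcongr; exact T.le_opNorm _
    _ = ‖T‖ * (‖u n‖ * ‖v n‖) := by rw [norm_timeFreqShift]; ring

theorem enorm_opPair_le (hS : IsNuclear S) (T : L2 d →L[ℂ] L2 d) (z : PhaseSpace d) :
    ‖opPair T S z‖ₑ ≤ ‖T‖ₑ * schattenNorm 1 S := by
  obtain ⟨u, v, h, hc⟩ := exists_nuclearSum (isNuclear_iff.mp hS)
  refine ((h.shift z).norm_trace_le T).trans ?_
  simp only [enorm_timeFreqShift]
  gcongr

theorem opPair_add_left (hS : IsNuclear S) (T₁ T₂ : L2 d →L[ℂ] L2 d) :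
    opPair (T₁ + T₂) S = opPair T₁ S + opPair T₂ S := by
  ext z
  rw [opPair, ContinuousLinearMap.add_comp]
  exact ((hS.shift z).comp_left T₁).trace_add ((hS.shift z).comp_left T₂)

theorem opPair_sub_left (hS : IsNuclear S) (T₁ T₂ : L2 d →L[ℂ] L2 d) :
    opPair (T₁ - T₂) S = opPair T₁ S - opPair T₂ S := by
  ext z
  rw [opPair, ContinuousLinearMap.sub_comp]
  exact ((hS.shift z).comp_left T₁).trace_sub ((hS.shift z).comp_left T₂)

theorem opPair_smul_left (c : ℂ) (T S : L2 d →L[ℂ] L2 d) :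
    opPair (c • T) S = c • opPair T S := by
  ext z
  rw [opPair, ContinuousLinearMap.smul_comp, trace_smul]
  rfl

theorem opPair_rankOne_right (T : L2 d →L[ℂ] L2 d) (x y : L2 d) (z : PhaseSpace d) :
    opPair T (rankOne ℂ x y) z = inner ℂ (timeFreqShift z y) (T (timeFreqShift z x)) := by
  rw [opPair, opShift_rankOne, trace_comp_rankOne]

theorem opPair_comm (hS : IsNuclear S) (T : L2 d →L[ℂ] L2 d) (z : PhaseSpace d) :
    opPair T S z = opPair S T (-z) := by
  rw [opPair, trace_comp_opShift hS, opPair, hS.trace_comp_comm]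

theorem opPair_opShift_left (hS : IsNuclear S) (T : L2 d →L[ℂ] L2 d) (w z : PhaseSpace d) :
    opPair (opShift w T) S z = opPair T S (z - w) := trace_opShift_comp hS T z w

theorem opPair_opShift_right (T S : L2 d →L[ℂ] L2 d) (w z : PhaseSpace d) :
    opPair T (opShift w S) z = opPair T S (z + w) := by
  rw [opPair, opShift_opShift, opPair]

theorem opPair_opCheck_right (hS : IsNuclear S) (T : L2 d →L[ℂ] L2 d) (z : PhaseSpace d) :
    opPair T (opCheck S) z = opPair (opCheck T) S (-z) := by
  have h := opCheck_opShift (-z) S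
  rw [neg_neg] at h
  rw [opPair, ← h, trace_comp_opCheck (hS.shift _), opPair]

/-- Young's inequality for the convolution of two operators. -/
theorem eLpNorm_opPair_le (hS : IsNuclear S) {p : ℝ≥0∞} (hp : 1 ≤ p) (T : L2 d →L[ℂ] L2 d) :
    eLpNorm (opPair T S) p volume ≤ schattenNorm 1 S * schattenNorm p T := by
  rcases eq_or_ne p ∞ with rfl | hpt
  · rw [eLpNorm_exponent_top]
    refine essSup_le_of_ae_le _ (Filter.Eventually.of_forall fun z => ?_)
    refine (enorm_opPair_le hS T z).trans ?_
    rw [mul_comm]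
    exact mul_le_mul' le_rfl
      ((enorm_le_pairNorm le_top T).trans (pairNorm_le_schattenNorm le_top T))
  by_cases hT : MemSchatten p T
  swap
  -- When T lies outside 𝒯^p the bound is infinite unless S has norm 0; then the product is 0, but
  -- the left side vanishes too.
  · rw [MemSchatten, not_lt_top_iff] at hT
    by_cases h0 : schattenNorm 1 S = 0
    · have : ∀ z, opPair T S z = 0 := fun z => by
        have := enorm_opPair_le hS T z
        rwa [h0, mul_zero, nonpos_iff_eq_zero, enorm_eq_zero] at this
      rw [show opPair T S = 0 from funext this]
      simp
    · rw [hT, ENNReal.mul_top h0]; exact le_top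
  obtain ⟨u, v, h, hc⟩ := exists_nuclearSum (isNuclear_iff.mp hS)
  obtain ⟨ι, _, s, a, b, hsvd, hs⟩ := exists_isSVD hp hpt hT
  let _ : MeasurableSpace ι := ⊤
  have hs' : eLpNorm s p Measure.count ≤ schattenNorm p T :=
    eLpNorm_count_le_of_tsum_le hp hpt (hs p hp hpt)
  -- The same kernel as for functions, now transposed and indexed by the singular vectors of T.
  refine (eLpNorm_le_of_kernel (ν := (Measure.count : Measure ι))
    (W := fun z i => shiftWeight u v (b i) (a i) z) ?_ (fun z => ?_) (fun i => ?_)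
    (Measurable.of_discrete).aestronglyMeasurable (fun z => ?_) hp).trans (mul_le_mul' hc hs')
  · exact measurable_from_prod_countable_left fun i => measurable_shiftWeight u v (b i) (a i)
  · rw [lintegral_count]
    exact tsum_shiftWeight_le hsvd.right hsvd.left u v z
  · refine (lintegral_shiftWeight_le u v (b i) (a i)).trans (le_of_eq ?_)
    rw [← ofReal_norm (a i), ← ofReal_norm (b i), hsvd.left.1, hsvd.right.1]
    simp
  · rw [lintegral_count, ← (h.hasSum_opPair T z).tsum_eq]
    refine enorm_tsum_le_tsum_enorm.trans ?_
    calc ∑' n, ‖inner ℂ (timeFreqShift z (v n)) (T (timeFreqShift z (u n)))‖ₑ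
        ≤ ∑' n, ∑' i, ‖inner ℂ (timeFreqShift z (v n)) (a i)‖ₑ *
            ‖inner ℂ (b i) (timeFreqShift z (u n))‖ₑ * ‖s i‖ₑ :=
          ENNReal.tsum_le_tsum fun n => hsvd.enorm_inner_le _ _
      _ = ∑' i, shiftWeight u v (b i) (a i) z * ‖s i‖ₑ := by
          rw [ENNReal.tsum_comm]
          refine tsum_congr fun i => ?_
          rw [shiftWeight, ← ENNReal.tsum_mul_right]
          refine tsum_congr fun n => ?_
          rw [mul_comm ‖inner ℂ (timeFreqShift z (v n)) (a i)‖ₑ]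

theorem memLp_opPair (hS : IsNuclear S) {p : ℝ≥0∞} (hp : 1 ≤ p) (hT : MemSchatten p T) :
    MemLp (opPair T S) p volume :=
  ⟨(continuous_opPair hS T).aestronglyMeasurable, (eLpNorm_opPair_le hS hp T).trans_lt
    (ENNReal.mul_lt_top (isNuclear_iff.mp hS) hT)⟩

theorem memLp_opPair_of_isNuclear (hS : IsNuclear S) (T : L2 d →L[ℂ] L2 d) :
    MemLp (opPair T S) ∞ volume := by
  refine ⟨(continuous_opPair hS T).aestronglyMeasurable, ?_⟩
  rw [eLpNorm_exponent_top]
  exact (essSup_le_of_ae_le _ (Filter.Eventually.of_forall (enorm_opPair_le hS T))).trans_lt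
    (ENNReal.mul_lt_top enorm_lt_top (isNuclear_iff.mp hS))

theorem isNuclear_funConv (hS : IsNuclear S) {f : PhaseSpace d → ℂ} (hf : MemLp f 1 volume) :
    IsNuclear (funConv f S) := by
  rw [isNuclear_iff, memSchatten_iff le_rfl]
  exact (pairNorm_funConv_le hS le_rfl hf).trans_lt
    (ENNReal.mul_lt_top (isNuclear_iff.mp hS) hf.2)

/-- `tr(T (f ∗ S)) = ∫ f(z) tr(T α_z(S)) dz` for a trace class operator `T`. -/
theorem trace_comp_funConv (hT : IsNuclear T) (hS : IsNuclear S) {r : ℝ≥0∞} (hr : 1 ≤ r)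
    {f : PhaseSpace d → ℂ} (hf : MemLp f r volume) :
    trace (T ∘L funConv f S) = ∫ z, f z * opPair T S z := by
  obtain ⟨u, v, h⟩ := hS
  have hS : IsNuclear S := ⟨u, v, h⟩
  obtain ⟨x, y, hxy⟩ := hT
  have h1 := hxy.trace_comp_left (funConv f S)
  rw [hxy.trace_comp_comm] at h1
  rw [← h1.tsum_eq]
  simp only [inner_funConv hS hr hf]
  rw [← integral_tsum]
  · refine integral_congr_ae (Filter.Eventually.of_forall fun z => ?_)
    have h2 := hxy.trace_comp_left (opShift z S)
    rw [hxy.trace_comp_comm] at h2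
    exact (h2.mul_left (f z)).tsum_eq
  · exact fun n => hf.aestronglyMeasurable.mul
      (continuous_inner_opShift (y n) (x n) S).aestronglyMeasurable
  · refine ne_top_of_le_ne_top ?_ (ENNReal.tsum_le_tsum fun n =>
      h.lintegral_mul_inner_opShift_le (y n) (x n) hr hf.aestronglyMeasurable)
    rw [ENNReal.tsum_mul_left, ENNReal.tsum_mul_right]
    refine ENNReal.mul_ne_top hf.2.ne (ENNReal.mul_ne_top ?_ h.tsum_enorm_ne_top)
    have := hxy.tsum_enorm_ne_top
    simpa only [mul_comm] using this

/-- `tr(T (f ∗ S)) = ∫ f(z) tr(T α_z(S)) dz` for an integrable function `f`. -/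
theorem trace_comp_funConv_of_integrable (hS : IsNuclear S) (T : L2 d →L[ℂ] L2 d)
    {f : PhaseSpace d → ℂ} (hf : MemLp f 1 volume) :
    trace (T ∘L funConv f S) = ∫ z, f z * opPair T S z := by
  obtain ⟨u, v, h⟩ := hS
  have hS : IsNuclear S := ⟨u, v, h⟩
  let e := traceBasis (L2 d)
  have : Fact ((2 : ℝ≥0∞) ≠ ∞) := ⟨by norm_num⟩
  have hsep : TopologicalSpace.SeparableSpace (L2 d) := inferInstance
  -- T is merely bounded here, so the trace is expanded in an orthonormal basis; countability of the
  -- basis allows sum and integral to be interchanged.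
  have hcount : Countable _ := countable_of_orthonormal e.orthonormal
  have h1 : HasSum (fun i => ∫ z, f z * inner ℂ (T.adjoint (e i)) (opShift z S (e i)))
      (trace (T ∘L funConv f S)) := by
    refine ((isNuclear_funConv hS hf).comp_left T).hasSum_trace.congr_fun fun i => ?_
    rw [← inner_funConv hS le_rfl hf, ContinuousLinearMap.adjoint_inner_left]
    rfl
  rw [← h1.tsum_eq, ← integral_tsum]
  · refine integral_congr_ae (Filter.Eventually.of_forall fun z => ?_)
    have h2 := (((hS.shift z).comp_left T).hasSum_trace).mul_left (f z)
    refine (HasSum.congr_fun h2 fun i => ?_).tsum_eq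
    rw [ContinuousLinearMap.adjoint_inner_left]
    rfl
  · exact fun n => hf.aestronglyMeasurable.mul
      (continuous_inner_opShift _ _ S).aestronglyMeasurable
  · have hm : ∀ i, AEMeasurable
        (fun z => ‖f z * inner ℂ (T.adjoint (e i)) (opShift z S (e i))‖ₑ) volume := fun i =>
      (hf.aestronglyMeasurable.mul (continuous_inner_opShift _ _ S).aestronglyMeasurable).enorm
    rw [← lintegral_tsum hm]
    -- A bound on the diagonal sum uniform in z, by Bessel applied to each nuclear term;
    -- integrability of f then suffices.
    have hb : ∀ z, ∑' i, ‖f z * inner ℂ (T.adjoint (e i)) (opShift z S (e i))‖ₑ ≤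
        ‖f z‖ₑ * (‖T‖ₑ * ∑' n, ‖u n‖ₑ * ‖v n‖ₑ) := by
      intro z
      simp only [enorm_mul, ENNReal.tsum_mul_left]
      gcongr
      calc ∑' i, ‖inner ℂ (T.adjoint (e i)) (opShift z S (e i))‖ₑ
          ≤ ∑' i, ∑' n, ‖inner ℂ (T.adjoint (e i)) (timeFreqShift z (u n))‖ₑ *
              ‖inner ℂ (timeFreqShift z (v n)) (e i)‖ₑ :=
            ENNReal.tsum_le_tsum fun i => (h.shift z).enorm_inner_le _ _
        _ = ∑' n, ∑' i, ‖inner ℂ (e i) (T (timeFreqShift z (u n)))‖ₑ *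
              ‖inner ℂ (timeFreqShift z (v n)) (e i)‖ₑ := by
            rw [ENNReal.tsum_comm]
            simp only [ContinuousLinearMap.adjoint_inner_left]
        _ ≤ ∑' n, ‖T (timeFreqShift z (u n))‖ₑ * ‖timeFreqShift z (v n)‖ₑ :=
            ENNReal.tsum_le_tsum fun n =>
              tsum_enorm_inner_mul_le e.orthonormal e.orthonormal _ _
        _ ≤ ∑' n, ‖T‖ₑ * (‖u n‖ₑ * ‖v n‖ₑ) := by
            refine ENNReal.tsum_le_tsum fun n => ?_
            rw [enorm_timeFreqShift, ← mul_assoc]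
            gcongr
            refine (T.le_opENorm _).trans ?_
            rw [enorm_timeFreqShift]
        _ = _ := ENNReal.tsum_mul_left
    refine ne_top_of_le_ne_top ?_ (lintegral_mono hb)
    have hT : ‖T‖ₑ * ∑' n, ‖u n‖ₑ * ‖v n‖ₑ ≠ ∞ :=
      ENNReal.mul_ne_top enorm_ne_top h.tsum_enorm_ne_top
    rw [lintegral_mul_const' _ _ hT]
    refine ENNReal.mul_ne_top ?_ hT
    rw [← eLpNorm_one_eq_lintegral_enorm]
    exact hf.2.ne

end OpPair

/-! ### Density of plane waves times a Gaussian -/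

section GaussianWaves

open FourierTransform BoundedContinuousFunction

variable {V : Type*} [NormedAddCommGroup V] [InnerProductSpace ℝ V]

/-- The plane wave `e^{2πi⟨ξ,z⟩}` times the Gaussian `e^{-c|z|²}`. -/
def gaussWave (c : ℝ) (ξ z : V) : ℂ :=
  (Real.exp (-c * ‖z‖ ^ 2) : ℂ) * Complex.exp (2 * Real.pi * Complex.I * (inner ℝ ξ z : ℝ))

theorem norm_gaussWave (c : ℝ) (ξ z : V) : ‖gaussWave c ξ z‖ = Real.exp (-c * ‖z‖ ^ 2) := by
  rw [gaussWave, norm_mul, Complex.norm_exp, Complex.norm_real, Real.norm_eq_abs, Real.abs_exp]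
  simp

theorem continuous_gaussWave (c : ℝ) (ξ : V) : Continuous (gaussWave c ξ) := by
  unfold gaussWave
  fun_prop

/-- `gaussWave` as a bounded continuous function. -/
def gaussWaveBCF {c : ℝ} (hc : 0 < c) (ξ : V) : V →ᵇ ℂ :=
  BoundedContinuousFunction.ofNormedAddCommGroup (gaussWave c ξ) (continuous_gaussWave c ξ) 1
    fun z => by
      rw [norm_gaussWave, Real.exp_le_one_iff]
      nlinarith [sq_nonneg ‖z‖]

theorem gaussWaveBCF_apply {c : ℝ} (hc : 0 < c) (ξ z : V) :
    gaussWaveBCF hc ξ z = gaussWave c ξ z := rfl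

theorem norm_gaussWaveBCF_le {c : ℝ} (hc : 0 < c) (ξ : V) : ‖gaussWaveBCF hc ξ‖ ≤ 1 := by
  refine (BoundedContinuousFunction.norm_le zero_le_one).mpr fun z => ?_
  rw [gaussWaveBCF_apply, norm_gaussWave, Real.exp_le_one_iff]
  nlinarith [sq_nonneg ‖z‖]

/-- The difference of two plane waves grows like ‖ξ - η‖‖z‖. The Gaussian absorbs ‖z‖, which makes ξ
↦ `gaussWaveBCF` Lipschitz in the supremum norm. -/
theorem exp_neg_mul_sq_mul_le {c : ℝ} (hc : 0 < c) (r : ℝ) :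
    Real.exp (-c * r ^ 2) * r ≤ 1 + 1 / c := by
  have h1 : Real.exp (-c * r ^ 2) * (1 + c * r ^ 2) ≤ 1 := by
    have := Real.add_one_le_exp (c * r ^ 2)
    calc Real.exp (-c * r ^ 2) * (1 + c * r ^ 2) ≤ Real.exp (-c * r ^ 2) * Real.exp (c * r ^ 2) := by
          gcongr; linarith
      _ = 1 := by rw [← Real.exp_add]; simp
  have h2 : r ≤ (1 + 1 / c) * (1 + c * r ^ 2) := by
    have : (1 + 1 / c) * (1 + c * r ^ 2) = 1 + c * r ^ 2 + 1 / c + r ^ 2 := by field_simp; ring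
    rw [this]
    have : 0 < 1 / c := by positivity
    nlinarith [sq_nonneg (r - 1), mul_nonneg hc.le (sq_nonneg r)]
  calc Real.exp (-c * r ^ 2) * r
      ≤ Real.exp (-c * r ^ 2) * ((1 + 1 / c) * (1 + c * r ^ 2)) := by gcongr
    _ = (1 + 1 / c) * (Real.exp (-c * r ^ 2) * (1 + c * r ^ 2)) := by ring
    _ ≤ (1 + 1 / c) * 1 := by gcongr
    _ = _ := mul_one _

theorem continuous_gaussWaveBCF {c : ℝ} (hc : 0 < c) :
    Continuous fun ξ : V => gaussWaveBCF hc ξ := by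
  set K : ℝ := 2 * Real.pi * (1 + 1 / c) with hK
  have hK0 : 0 ≤ K := by positivity
  refine (LipschitzWith.of_dist_le_mul (K := ⟨K, hK0⟩) fun ξ η => ?_).continuous
  refine (BoundedContinuousFunction.dist_le (by positivity)).mpr fun z => ?_
  rw [gaussWaveBCF_apply, gaussWaveBCF_apply, dist_eq_norm, dist_eq_norm, gaussWave, gaussWave,
    ← mul_sub, norm_mul, Complex.norm_real, Real.norm_eq_abs, Real.abs_exp]
  have e : Complex.exp (2 * Real.pi * Complex.I * (inner ℝ ξ z : ℝ)) -
      Complex.exp (2 * Real.pi * Complex.I * (inner ℝ η z : ℝ)) =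
      Complex.exp (2 * Real.pi * Complex.I * (inner ℝ η z : ℝ)) *
        (Complex.exp (Complex.I * ((2 * Real.pi * inner ℝ (ξ - η) z : ℝ) : ℂ)) - 1) := by
    rw [mul_sub, ← Complex.exp_add, mul_one, inner_sub_left]
    congr 2
    push_cast
    ring
  have h1 : ‖Complex.exp (2 * Real.pi * Complex.I * (inner ℝ η z : ℝ))‖ = 1 := by
    rw [Complex.norm_exp]; simp
  rw [e, norm_mul, h1, one_mul]
  calc Real.exp (-c * ‖z‖ ^ 2) *
        ‖Complex.exp (Complex.I * ((2 * Real.pi * inner ℝ (ξ - η) z : ℝ) : ℂ)) - 1‖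
      ≤ Real.exp (-c * ‖z‖ ^ 2) * ‖2 * Real.pi * inner ℝ (ξ - η) z‖ := by
        gcongr
        exact Real.norm_exp_I_mul_ofReal_sub_one_le
    _ ≤ Real.exp (-c * ‖z‖ ^ 2) * (2 * Real.pi * (‖ξ - η‖ * ‖z‖)) := by
        gcongr
        rw [norm_mul, Real.norm_of_nonneg (by positivity : 0 ≤ 2 * Real.pi)]
        gcongr
        exact norm_inner_le_norm _ _
    _ = 2 * Real.pi * (Real.exp (-c * ‖z‖ ^ 2) * ‖z‖) * ‖ξ - η‖ := by ring
    _ ≤ K * ‖ξ - η‖ := by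
        rw [hK]
        gcongr
        exact exp_neg_mul_sq_mul_le hc _

/-- A Bochner integral lies in the closed span of the values of its integrand. -/
theorem integral_mem_of_isClosed {X W : Type*} [MeasurableSpace X] {μ : Measure X}
    [NormedAddCommGroup W] [NormedSpace ℂ W] [CompleteSpace W] {M : Submodule ℂ W}
    (hM : IsClosed (M : Set W)) {F : X → W} (hF : Integrable F μ) (h : ∀ x, F x ∈ M) :
    ∫ x, F x ∂μ ∈ M := by
  have : IsClosed (M : Set W) := hM
  have h1 := M.mkQL.integral_comp_comm hF
  have h2 : ∀ x, M.mkQL (F x) = 0 := fun x => (Submodule.Quotient.mk_eq_zero M).mpr (h x)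
  simp only [h2, integral_zero] at h1
  exact (Submodule.Quotient.mk_eq_zero M).mp h1.symm

variable [FiniteDimensional ℝ V]

/-- Write h = e^{-c|z|²} H with H again a test function and expand H by Fourier inversion. Half of
the Gaussian turns the inversion formula into a Bochner integral of bounded continuous functions,
which lies in the closed span of its integrand's values; the other half remains as a weight on the
error, so that one estimate serves every L^p and C₀. -/
theorem exists_gaussWave_approx {c : ℝ} (hc : 0 < c) {h : V → ℂ}
    (hs : ContDiff ℝ ((⊤ : ℕ∞) : WithTop ℕ∞) h) (hcs : HasCompactSupport h) {ε : ℝ} (hε : 0 < ε) :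
    ∃ k ∈ Submodule.span ℂ (Set.range fun ξ : V => gaussWave c ξ),
      ∀ z, ‖h z - k z‖ ≤ ε * Real.exp (-(c / 2) * ‖z‖ ^ 2) := by
  borelize V
  have hc2 : 0 < c / 2 := by positivity
  have hcsH : HasCompactSupport fun z : V => h z * (Real.exp (c * ‖z‖ ^ 2) : ℂ) := hcs.mul_right
  have hsH : ContDiff ℝ ((⊤ : ℕ∞) : WithTop ℕ∞)
      fun z : V => h z * (Real.exp (c * ‖z‖ ^ 2) : ℂ) := by
    refine hs.mul (Complex.ofRealCLM.contDiff.comp ?_)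
    exact Real.contDiff_exp.comp (contDiff_const.mul (contDiff_norm_sq ℝ))
  set H := hcsH.toSchwartzMap hsH with hH
  have hHz : ∀ z, H z = h z * (Real.exp (c * ‖z‖ ^ 2) : ℂ) := fun z => by simp [hH]
  set M := (Submodule.span ℂ (Set.range fun ξ : V => gaussWaveBCF hc2 ξ)).topologicalClosure
  set Φ : V → V →ᵇ ℂ := fun ξ => (𝓕 H) ξ • gaussWaveBCF hc2 ξ with hΦ
  have hΦi : Integrable Φ volume := by
    refine (𝓕 H).integrable.mono ((𝓕 H).continuous.smul
      (continuous_gaussWaveBCF hc2)).aestronglyMeasurable (Filter.Eventually.of_forall fun ξ => ?_)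
    rw [hΦ, norm_smul]
    exact mul_le_of_le_one_right (norm_nonneg _) (norm_gaussWaveBCF_le hc2 ξ)
  have hmem : ∫ ξ, Φ ξ ∈ M := integral_mem_of_isClosed
    (Submodule.isClosed_topologicalClosure _) hΦi fun ξ =>
      M.smul_mem _ (Submodule.le_topologicalClosure _ (Submodule.subset_span ⟨ξ, rfl⟩))
  have hval : ∀ z, (∫ ξ, Φ ξ) z = (Real.exp (-(c / 2) * ‖z‖ ^ 2) : ℂ) * H z := by
    intro z
    have h1 := (BoundedContinuousFunction.evalCLM ℂ z).integral_comp_comm hΦi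
    have h2 : H z = 𝓕⁻ ((𝓕 H : SchwartzMap V ℂ) : V → ℂ) z := by
      rw [← SchwartzMap.fourierInv_coe, FourierTransform.fourierInv_fourier_eq]
    rw [h2, Real.fourierInv_eq', ← integral_const_mul]
    refine h1.symm.trans (integral_congr_ae (Filter.Eventually.of_forall fun ξ => ?_))
    change (𝓕 H) ξ * gaussWave (c / 2) ξ z = _
    beta_reduce
    rw [gaussWave, smul_eq_mul]
    push_cast
    ring_nf
  obtain ⟨k, hk, hkε⟩ := Metric.mem_closure_iff.mp hmem ε hε
  refine ⟨fun z => (Real.exp (-(c / 2) * ‖z‖ ^ 2) : ℂ) * k z, ?_, fun z => ?_⟩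
  · let L : (V →ᵇ ℂ) →ₗ[ℂ] (V → ℂ) :=
      { toFun := fun f z => (Real.exp (-(c / 2) * ‖z‖ ^ 2) : ℂ) * f z
        map_add' := fun f g => by ext z; simp [mul_add]
        map_smul' := fun a f => by ext z; simp; ring }
    have : Submodule.span ℂ (Set.range fun ξ : V => gaussWaveBCF hc2 ξ) ≤
        (Submodule.span ℂ (Set.range fun ξ : V => gaussWave c ξ)).comap L := by
      rw [Submodule.span_le]
      rintro _ ⟨ξ, rfl⟩
      refine Submodule.subset_span ⟨ξ, ?_⟩
      ext z
      change gaussWave c ξ z = (Real.exp (-(c / 2) * ‖z‖ ^ 2) : ℂ) * gaussWave (c / 2) ξ z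
      rw [gaussWave, gaussWave, ← mul_assoc, ← Complex.ofReal_mul, ← Real.exp_add]
      ring_nf
    exact this hk
  · have h1 : h z = (Real.exp (-(c / 2) * ‖z‖ ^ 2) : ℂ) * (∫ ξ, Φ ξ) z := by
      have e : (Real.exp (-(c / 2) * ‖z‖ ^ 2) : ℂ) * (Real.exp (-(c / 2) * ‖z‖ ^ 2) : ℂ) *
          (Real.exp (c * ‖z‖ ^ 2) : ℂ) = 1 := by
        rw [← Complex.ofReal_mul, ← Complex.ofReal_mul, ← Real.exp_add, ← Real.exp_add]
        ring_nf
        simp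
      rw [hval, hHz]
      linear_combination (-h z) * e
    rw [h1, ← mul_sub, norm_mul, Complex.norm_real, Real.norm_eq_abs, Real.abs_exp, mul_comm]
    gcongr
    rw [← dist_eq_norm]
    exact (BoundedContinuousFunction.dist_coe_le_dist z).trans hkε.le

end GaussianWaves

/-! ### Gaussian waves on phase space -/

section PhaseWaves

variable {d : ℕ}

/-- The radial Gaussian `e^{-c(|x|²+|ω|²)}` on phase space. -/
def phaseGauss (c : ℝ) (z : PhaseSpace d) : ℝ := Real.exp (-c * (‖z.1‖ ^ 2 + ‖z.2‖ ^ 2))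

/-- The plane wave of frequency `ξ` times the Gaussian `e^{-π|z|²}` on phase space. -/
def phaseWave (ξ z : PhaseSpace d) : ℂ :=
  phaseGauss Real.pi z * (character ξ.1 z.1 * character ξ.2 z.2)

theorem gaussWave_toLp (ξ z : PhaseSpace d) :
    gaussWave Real.pi (WithLp.toLp 2 ξ) (WithLp.toLp 2 z) = phaseWave ξ z := by
  rw [gaussWave, phaseWave, phaseGauss, character, character, ← Complex.exp_add,
    WithLp.prod_norm_sq_eq_of_L2, WithLp.prod_inner_apply,
    show (WithLp.toLp 2 z).fst = z.1 from rfl, show (WithLp.toLp 2 z).snd = z.2 from rfl]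
  push_cast
  ring_nf

theorem exists_phaseWave_approx {h : PhaseSpace d → ℂ}
    (hs : ContDiff ℝ ((⊤ : ℕ∞) : WithTop ℕ∞) h) (hcs : HasCompactSupport h) {ε : ℝ} (hε : 0 < ε) :
    ∃ k ∈ Submodule.span ℂ (Set.range fun ξ : PhaseSpace d => phaseWave ξ),
      ∀ z, ‖h z - k z‖ ≤ ε * phaseGauss (Real.pi / 2) z := by
  -- `PhaseSpace` carries the supremum norm of a product, so the inner-product statement is applied
  -- on the ℓ² product and transported.
  let e := WithLp.prodContinuousLinearEquiv 2 ℝ (EuclideanSpace ℝ (Fin d)) (EuclideanSpace ℝ (Fin d))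
  obtain ⟨k, hk, hkε⟩ := exists_gaussWave_approx Real.pi_pos (h := h ∘ e)
    (hs.comp e.contDiff) (hcs.comp_homeomorph e.toHomeomorph) hε
  refine ⟨fun z => k (WithLp.toLp 2 z), ?_, fun z => ?_⟩
  · let L : (WithLp 2 (PhaseSpace d) → ℂ) →ₗ[ℂ] (PhaseSpace d → ℂ) :=
      LinearMap.funLeft ℂ ℂ (WithLp.toLp 2)
    have : Submodule.span ℂ (Set.range fun ξ : WithLp 2 (PhaseSpace d) => gaussWave Real.pi ξ) ≤
        (Submodule.span ℂ (Set.range fun ξ : PhaseSpace d => phaseWave ξ)).comap L := by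
      rw [Submodule.span_le]
      rintro _ ⟨ξ, rfl⟩
      refine Submodule.subset_span ⟨WithLp.ofLp ξ, ?_⟩
      ext z
      exact (gaussWave_toLp (WithLp.ofLp ξ) z).symm
    exact this hk
  · have := hkε (WithLp.toLp 2 z)
    rw [WithLp.prod_norm_sq_eq_of_L2] at this
    exact this

theorem phaseGauss_pos (c : ℝ) (z : PhaseSpace d) : 0 < phaseGauss c z := Real.exp_pos _

theorem norm_phaseWave (ξ z : PhaseSpace d) : ‖phaseWave ξ z‖ = phaseGauss Real.pi z := by
  rw [phaseWave, norm_mul, norm_mul, norm_character, norm_character, Complex.norm_real,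
    Real.norm_of_nonneg (phaseGauss_pos _ z).le]
  ring

theorem continuous_phaseGauss (c : ℝ) : Continuous (phaseGauss c : PhaseSpace d → ℝ) := by
  unfold phaseGauss
  fun_prop

theorem phaseGauss_le_one {c : ℝ} (hc : 0 ≤ c) (z : PhaseSpace d) : phaseGauss c z ≤ 1 := by
  rw [phaseGauss, Real.exp_le_one_iff]
  have : 0 ≤ c * (‖z.1‖ ^ 2 + ‖z.2‖ ^ 2) := by positivity
  linarith

theorem integrable_phaseGauss {c : ℝ} (hc : 0 < c) :
    Integrable (phaseGauss c : PhaseSpace d → ℝ) volume := by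
  have h1 : Integrable (fun x : EuclideanSpace ℝ (Fin d) => Real.exp (-c * ‖x‖ ^ 2)) volume := by
    have := (GaussianFourier.integrable_cexp_neg_mul_sq_norm_add (b := (c : ℂ)) (by simpa) 0
      (0 : EuclideanSpace ℝ (Fin d))).norm
    refine this.congr (Filter.Eventually.of_forall fun x => ?_)
    beta_reduce
    rw [Complex.norm_exp]
    congr 1
    simp [← Complex.ofReal_pow]
  refine (h1.mul_prod h1).congr (Filter.Eventually.of_forall fun z => ?_)
  beta_reduce
  rw [phaseGauss, ← Real.exp_add]
  ring_nf

theorem memLp_phaseGauss {c : ℝ} (hc : 0 < c) {p : ℝ≥0∞} (hp : 1 ≤ p) :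
    MemLp (phaseGauss c : PhaseSpace d → ℝ) p volume := by
  have hcont : Continuous fun z : PhaseSpace d => (phaseGauss c z : ℂ) :=
    Complex.continuous_ofReal.comp (continuous_phaseGauss c)
  have hnorm : ∀ z : PhaseSpace d, ‖(phaseGauss c z : ℂ)‖ = phaseGauss c z := fun z => by
    rw [Complex.norm_real, Real.norm_of_nonneg (phaseGauss_pos c z).le]
  have hint : Integrable (fun z : PhaseSpace d => (phaseGauss c z : ℂ)) volume :=
    (integrable_phaseGauss hc).ofReal
  have h1 : MemLp (fun z : PhaseSpace d => (phaseGauss c z : ℂ)) p volume := by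
    refine ⟨hcont.aestronglyMeasurable, ?_⟩
    refine (eLpNorm_le_of_le_of_lintegral_le hcont.measurable
      (C := max 1 (∫⁻ z : PhaseSpace d, ‖(phaseGauss c z : ℂ)‖ₑ)) (fun z => ?_)
      (le_max_right _ _) hp).trans_lt (max_lt (by simp) hint.2)
    refine le_trans ?_ (le_max_left _ _)
    rw [← ofReal_norm, hnorm]
    exact ENNReal.ofReal_le_one.mpr (phaseGauss_le_one hc.le z)
  exact h1.of_le (continuous_phaseGauss c).aestronglyMeasurable
    (Filter.Eventually.of_forall fun z => by
      rw [hnorm, Real.norm_of_nonneg (phaseGauss_pos c z).le])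

theorem continuous_phaseWave (ξ : PhaseSpace d) : Continuous (phaseWave ξ) := by
  unfold phaseWave
  exact (Complex.continuous_ofReal.comp (continuous_phaseGauss _)).mul
    (((continuous_character _).comp continuous_fst).mul ((continuous_character _).comp continuous_snd))

theorem memLp_phaseWave (ξ : PhaseSpace d) {p : ℝ≥0∞} (hp : 1 ≤ p) :
    MemLp (phaseWave ξ) p volume :=
  (memLp_phaseGauss Real.pi_pos hp).of_le (continuous_phaseWave ξ).aestronglyMeasurable
    (Filter.Eventually.of_forall fun z => by
      rw [norm_phaseWave, Real.norm_of_nonneg (phaseGauss_pos _ z).le])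

theorem memLp_of_mem_span_phaseWave {k : PhaseSpace d → ℂ}
    (hk : k ∈ Submodule.span ℂ (Set.range fun ξ : PhaseSpace d => phaseWave ξ)) {p : ℝ≥0∞}
    (hp : 1 ≤ p) : MemLp k p volume := by
  induction hk using Submodule.span_induction with
  | mem x hx => obtain ⟨ξ, rfl⟩ := hx; exact memLp_phaseWave ξ hp
  | zero => exact MemLp.zero
  | add x y _ _ hx hy => exact hx.add hy
  | smul a x _ hx => exact hx.const_smul a

/-- The functionals given by the Gaussian waves separate the points of `L^q`. -/
theorem ae_eq_zero_of_integral_phaseWave {q : ℝ≥0∞} (hq : 1 ≤ q) {F : PhaseSpace d → ℂ}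
    (hF : MemLp F q volume) (h : ∀ ξ, ∫ z, F z * phaseWave ξ z = 0) : F =ᵐ[volume] 0 := by
  obtain ⟨p, hp, hqp⟩ := exists_conjugate hq
  have hspan : ∀ k ∈ Submodule.span ℂ (Set.range fun ξ : PhaseSpace d => phaseWave ξ),
      ∫ z, F z * k z = 0 := by
    intro k hk
    induction hk using Submodule.span_induction with
    | mem x hx => obtain ⟨ξ, rfl⟩ := hx; exact h ξ
    | zero => simp
    | add x y hx hy hx0 hy0 =>
      have e : ∀ z, F z * (x + y) z = F z * x z + F z * y z := fun z => mul_add _ _ _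
      simp only [e]
      rw [integral_add (integrable_mul_of_memLp hF (memLp_of_mem_span_phaseWave hx hp) hqp)
        (integrable_mul_of_memLp hF (memLp_of_mem_span_phaseWave hy hp) hqp), hx0, hy0, add_zero]
    | smul a x hx hx0 =>
      have e : ∀ z, F z * (a • x) z = a * (F z * x z) := fun z => by
        rw [Pi.smul_apply, smul_eq_mul]; ring
      simp only [e]
      rw [integral_const_mul, hx0, mul_zero]
  refine ae_eq_zero_of_integral_contDiff_smul_eq_zero (hF.locallyIntegrable hq) fun g hg hgc => ?_
  have hg₁ : HasCompactSupport (Complex.ofRealCLM ∘ g) := hgc.comp_left rfl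
  have hg₂ : ContDiff ℝ ((⊤ : ℕ∞) : WithTop ℕ∞) (Complex.ofRealCLM ∘ g) :=
    Complex.ofRealCLM.contDiff.comp hg
  have hgp : MemLp (Complex.ofRealCLM ∘ g) p volume :=
    hg₂.continuous.memLp_of_hasCompactSupport hg₁
  have e : ∫ z, g z • F z = ∫ z, F z * (Complex.ofRealCLM ∘ g) z := by
    refine integral_congr_ae (Filter.Eventually.of_forall fun z => ?_)
    simp [mul_comm]
  rw [e]
  -- F times the error weight is integrable by Hölder, so the approximation error in the pairing
  -- with F is at most ε.
  have hvF : Integrable (fun z : PhaseSpace d => F z * (phaseGauss (Real.pi / 2) z : ℂ)) volume :=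
    integrable_mul_of_memLp hF (memLp_phaseGauss (by positivity) hp).ofReal hqp
  set I := ∫ z : PhaseSpace d, ‖F z * (phaseGauss (Real.pi / 2) z : ℂ)‖ with hI
  have hI0 : 0 ≤ I := integral_nonneg fun _ => norm_nonneg _
  refine norm_le_zero_iff.mp (le_of_forall_pos_le_add fun ε hε => ?_)
  obtain ⟨k, hk, hkε⟩ := exists_phaseWave_approx hg₂ hg₁ (ε := ε / (I + 1)) (by positivity)
  have hkp := memLp_of_mem_span_phaseWave hk hp
  have e2 : ∫ z, F z * (Complex.ofRealCLM ∘ g) z =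
      ∫ z, F z * ((Complex.ofRealCLM ∘ g) z - k z) := by
    simp only [mul_sub]
    rw [integral_sub (integrable_mul_of_memLp hF hgp hqp) (integrable_mul_of_memLp hF hkp hqp),
      hspan k hk, sub_zero]
  rw [e2, zero_add]
  calc ‖∫ z, F z * ((Complex.ofRealCLM ∘ g) z - k z)‖
      ≤ ∫ z, ε / (I + 1) * ‖F z * (phaseGauss (Real.pi / 2) z : ℂ)‖ := by
        refine norm_integral_le_of_norm_le (hvF.norm.const_mul _)
          (Filter.Eventually.of_forall fun z => ?_)
        rw [norm_mul, norm_mul, Complex.norm_real, Real.norm_of_nonneg (phaseGauss_pos _ z).le,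
          mul_left_comm]
        gcongr
        exact hkε z
    _ = ε / (I + 1) * I := integral_const_mul _ _
    _ ≤ ε := by
        rw [div_mul_eq_mul_div, div_le_iff₀ (by positivity)]
        nlinarith

/-- The Gaussian waves span a dense subspace of `L^p`. -/
theorem exists_phaseWave_eLpNorm_sub_lt {p : ℝ≥0∞} (hp : 1 ≤ p) (hpt : p ≠ ∞)
    {F : PhaseSpace d → ℂ} (hF : MemLp F p volume) {ε : ℝ≥0∞} (hε : 0 < ε) :
    ∃ k ∈ Submodule.span ℂ (Set.range fun ξ : PhaseSpace d => phaseWave ξ),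
      eLpNorm (F - k) p volume < ε := by
  obtain ⟨δ, hδ, hδε⟩ : ∃ δ : ℝ, 0 < δ ∧ ENNReal.ofReal δ + ENNReal.ofReal δ < ε := by
    obtain ⟨η, hη, hηε⟩ := ENNReal.lt_iff_exists_nnreal_btwn.mp hε
    refine ⟨η / 2, by simpa using hη, ?_⟩
    rw [← ENNReal.ofReal_add (by positivity) (by positivity), add_halves]
    simpa using hηε
  obtain ⟨g, hgc, hgs, hg⟩ := hF.exist_eLpNorm_sub_le hpt hp hδ
  have hv := memLp_phaseGauss (d := d) (c := Real.pi / 2) (by positivity) hp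
  set N := (eLpNorm (phaseGauss (Real.pi / 2) : PhaseSpace d → ℝ) p volume).toReal with hN
  have hN0 : 0 ≤ N := ENNReal.toReal_nonneg
  obtain ⟨k, hk, hkε⟩ := exists_phaseWave_approx hgs hgc (ε := δ / (N + 1)) (by positivity)
  refine ⟨k, hk, ?_⟩
  have hkp := memLp_of_mem_span_phaseWave hk hp
  have hgp : MemLp g p volume := hgs.continuous.memLp_of_hasCompactSupport hgc
  have h2 : eLpNorm (g - k) p volume ≤ ENNReal.ofReal δ := by
    have h3 : eLpNorm (g - k) p volume ≤
        eLpNorm ((δ / (N + 1)) • (phaseGauss (Real.pi / 2) : PhaseSpace d → ℝ)) p volume := by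
      refine eLpNorm_mono fun z => ?_
      rw [Pi.smul_apply, smul_eq_mul, norm_mul, Real.norm_of_nonneg (by positivity),
        Real.norm_of_nonneg (phaseGauss_pos _ z).le]
      exact hkε z
    refine h3.trans (eLpNorm_const_smul_le.trans ?_)
    rw [← ENNReal.ofReal_toReal hv.2.ne, ← hN, Real.enorm_of_nonneg (by positivity),
      ← ENNReal.ofReal_mul (by positivity)]
    refine ENNReal.ofReal_le_ofReal ?_
    rw [div_mul_eq_mul_div, div_le_iff₀ (by positivity)]
    nlinarith
  calc eLpNorm (F - k) p volume = eLpNorm ((F - g) + (g - k)) p volume := by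
        rw [sub_add_sub_cancel]
    _ ≤ eLpNorm (F - g) p volume + eLpNorm (g - k) p volume :=
        eLpNorm_add_le (hF.sub hgp).aestronglyMeasurable (hgp.sub hkp).aestronglyMeasurable hp
    _ ≤ ENNReal.ofReal δ + ENNReal.ofReal δ := by gcongr
    _ < ε := hδε

end PhaseWaves

/-! ### Approximation in C₀ -/

section ZeroAtInfinity

/-- Soft thresholding: shrink the modulus of F by ε, down to 0 where it is at most ε. Decay at
infinity makes the support compact without any cut-off function. -/
theorem exists_hasCompactSupport_approx {X : Type*} [TopologicalSpace X] [T2Space X]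
    (F : C₀(X, ℂ)) {ε : ℝ} (hε : 0 < ε) :
    ∃ g : X → ℂ, Continuous g ∧ HasCompactSupport g ∧ ∀ x, ‖F x - g x‖ ≤ ε := by
  have hFc : Continuous F := map_continuous F
  have hm : ∀ x, 0 < max ‖F x‖ ε := fun x => lt_max_of_lt_right hε
  set t : X → ℝ := fun x => max (‖F x‖ - ε) 0 / max ‖F x‖ ε with ht
  refine ⟨fun x => (t x : ℂ) * F x, ?_, ?_, fun x => ?_⟩
  · have : Continuous t := by
      refine Continuous.div (by fun_prop) (by fun_prop) fun x => (hm x).ne'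
    fun_prop
  · have h0 := Metric.tendsto_nhds.mp F.zero_at_infty' ε hε
    obtain ⟨K, hK, hKs⟩ := Filter.mem_cocompact.mp h0
    refine HasCompactSupport.intro hK fun x hx => ?_
    have h1 : ‖F x‖ < ε := by simpa using hKs hx
    have : t x = 0 := by rw [ht]; simp [max_eq_right (by linarith : ‖F x‖ - ε ≤ 0)]
    simp [this]
  · have e : F x - (t x : ℂ) * F x = ((1 - t x : ℝ) : ℂ) * F x := by push_cast; ring
    rw [e, norm_mul, Complex.norm_real]
    rcases le_total ‖F x‖ ε with h | h
    · have : t x = 0 := by rw [ht]; simp [max_eq_right (by linarith : ‖F x‖ - ε ≤ 0)]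
      rw [this]; simpa using h
    · have h0 : 0 < ‖F x‖ := hε.trans_le h
      have : 1 - t x = ε / ‖F x‖ := by
        rw [ht]
        simp only [max_eq_left h, max_eq_left (by linarith : 0 ≤ ‖F x‖ - ε)]
        field_simp
        ring
      rw [this, Real.norm_of_nonneg (by positivity), div_mul_cancel₀ _ h0.ne']

/-- The Gaussian waves span a dense subspace of `C₀`. -/
theorem exists_phaseWave_norm_sub_lt {d : ℕ} (F : C₀(PhaseSpace d, ℂ)) {ε : ℝ} (hε : 0 < ε) :
    ∃ k ∈ Submodule.span ℂ (Set.range fun ξ : PhaseSpace d => phaseWave ξ),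
      ∀ z, ‖F z - k z‖ ≤ ε := by
  have hε3 : 0 < ε / 3 := by positivity
  obtain ⟨g, hgc, hgs, hg⟩ := exists_hasCompactSupport_approx F hε3
  obtain ⟨g', hg's, hg', hsupp⟩ := hgc.exists_contDiff_approx ⊤ (ε := fun _ => ε / 3)
    continuous_const (fun _ => hε3)
  obtain ⟨k, hk, hkε⟩ := exists_phaseWave_approx hg's (hgs.mono hsupp) hε3
  refine ⟨k, hk, fun z => ?_⟩
  have h1 := hg z
  have h2 := (hg' z).le
  rw [dist_comm, dist_eq_norm] at h2
  have h3 : ‖g' z - k z‖ ≤ ε / 3 := (hkε z).trans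
    (mul_le_of_le_one_right hε3.le (phaseGauss_le_one (by positivity) z))
  calc ‖F z - k z‖ = ‖(F z - g z) + (g z - g' z) + (g' z - k z)‖ := by congr 1; ring
    _ ≤ ε / 3 + ε / 3 + ε / 3 := by
        refine (norm_add₃_le).trans ?_
        gcongr
    _ = ε := by ring

end ZeroAtInfinity

/-! ### Gaussians with complex parameter -/

section Gaussians

variable {d : ℕ}

theorem integral_cexp_quadratic_euclidean {b : ℂ} (hb : 0 < b.re) (c : Fin d → ℂ) :
    ∫ t : EuclideanSpace ℝ (Fin d), Complex.exp (-b * ∑ i, (t i : ℂ) ^ 2 + ∑ i, c i * t i) =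
      (Real.pi / b) ^ (d / 2 : ℂ) * Complex.exp ((∑ i, c i ^ 2) / (4 * b)) := by
  have h := (PiLp.volume_preserving_ofLp (Fin d)).integral_comp
    (MeasurableEquiv.toLp 2 (Fin d → ℝ)).symm.measurableEmbedding
    (fun v : Fin d → ℝ => Complex.exp (-b * ∑ i, (v i : ℂ) ^ 2 + ∑ i, c i * v i))
  refine h.trans ?_
  rw [GaussianFourier.integral_cexp_neg_mul_sum_add hb c, Fintype.card_fin]

/-- The Gaussian `t ↦ e^{-πt² + 2πa·t}` with complex `a`. -/
def gaussFun (a : Fin d → ℂ) (t : EuclideanSpace ℝ (Fin d)) : ℂ :=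
  Complex.exp (-Real.pi * ∑ i, (t i : ℂ) ^ 2 + 2 * Real.pi * ∑ i, a i * t i)

theorem continuous_gaussFun (a : Fin d → ℂ) : Continuous (gaussFun a) := by
  unfold gaussFun
  fun_prop

theorem norm_sum_mul_le (e : Fin d → ℂ) (t : EuclideanSpace ℝ (Fin d)) :
    ‖∑ i, e i * (t i : ℂ)‖ ≤ (∑ i, ‖e i‖) * ‖t‖ := by
  rw [Finset.sum_mul]
  refine (norm_sum_le _ _).trans (Finset.sum_le_sum fun i _ => ?_)
  rw [norm_mul, Complex.norm_real]
  gcongr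
  exact PiLp.norm_apply_le t i

theorem sum_sq_eq_norm_sq (t : EuclideanSpace ℝ (Fin d)) :
    ∑ i, (t i : ℂ) ^ 2 = ((‖t‖ ^ 2 : ℝ) : ℂ) := by
  rw [EuclideanSpace.norm_sq_eq]
  push_cast
  refine Finset.sum_congr rfl fun i _ => ?_
  rw [← Complex.ofReal_pow, ← Complex.ofReal_pow, Real.norm_eq_abs, sq_abs]

theorem norm_gaussFun_le (a : Fin d → ℂ) (t : EuclideanSpace ℝ (Fin d)) :
    ‖gaussFun a t‖ ≤ Real.exp (-Real.pi * ‖t‖ ^ 2 + (2 * Real.pi * ∑ i, ‖a i‖) * ‖t‖) := by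
  rw [gaussFun, Complex.norm_exp, Real.exp_le_exp, Complex.add_re, sum_sq_eq_norm_sq]
  have h1 : (-(Real.pi : ℂ) * ((‖t‖ ^ 2 : ℝ) : ℂ)).re = -Real.pi * ‖t‖ ^ 2 := by
    rw [← Complex.ofReal_neg, ← Complex.ofReal_mul, Complex.ofReal_re]
  have h2 : (2 * (Real.pi : ℂ) * ∑ i, a i * (t i : ℂ)).re ≤
      (2 * Real.pi * ∑ i, ‖a i‖) * ‖t‖ := by
    refine (Complex.re_le_norm _).trans ?_
    rw [norm_mul, norm_mul, Complex.norm_real, Real.norm_of_nonneg Real.pi_pos.le, mul_assoc,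
      mul_assoc, mul_assoc, Complex.norm_ofNat]
    gcongr
    exact norm_sum_mul_le a t
  rw [h1]
  gcongr

theorem memLp_two_of_gaussian_bound {F : EuclideanSpace ℝ (Fin d) → ℂ} (hF : Continuous F)
    {A B : ℝ} (h : ∀ t, ‖F t‖ ≤ A * Real.exp (-Real.pi * ‖t‖ ^ 2 + B * ‖t‖)) :
    MemLp F 2 volume := by
  have hA : 0 ≤ A := by
    have := (norm_nonneg _).trans (h 0)
    exact nonneg_of_mul_nonneg_left this (Real.exp_pos _)
  have h1 : Integrable (fun t : EuclideanSpace ℝ (Fin d) => Real.exp (-Real.pi * ‖t‖ ^ 2)) volume := by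
    have := (GaussianFourier.integrable_cexp_neg_mul_sq_norm_add (b := (Real.pi : ℂ))
      (by simpa using Real.pi_pos) 0 (0 : EuclideanSpace ℝ (Fin d))).norm
    refine this.congr (Filter.Eventually.of_forall fun x => ?_)
    beta_reduce
    rw [Complex.norm_exp]
    congr 1
    simp [← Complex.ofReal_pow]
  rw [memLp_two_iff_integrable_sq_norm hF.aestronglyMeasurable]
  refine (h1.const_mul (A ^ 2 * Real.exp (B ^ 2 / Real.pi))).mono'
    (hF.norm.pow 2).aestronglyMeasurable (Filter.Eventually.of_forall fun t => ?_)
  rw [Real.norm_of_nonneg (by positivity)]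
  calc ‖F t‖ ^ 2 ≤ (A * Real.exp (-Real.pi * ‖t‖ ^ 2 + B * ‖t‖)) ^ 2 := by
        gcongr; exact h t
    _ = A ^ 2 * Real.exp (2 * (-Real.pi * ‖t‖ ^ 2 + B * ‖t‖)) := by
        rw [mul_pow, ← Real.exp_nat_mul]; norm_num
    _ ≤ A ^ 2 * Real.exp (B ^ 2 / Real.pi + -Real.pi * ‖t‖ ^ 2) := by
        -- Completing the square: the difference of the two exponents is (B - π‖t‖)²/π.
        gcongr
        have h0 : B ^ 2 / Real.pi + -Real.pi * ‖t‖ ^ 2 - 2 * (-Real.pi * ‖t‖ ^ 2 + B * ‖t‖) =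
            (B - Real.pi * ‖t‖) ^ 2 / Real.pi := by
          field_simp; ring
        have h2 : 0 ≤ (B - Real.pi * ‖t‖) ^ 2 / Real.pi := by positivity
        linarith
    _ = A ^ 2 * Real.exp (B ^ 2 / Real.pi) * Real.exp (-Real.pi * ‖t‖ ^ 2) := by
        rw [Real.exp_add, mul_assoc]

theorem memLp_gaussFun (a : Fin d → ℂ) : MemLp (gaussFun a) 2 volume :=
  memLp_two_of_gaussian_bound (continuous_gaussFun a) (A := 1) fun t => by
    rw [one_mul]; exact norm_gaussFun_le a t

/-- The Gaussian `gaussFun a` as an element of `L²`. -/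
def gaussVec (a : Fin d → ℂ) : L2 d := (memLp_gaussFun a).toLp _

theorem coeFn_gaussVec (a : Fin d → ℂ) : gaussVec a =ᵐ[volume] gaussFun a :=
  (memLp_gaussFun a).coeFn_toLp

/-- The constant in the inner product of two Gaussians. -/
def gaussConst (d : ℕ) : ℂ := (Real.pi / (2 * Real.pi : ℂ)) ^ (d / 2 : ℂ)

theorem gaussConst_ne_zero (d : ℕ) : gaussConst d ≠ 0 := by
  have hpi : (Real.pi : ℂ) ≠ 0 := by exact_mod_cast Real.pi_ne_zero
  rw [gaussConst, Complex.cpow_ne_zero_iff]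
  left
  simp [hpi]

theorem inner_gaussVec (a b : Fin d → ℂ) : inner ℂ (gaussVec a) (gaussVec b) =
    gaussConst d * Complex.exp (Real.pi / 2 * ∑ i, (starRingEnd ℂ (a i) + b i) ^ 2) := by
  have hpi : (Real.pi : ℂ) ≠ 0 := by exact_mod_cast Real.pi_ne_zero
  have h := integral_cexp_quadratic_euclidean (d := d) (b := 2 * Real.pi)
    (by simpa using Real.pi_pos) (fun i => 2 * Real.pi * (starRingEnd ℂ (a i) + b i))
  rw [L2.inner_def]
  have e : ∫ t, inner ℂ (gaussVec a t) (gaussVec b t) = ∫ t : EuclideanSpace ℝ (Fin d),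
      Complex.exp (-(2 * Real.pi) * ∑ i, (t i : ℂ) ^ 2 +
        ∑ i, 2 * Real.pi * (starRingEnd ℂ (a i) + b i) * t i) := by
    refine integral_congr_ae ?_
    filter_upwards [coeFn_gaussVec a, coeFn_gaussVec b] with t h1 h2
    rw [h1, h2, RCLike.inner_apply, gaussFun, gaussFun, ← Complex.exp_conj, ← Complex.exp_add]
    congr 1
    simp only [map_add, map_mul, map_neg, map_sum, map_pow, Complex.conj_ofReal, map_ofNat,
      mul_assoc, ← Finset.mul_sum, add_mul, Finset.sum_add_distrib]
    ring
  rw [e, h, gaussConst]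
  congr 2
  simp only [mul_pow, ← Finset.mul_sum]
  field_simp
  ring

/-- The point `x + iω` of `ℂ^d`. -/
def phasePoint (z : PhaseSpace d) : Fin d → ℂ := fun i => z.1 i + Complex.I * z.2 i

/-- Expanding -π(t - x)² + 2πi ω·t gives -πt² + 2π(x + iω)·t - πx². The coherent states are thus
multiples of vectors depending holomorphically on x + iω. -/
theorem timeFreqShift_gaussVec_zero (z : PhaseSpace d) :
    timeFreqShift z (gaussVec 0) =
      Complex.exp (-Real.pi * ∑ i, (z.1 i : ℂ) ^ 2) • gaussVec (phasePoint z) := by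
  refine Lp.ext ?_
  have h2 : ∀ᵐ t, (gaussVec (0 : Fin d → ℂ)) (t - z.1) = gaussFun 0 (t - z.1) :=
    (measurePreserving_sub_right volume z.1).quasiMeasurePreserving.ae (coeFn_gaussVec 0)
  filter_upwards [coeFn_timeFreqShift z (gaussVec 0), h2, coeFn_gaussVec (phasePoint z),
    Lp.coeFn_smul (Complex.exp (-Real.pi * ∑ i, (z.1 i : ℂ) ^ 2)) (gaussVec (phasePoint z))]
    with t h1 h2 h3 h4
  rw [h1, h2, h4, Pi.smul_apply, h3, smul_eq_mul, gaussFun, gaussFun, character, ← Complex.exp_add,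
    ← Complex.exp_add]
  congr 1
  rw [PiLp.inner_apply]
  simp only [phasePoint, Pi.zero_apply, zero_mul, Finset.sum_const_zero, mul_zero, add_zero,
    PiLp.sub_apply, RCLike.inner_apply, conj_trivial]
  push_cast
  simp only [Finset.mul_sum, ← Finset.sum_add_distrib]
  refine Finset.sum_congr rfl fun i _ => ?_
  ring

/-- For a = iξ the inner product is the Fourier transform of e^{-πt²} y(t) at ξ; Plancherel gives
e^{-πt²} y = 0, and the Gaussian has no zero. -/
theorem eq_zero_of_inner_gaussVec {y : L2 d} (h : ∀ a, inner ℂ (gaussVec a) y = 0) : y = 0 := by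
  set F : EuclideanSpace ℝ (Fin d) → ℂ := fun t => gaussFun 0 t * y t with hF
  have hb : ∀ t : EuclideanSpace ℝ (Fin d), ‖gaussFun 0 t‖ ≤ 1 := fun t => by
    refine (norm_gaussFun_le 0 t).trans ?_
    rw [Real.exp_le_one_iff]
    simp only [Pi.zero_apply, norm_zero, Finset.sum_const_zero, mul_zero, zero_mul, add_zero]
    have := Real.pi_pos
    nlinarith [sq_nonneg ‖t‖]
  have hm : AEStronglyMeasurable F volume :=
    (continuous_gaussFun 0).aestronglyMeasurable.mul (Lp.aestronglyMeasurable y)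
  have h2 : MemLp F 2 volume := (Lp.memLp y).of_le hm (Filter.Eventually.of_forall fun t => by
    rw [hF, norm_mul]
    exact mul_le_of_le_one_left (norm_nonneg _) (hb t))
  have h1 : MemLp F 1 volume := memLp_one_iff_integrable.mpr
    (integrable_mul_of_memLp (memLp_gaussFun 0) (Lp.memLp y) ENNReal.inv_two_add_inv_two)
  have h0 : FourierTransform.fourier F = 0 := by
    ext ξ
    rw [Real.fourier_eq', Pi.zero_apply, ← h fun i => Complex.I * ξ i, L2.inner_def]
    refine integral_congr_ae ?_
    filter_upwards [coeFn_gaussVec fun i => Complex.I * (ξ i : ℂ)] with t ht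
    rw [ht, RCLike.inner_apply, hF]
    beta_reduce
    simp only [gaussFun]
    rw [← Complex.exp_conj, smul_eq_mul, ← mul_assoc, ← Complex.exp_add, mul_comm (y t),
      PiLp.inner_apply]
    congr 2
    simp only [Pi.zero_apply, zero_mul, Finset.sum_const_zero, mul_zero, add_zero,
      RCLike.inner_apply, conj_trivial, map_add, map_mul, map_neg, map_sum, map_pow,
      Complex.conj_ofReal, map_ofNat, Complex.conj_I]
    push_cast
    simp only [Finset.mul_sum, Finset.sum_mul, ← Finset.sum_add_distrib]
    refine Finset.sum_congr rfl fun i _ => ?_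
    ring
  have h3 := fourier_toLp_ae_eq h1 h2
  rw [h0] at h3
  have h4 : FourierTransform.fourier (h2.toLp F) = (0 : L2 d) := (Lp.eq_zero_iff_ae_eq_zero).mpr h3
  have h5 : h2.toLp F = 0 := by
    rw [← norm_eq_zero, ← Lp.norm_fourier_eq, h4, norm_zero]
  rw [Lp.eq_zero_iff_ae_eq_zero] at h5 ⊢
  filter_upwards [h5, h2.coeFn_toLp] with t h6 h7
  rw [h6, Pi.zero_apply] at h7
  exact (mul_eq_zero.mp h7.symm).resolve_left (Complex.exp_ne_zero _)

end Gaussians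

/-! ### The Gaussian operator and its convolutions -/

section GaussianOperator

variable {d : ℕ}

/-- The projection (up to a factor) on the standard Gaussian. -/
def gaussOp (d : ℕ) : L2 d →L[ℂ] L2 d := rankOne ℂ (gaussVec 0) (gaussVec 0)

theorem isNuclear_gaussOp : IsNuclear (gaussOp d) := IsNuclear.rankOne _ _

theorem parityOp_gaussVec_zero : parityOp d (gaussVec 0) = gaussVec 0 := by
  refine Lp.ext ?_
  have h2 : ∀ᵐ t, (gaussVec (0 : Fin d → ℂ)) (-t) = gaussFun 0 (-t) :=
    (Measure.measurePreserving_neg volume).quasiMeasurePreserving.ae (coeFn_gaussVec 0)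
  filter_upwards [coeFn_parityOp (gaussVec (0 : Fin d → ℂ)), h2, coeFn_gaussVec (0 : Fin d → ℂ)]
    with t h1 h2 h3
  rw [h1, h2, h3, gaussFun, gaussFun]
  simp

theorem opCheck_gaussOp : opCheck (gaussOp d) = gaussOp d := by
  rw [gaussOp, opCheck_rankOne, parityOp_gaussVec_zero]

theorem opPair_gaussOp (T : L2 d →L[ℂ] L2 d) (z : PhaseSpace d) :
    opPair T (gaussOp d) z = Complex.exp (-(2 * Real.pi) * ∑ i, (z.1 i : ℂ) ^ 2) *
      inner ℂ (gaussVec (phasePoint z)) (T (gaussVec (phasePoint z))) := by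
  rw [gaussOp, opPair_rankOne_right, timeFreqShift_gaussVec_zero, map_smul, inner_smul_left,
    inner_smul_right, ← mul_assoc, ← Complex.exp_conj, ← Complex.exp_add]
  congr 2
  simp only [map_mul, map_neg, map_sum, map_pow, Complex.conj_ofReal]
  ring

/-- The parameter of the Gaussians representing the frequency `ξ`. -/
def gaussFreq (ξ : PhaseSpace d) : Fin d → ℂ := fun i => Complex.I * ξ.1 i - ξ.2 i

/-- The factor in `opPair_rankOne_gaussOp`. -/
def gaussFactor (ξ : PhaseSpace d) : ℂ :=
  gaussConst d ^ 2 * Complex.exp (Real.pi / 2 *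
    ∑ i, (gaussFreq ξ i ^ 2 + starRingEnd ℂ (gaussFreq ξ i) ^ 2))

theorem gaussFactor_ne_zero (ξ : PhaseSpace d) : gaussFactor ξ ≠ 0 :=
  mul_ne_zero (pow_ne_zero _ (gaussConst_ne_zero d)) (Complex.exp_ne_zero _)

/-- With p = x + iω and a = `gaussFreq ξ`, the exponents add up to (π/2) ∑ ((p - ā)² + (p̄ + a)²) -
2πx². The cross terms give 2πi Im(a p̄) = 2πi(ξ₁·x + ξ₂·ω), and the terms in p alone give -π(x² +
ω²). -/
theorem opPair_rankOne_gaussOp (ξ z : PhaseSpace d) :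
    opPair (rankOne ℂ (gaussVec (gaussFreq ξ)) (gaussVec (-gaussFreq ξ))) (gaussOp d) z =
      gaussFactor ξ * phaseWave ξ z := by
  have e1 : ((‖z.1‖ ^ 2 : ℝ) : ℂ) = ∑ i, (z.1 i : ℂ) ^ 2 := (sum_sq_eq_norm_sq z.1).symm
  have e2 : ((‖z.2‖ ^ 2 : ℝ) : ℂ) = ∑ i, (z.2 i : ℂ) ^ 2 := (sum_sq_eq_norm_sq z.2).symm
  rw [opPair_gaussOp, InnerProductSpace.rankOne_apply, inner_smul_right, inner_gaussVec,
    inner_gaussVec, phaseWave, phaseGauss, character, character, gaussFactor]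
  rw [show Complex.exp (-(2 * Real.pi) * ∑ i, (z.1 i : ℂ) ^ 2) *
      (gaussConst d * Complex.exp (Real.pi / 2 *
        ∑ i, (starRingEnd ℂ ((-gaussFreq ξ) i) + phasePoint z i) ^ 2) *
      (gaussConst d * Complex.exp (Real.pi / 2 *
        ∑ i, (starRingEnd ℂ (phasePoint z i) + gaussFreq ξ i) ^ 2))) =
      gaussConst d ^ 2 * (Complex.exp (-(2 * Real.pi) * ∑ i, (z.1 i : ℂ) ^ 2) *
        (Complex.exp (Real.pi / 2 *
        ∑ i, (starRingEnd ℂ ((-gaussFreq ξ) i) + phasePoint z i) ^ 2) *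
       Complex.exp (Real.pi / 2 *
        ∑ i, (starRingEnd ℂ (phasePoint z i) + gaussFreq ξ i) ^ 2))) by ring,
    mul_assoc]
  congr 1
  simp only [Complex.ofReal_exp, ← Complex.exp_add]
  congr 1
  rw [PiLp.inner_apply, PiLp.inner_apply]
  push_cast at e1 e2 ⊢
  rw [e1, e2]
  simp only [Pi.neg_apply, map_neg, gaussFreq, phasePoint, map_sub, map_add, map_mul,
    Complex.conj_I, Complex.conj_ofReal, RCLike.inner_apply, conj_trivial, Complex.ofReal_mul,
    mul_add, Finset.mul_sum, ← Finset.sum_add_distrib]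
  refine Finset.sum_congr rfl fun i _ => ?_
  have hI := Complex.I_sq
  linear_combination (Real.pi * ((z.2 i : ℂ)) ^ 2 - 0) * hI

theorem inner_opShift_eq_opPair {S : L2 d →L[ℂ] L2 d} (hS : IsNuclear S) (a b : L2 d)
    (z : PhaseSpace d) : inner ℂ a (opShift z S b) = opPair (rankOne ℂ b a) S z := by
  rw [opPair, (hS.shift z).trace_comp_comm, trace_comp_rankOne]

/-- The coefficients of f ∗ G between the two Gaussians of frequency ξ are nonzero multiples of ∫ f
· `phaseWave ξ`, and these integrals determine f. -/
theorem gaussOp_convolution_injective {f : PhaseSpace d → ℂ} {q : ℝ≥0∞} (hq : 1 ≤ q)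
    (hf : MemLp f q volume) (h : funConv f (gaussOp d) = 0) : f =ᵐ[volume] 0 := by
  refine ae_eq_zero_of_integral_phaseWave hq hf fun ξ => ?_
  have h1 := inner_funConv isNuclear_gaussOp hq hf (gaussVec (-gaussFreq ξ))
    (gaussVec (gaussFreq ξ))
  rw [h, zero_apply, inner_zero_right] at h1
  have h2 : ∀ z : PhaseSpace d, inner ℂ (gaussVec (-gaussFreq ξ))
      (opShift z (gaussOp d) (gaussVec (gaussFreq ξ))) = gaussFactor ξ * phaseWave ξ z := by
    intro z
    rw [← opPair_rankOne_gaussOp, inner_opShift_eq_opPair isNuclear_gaussOp]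
  simp only [h2] at h1
  have h3 : ∫ z, f z * (gaussFactor ξ * phaseWave ξ z) =
      gaussFactor ξ * ∫ z, f z * phaseWave ξ z := by
    rw [← integral_const_mul]
    refine integral_congr_ae (Filter.Eventually.of_forall fun z => ?_)
    ring
  rw [h3] at h1
  exact (mul_eq_zero.mp h1.symm).resolve_left (gaussFactor_ne_zero ξ)

end GaussianOperator

/-! ### Polarisation by analytic continuation -/

section Holomorphy

theorem hasDerivAt_of_quadratic_bound {E : Type*} [NormedAddCommGroup E] [NormedSpace ℂ E]
    {F : ℂ → E} {D : E} {s : ℂ} {C : ℝ}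
    (h : ∀ k : ℂ, ‖k‖ ≤ 1 → ‖F (s + k) - F s - k • D‖ ≤ C * ‖k‖ ^ 2) : HasDerivAt F D s := by
  rw [hasDerivAt_iff_isLittleO_nhds_zero]
  refine Asymptotics.IsBigO.trans_isLittleO (g := fun k : ℂ => k ^ 2) ?_ ?_
  · refine Asymptotics.IsBigO.of_bound C ?_
    filter_upwards [Metric.closedBall_mem_nhds (0 : ℂ) one_pos] with k hk
    rw [norm_pow]
    exact h k (by simpa using hk)
  · simpa using Asymptotics.isLittleO_pow_id (𝕜 := ℂ) one_lt_two

theorem eq_zero_of_eq_zero_on_real {h : ℂ → ℂ} (hd : Differentiable ℂ h)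
    (h0 : ∀ t : ℝ, h t = 0) : h = 0 := by
  refine AnalyticOnNhd.eq_of_frequently_eq (z₀ := 0) (fun z _ => hd.analyticAt z)
    (fun z _ => analyticAt_const) ?_
  have ht : Filter.Tendsto (fun t : ℝ => (t : ℂ)) (nhdsWithin 0 {0}ᶜ) (nhdsWithin 0 {0}ᶜ) := by
    refine tendsto_nhdsWithin_iff.mpr ⟨?_, ?_⟩
    · have := Complex.continuous_ofReal.tendsto 0
      rw [Complex.ofReal_zero] at this
      exact this.mono_left nhdsWithin_le_nhds
    · filter_upwards [self_mem_nhdsWithin] with t ht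
      simpa using ht
  exact ht.frequently (Filter.Eventually.of_forall fun t => h0 t).frequently

variable {d : ℕ}

theorem norm_exp_sub_one_sub_le (w : ℂ) :
    ‖Complex.exp w - 1 - w‖ ≤ ‖w‖ ^ 2 * Real.exp ‖w‖ := by
  have := Complex.norm_exp_sub_sum_le_norm_mul_exp w 2
  simpa [Finset.sum_range_succ, sub_sub] using this

theorem gaussFun_add_smul (c e : Fin d → ℂ) (k : ℂ) (t : EuclideanSpace ℝ (Fin d)) :
    gaussFun (c + k • e) t = gaussFun c t * Complex.exp (k * (2 * Real.pi * ∑ i, e i * t i)) := by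
  rw [gaussFun, gaussFun, ← Complex.exp_add]
  congr 1
  simp only [Pi.add_apply, Pi.smul_apply, smul_eq_mul, add_mul, Finset.sum_add_distrib,
    Finset.mul_sum, mul_add]
  rw [add_assoc]
  congr 2
  refine Finset.sum_congr rfl fun i _ => ?_
  ring

/-- Along a complex line the Gaussian is multiplied by e^{k l(t)} with l linear. The second-order
Taylor remainder is |k|² times a Gaussian with linear exponent, which is square integrable; D is
multiplication by l. -/
theorem exists_gaussVec_deriv (c e : Fin d → ℂ) : ∃ (D : L2 d) (C : ℝ), ∀ k : ℂ, ‖k‖ ≤ 1 →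
    ‖gaussVec (c + k • e) - gaussVec c - k • D‖ ≤ C * ‖k‖ ^ 2 := by
  set l : EuclideanSpace ℝ (Fin d) → ℂ := fun t => 2 * Real.pi * ∑ i, e i * t i with hl
  set M : ℝ := 2 * Real.pi * ∑ i, ‖e i‖ with hM
  set N : ℝ := 2 * Real.pi * ∑ i, ‖c i‖ with hN
  have hM0 : 0 ≤ M := by positivity
  have hlM : ∀ t, ‖l t‖ ≤ M * ‖t‖ := fun t => by
    rw [hl, hM, norm_mul, norm_mul, Complex.norm_real, Real.norm_of_nonneg Real.pi_pos.le,
      Complex.norm_ofNat, mul_assoc _ _ ‖t‖]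
    gcongr
    exact norm_sum_mul_le e t
  have hlc : Continuous l := by fun_prop
  have hDm : MemLp (fun t => l t * gaussFun c t) 2 volume := by
    refine memLp_two_of_gaussian_bound (hlc.mul (continuous_gaussFun c)) (A := 1) (B := M + N)
      fun t => ?_
    rw [one_mul, norm_mul, show -Real.pi * ‖t‖ ^ 2 + (M + N) * ‖t‖ =
      M * ‖t‖ + (-Real.pi * ‖t‖ ^ 2 + N * ‖t‖) by ring, Real.exp_add]
    gcongr
    · exact (hlM t).trans (by linarith [Real.add_one_le_exp (M * ‖t‖)])
    · exact norm_gaussFun_le c t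
  set H : EuclideanSpace ℝ (Fin d) → ℂ := fun t =>
    ((2 * Real.exp (-Real.pi * ‖t‖ ^ 2 + (2 * M + N) * ‖t‖) : ℝ) : ℂ) with hH
  have hHm : MemLp H 2 volume := by
    refine memLp_two_of_gaussian_bound (by fun_prop) (A := 2) (B := 2 * M + N) fun t => ?_
    rw [hH, Complex.norm_real, Real.norm_of_nonneg (by positivity)]
  refine ⟨hDm.toLp _, ‖hHm.toLp H‖, fun k hk => ?_⟩
  rw [mul_comm]
  refine Lp.norm_le_mul_norm_of_ae_le_mul ?_
  filter_upwards [coeFn_gaussVec (c + k • e), coeFn_gaussVec c, hDm.coeFn_toLp, hHm.coeFn_toLp,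
    Lp.coeFn_sub (gaussVec (c + k • e) - gaussVec c) (k • hDm.toLp _),
    Lp.coeFn_sub (gaussVec (c + k • e)) (gaussVec c), Lp.coeFn_smul k (hDm.toLp _)]
    with t h1 h2 h3 h4 h5 h6 h7
  rw [h5, Pi.sub_apply, h6, Pi.sub_apply, h7, Pi.smul_apply, h1, h2, h3, h4, gaussFun_add_smul,
    smul_eq_mul]
  have e1 : gaussFun c t * Complex.exp (k * (2 * Real.pi * ∑ i, e i * t i)) - gaussFun c t -
      k * (l t * gaussFun c t) = (Complex.exp (k * l t) - 1 - k * l t) * gaussFun c t := by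
    rw [hl]; ring
  rw [e1, norm_mul, hH, Complex.norm_real, Real.norm_of_nonneg (by positivity)]
  have e2 : ‖k * l t‖ ≤ M * ‖t‖ := by
    rw [norm_mul]
    exact (mul_le_of_le_one_left (norm_nonneg _) hk).trans (hlM t)
  calc ‖Complex.exp (k * l t) - 1 - k * l t‖ * ‖gaussFun c t‖
      ≤ (‖k * l t‖ ^ 2 * Real.exp ‖k * l t‖) *
          Real.exp (-Real.pi * ‖t‖ ^ 2 + N * ‖t‖) := by
        gcongr
        · exact norm_exp_sub_one_sub_le _
        · exact norm_gaussFun_le c t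
    _ ≤ (‖k‖ ^ 2 * (M * ‖t‖) ^ 2 * Real.exp (M * ‖t‖)) *
          Real.exp (-Real.pi * ‖t‖ ^ 2 + N * ‖t‖) := by
        have e3 : ‖k * l t‖ ^ 2 ≤ ‖k‖ ^ 2 * (M * ‖t‖) ^ 2 := by
          rw [norm_mul, mul_pow]
          gcongr
          exact hlM t
        gcongr
    _ ≤ (‖k‖ ^ 2 * (2 * Real.exp (M * ‖t‖)) * Real.exp (M * ‖t‖)) *
          Real.exp (-Real.pi * ‖t‖ ^ 2 + N * ‖t‖) := by
        -- From x²/2! ≤ e^x, so that the polynomial factor is absorbed in the exponential.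
        have e4 : (M * ‖t‖) ^ 2 ≤ 2 * Real.exp (M * ‖t‖) := by
          have := Real.pow_div_factorial_le_exp (M * ‖t‖) (by positivity) 2
          simp only [Nat.factorial] at this
          norm_num at this
          linarith
        gcongr
    _ = ‖k‖ ^ 2 * (2 * Real.exp (-Real.pi * ‖t‖ ^ 2 + (2 * M + N) * ‖t‖)) := by
        rw [show -Real.pi * ‖t‖ ^ 2 + (2 * M + N) * ‖t‖ =
          M * ‖t‖ + (M * ‖t‖ + (-Real.pi * ‖t‖ ^ 2 + N * ‖t‖)) by ring, Real.exp_add (M * ‖t‖),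
          Real.exp_add (M * ‖t‖)]
        ring

/-- If `u` is holomorphic with locally quadratic remainders, then so is the sesquilinear
expression `⟨u(s̄), T u(s)⟩`. -/
theorem differentiable_inner_conj {E : Type*} [NormedAddCommGroup E] [InnerProductSpace ℂ E]
    {u : ℂ → E} (hu : ∀ s, ∃ (D : E) (C : ℝ), ∀ k : ℂ, ‖k‖ ≤ 1 →
      ‖u (s + k) - u s - k • D‖ ≤ C * ‖k‖ ^ 2) (T : E →L[ℂ] E) :
    Differentiable ℂ fun s => inner ℂ (u (starRingEnd ℂ s)) (T (u s)) := by
  intro s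
  obtain ⟨D, C, h⟩ := hu s
  obtain ⟨D', C', h'⟩ := hu (starRingEnd ℂ s)
  have h1 : HasDerivAt (fun s => T (u s)) (T D) s :=
    T.hasFDerivAt.comp_hasDerivAt s (hasDerivAt_of_quadratic_bound h)
  have h2 : HasDerivAt (fun s => innerSL ℂ (u (starRingEnd ℂ s))) (innerSL ℂ D') s := by
    refine hasDerivAt_of_quadratic_bound (C := C') fun k hk => ?_
    have e : innerSL ℂ (u (starRingEnd ℂ (s + k))) - innerSL ℂ (u (starRingEnd ℂ s)) -
        k • innerSL ℂ D' = innerSL ℂ (u (starRingEnd ℂ s + starRingEnd ℂ k) -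
          u (starRingEnd ℂ s) - starRingEnd ℂ k • D') := by
      rw [map_sub, map_sub, map_smulₛₗ, map_add, Complex.conj_conj]
    rw [e, innerSL_apply_norm]
    refine (h' (starRingEnd ℂ k) ?_).trans_eq ?_ <;> rw [Complex.norm_conj]
    exact hk
  exact (h2.clm_apply h1).differentiableAt

theorem eq_zero_of_opPair_gaussOp {T : L2 d →L[ℂ] L2 d} (h : ∀ z, opPair T (gaussOp d) z = 0) :
    T = 0 := by
  have h1 : ∀ p : Fin d → ℂ, inner ℂ (gaussVec p) (T (gaussVec p)) = 0 := by
    intro p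
    have h2 := h (WithLp.toLp 2 fun i => (p i).re, WithLp.toLp 2 fun i => (p i).im)
    rw [opPair_gaussOp] at h2
    have h3 : phasePoint ((WithLp.toLp 2 fun i => (p i).re, WithLp.toLp 2 fun i => (p i).im) :
        PhaseSpace d) = p := by
      funext i
      simp only [phasePoint]
      rw [mul_comm]
      exact Complex.re_add_im (p i)
    rw [h3] at h2
    exact (mul_eq_zero.mp h2).resolve_left (Complex.exp_ne_zero _)
  have h4 : ∀ a b : Fin d → ℂ, inner ℂ (gaussVec a) (T (gaussVec b)) = 0 := by
    intro a b
    -- On the line c + s e the function ⟨g(c + s̄ e), T g(c + s e)⟩ is entire and vanishes for real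
    -- s. The line is chosen so that s = i gives c + s e = b and c + s̄ e = a.
    set c : Fin d → ℂ := (2⁻¹ : ℂ) • (a + b) with hc
    set e : Fin d → ℂ := (-(Complex.I * 2⁻¹)) • (b - a) with he
    have h5 := eq_zero_of_eq_zero_on_real (differentiable_inner_conj
      (u := fun s => gaussVec (c + s • e)) (fun s => by
        obtain ⟨D, C, h⟩ := exists_gaussVec_deriv (c + s • e) e
        refine ⟨D, C, fun k hk => ?_⟩
        have := h k hk
        rwa [add_assoc, ← add_smul] at this) T) (fun t => by
        rw [Complex.conj_ofReal]; exact h1 _)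
    have h6 := congrFun h5 Complex.I
    have e1 : c + starRingEnd ℂ Complex.I • e = a := by
      funext i
      simp only [hc, he, Pi.add_apply, Pi.smul_apply, Pi.sub_apply, smul_eq_mul, Complex.conj_I]
      linear_combination (2⁻¹ * (b i - a i)) * Complex.I_sq
    have e2 : c + Complex.I • e = b := by
      funext i
      simp only [hc, he, Pi.add_apply, Pi.smul_apply, Pi.sub_apply, smul_eq_mul]
      linear_combination (-2⁻¹ * (b i - a i)) * Complex.I_sq
    beta_reduce at h6
    rwa [e1, e2] at h6
  have h7 : ∀ b : Fin d → ℂ, T (gaussVec b) = 0 := fun b =>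
    eq_zero_of_inner_gaussVec fun a => h4 a b
  refine clm_ext_inner fun x y => ?_
  have h8 : T.adjoint x = 0 := eq_zero_of_inner_gaussVec fun b => by
    rw [ContinuousLinearMap.adjoint_inner_right, h7, inner_zero_left]
  rw [← ContinuousLinearMap.adjoint_inner_left, h8, inner_zero_left,
    zero_apply, inner_zero_right]

end Holomorphy

/-! ### Injectivity and density of translates -/

section Injectivity

variable {d : ℕ} {S T R : L2 d →L[ℂ] L2 d}

/-- Convolution with `S` (up to reflection) is injective on `𝒯^q`. -/
def OpInjective (q : ℝ≥0∞) (S : L2 d →L[ℂ] L2 d) : Prop :=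
  ∀ T : L2 d →L[ℂ] L2 d, MemSchatten q T → (∀ z, opPair T S z = 0) → T = 0

/-- Convolution with `S` is injective on `L^q`. -/
def FunInjective (q : ℝ≥0∞) (S : L2 d →L[ℂ] L2 d) : Prop :=
  ∀ f : PhaseSpace d → ℂ, MemLp f q volume → funConv f S = 0 → f =ᵐ[volume] 0

theorem opInjective_gaussOp (q : ℝ≥0∞) : OpInjective q (gaussOp d) :=
  fun _ _ => eq_zero_of_opPair_gaussOp

theorem OpInjective.opCheck {q : ℝ≥0∞} (hq : 1 ≤ q) (hS : IsNuclear S) (h : OpInjective q S) :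
    OpInjective q (opCheck S) := by
  intro T hT h0
  have h1 : QHA.opCheck T = 0 := by
    refine h _ ?_ fun z => ?_
    · rw [memSchatten_iff hq] at hT ⊢
      rwa [pairNorm_opCheck]
    · have := h0 (-z)
      rwa [opPair_opCheck_right hS, neg_neg] at this
  rw [← opCheck_opCheck T, h1, QHA.opCheck, ContinuousLinearMap.zero_comp,
    ContinuousLinearMap.comp_zero]

theorem opInjective_opCheck_iff {q : ℝ≥0∞} (hq : 1 ≤ q) (hS : IsNuclear S) :
    OpInjective q (opCheck S) ↔ OpInjective q S :=
  ⟨fun h => by simpa [opCheck_opCheck] using OpInjective.opCheck hq hS.check h,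
    OpInjective.opCheck hq hS⟩

/-- The span of the translates of an operator. -/
def shiftSpan (S : L2 d →L[ℂ] L2 d) : Submodule ℂ (L2 d →L[ℂ] L2 d) :=
  Submodule.span ℂ (Set.range fun z : PhaseSpace d => opShift z S)

theorem isNuclear_of_mem_shiftSpan (hS : IsNuclear S) {A : L2 d →L[ℂ] L2 d}
    (hA : A ∈ shiftSpan S) : IsNuclear A := by
  rw [← mem_schattenSubmodule_one]
  refine (Submodule.span_le (p := schattenSubmodule (L2 d) le_rfl)).mpr ?_ hA
  rintro _ ⟨z, rfl⟩
  exact mem_schattenSubmodule_one.mpr (hS.shift z)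

theorem trace_comp_eq_zero_of_mem_shiftSpan (hS : IsNuclear S) (h : ∀ z, opPair T S z = 0)
    {A : L2 d →L[ℂ] L2 d} (hA : A ∈ shiftSpan S) : trace (T ∘L A) = 0 := by
  induction hA using Submodule.span_induction with
  | mem x hx => obtain ⟨z, rfl⟩ := hx; exact h z
  | zero => simpa using trace_smul 0 (0 : L2 d →L[ℂ] L2 d)
  | add x y hx hy h1 h2 =>
    rw [ContinuousLinearMap.comp_add,
      ((isNuclear_of_mem_shiftSpan hS hx).comp_left T).trace_add
        ((isNuclear_of_mem_shiftSpan hS hy).comp_left T), h1, h2, add_zero]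
  | smul c x _ h1 => rw [ContinuousLinearMap.comp_smul, trace_smul, h1, mul_zero]

/-- Injectivity says precisely that the annihilator of the translates in the dual class is trivial.
-/
theorem OpInjective.exists_shiftSpan {p q : ℝ≥0∞} (hp : 1 ≤ p) (hq : 1 ≤ q)
    (hpq : p⁻¹ + q⁻¹ = 1) (hS : IsNuclear S) (h : OpInjective q S) {A : L2 d →L[ℂ] L2 d}
    (hA : IsNuclear A) {ε : ℝ≥0∞} (hε : 0 < ε) : ∃ B ∈ shiftSpan S, pairNorm p (A - B) < ε :=
  exists_mem_pairNorm_sub_lt hp hpq (shiftSpan S) (fun _ hB => isNuclear_of_mem_shiftSpan hS hB)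
    (fun T hT h0 => h T ((memSchatten_iff hq T).mpr hT) fun z =>
      h0 _ (Submodule.subset_span ⟨z, rfl⟩)) hA hε

theorem exists_shiftSpan_gaussOp {p : ℝ≥0∞} (hp : 1 ≤ p) {A : L2 d →L[ℂ] L2 d}
    (hA : IsNuclear A) {ε : ℝ≥0∞} (hε : 0 < ε) :
    ∃ B ∈ shiftSpan (gaussOp d), pairNorm p (A - B) < ε := by
  obtain ⟨q, hq, hpq⟩ := exists_conjugate hp
  exact (opInjective_gaussOp q).exists_shiftSpan hp hq hpq isNuclear_gaussOp hA hε

end Injectivity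

/-! ### Decay at infinity and compactness -/

section Decay

variable {d : ℕ} {S T : L2 d →L[ℂ] L2 d}

open Filter Topology

theorem tendsto_phaseGauss {c : ℝ} (hc : 0 < c) :
    Tendsto (phaseGauss c : PhaseSpace d → ℝ) (cocompact _) (𝓝 0) := by
  have h1 : Tendsto (fun z : PhaseSpace d => Real.exp (-(c * ‖z‖ ^ 2))) (cocompact _) (𝓝 0) :=
    Real.tendsto_exp_neg_atTop_nhds_zero.comp
      (((tendsto_pow_atTop two_ne_zero).comp tendsto_norm_cocompact_atTop).const_mul_atTop hc)
  refine squeeze_zero (fun z => (phaseGauss_pos c z).le) (fun z => ?_) h1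
  rw [phaseGauss, Real.exp_le_exp]
  have h2 : ‖z‖ ^ 2 ≤ ‖z.1‖ ^ 2 + ‖z.2‖ ^ 2 := by
    rw [Prod.norm_def]
    rcases max_cases ‖z.1‖ ‖z.2‖ with ⟨h, _⟩ | ⟨h, _⟩ <;> rw [h] <;>
      nlinarith [sq_nonneg ‖z.1‖, sq_nonneg ‖z.2‖]
  have := mul_le_mul_of_nonneg_left h2 hc.le
  linarith

theorem tendsto_opPair_of_approx (hS : IsNuclear S)
    (h : ∀ ε : ℝ≥0∞, 0 < ε → ∃ A : L2 d →L[ℂ] L2 d, ‖T - A‖ₑ < ε ∧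
      Tendsto (opPair A S) (cocompact _) (𝓝 0)) : Tendsto (opPair T S) (cocompact _) (𝓝 0) := by
  have hSn : schattenNorm 1 S ≠ ∞ := (isNuclear_iff.mp hS).ne
  rw [EMetric.tendsto_nhds]
  intro ε hε
  obtain ⟨δ, hδ, hδε⟩ : ∃ δ : ℝ≥0∞, 0 < δ ∧ δ * schattenNorm 1 S < ε / 2 := by
    have h1 : Tendsto (fun δ : ℝ≥0∞ => δ * schattenNorm 1 S) (𝓝[>] 0) (𝓝 (0 * schattenNorm 1 S)) :=
      ((ENNReal.continuous_mul_const hSn).tendsto 0).mono_left nhdsWithin_le_nhds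
    rw [zero_mul] at h1
    obtain ⟨δ, h2, h3⟩ := ((h1.eventually (gt_mem_nhds (ENNReal.half_pos hε.ne'))).and
      self_mem_nhdsWithin).exists
    exact ⟨δ, h3, h2⟩
  obtain ⟨A, hA, hA0⟩ := h δ hδ
  filter_upwards [EMetric.tendsto_nhds.mp hA0 (ε / 2) (ENNReal.half_pos hε.ne')] with z hz
  rw [edist_zero_right] at hz ⊢
  have e : opPair T S z = opPair (T - A) S z + opPair A S z := by
    rw [opPair_sub_left hS, Pi.sub_apply, sub_add_cancel]
  rw [e]
  refine (enorm_add_le _ _).trans_lt ?_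
  rw [← ENNReal.add_halves ε]
  refine ENNReal.add_lt_add (((enorm_opPair_le hS _ z).trans ?_).trans_lt hδε) hz
  exact mul_le_mul_left hA.le _

theorem tendsto_opPair_of_mem_shiftSpan (hS : IsNuclear S)
    (h : Tendsto (opPair T S) (cocompact _) (𝓝 0)) {A : L2 d →L[ℂ] L2 d} (hA : A ∈ shiftSpan T) :
    Tendsto (opPair A S) (cocompact _) (𝓝 0) := by
  induction hA using Submodule.span_induction with
  | mem x hx =>
    obtain ⟨w, rfl⟩ := hx
    have e : opPair (opShift w T) S = opPair T S ∘ Homeomorph.subRight w :=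
      funext fun z => opPair_opShift_left hS T w z
    beta_reduce
    rw [e]
    exact h.comp (Homeomorph.subRight w).isClosedEmbedding.tendsto_cocompact
  | zero =>
    have e : opPair (0 : L2 d →L[ℂ] L2 d) S = 0 := by
      simpa using opPair_smul_left 0 (0 : L2 d →L[ℂ] L2 d) S
    rw [e]; exact tendsto_const_nhds
  | add x y _ _ h1 h2 => rw [opPair_add_left hS, ← add_zero (0 : ℂ)]; exact h1.add h2
  | smul c x _ h1 => rw [opPair_smul_left, ← smul_zero c]; exact h1.const_smul c

/-- For the pair (G, G) the function is an explicit Gaussian. Translates of G approximate nuclear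
operators in norm, which extends decay to (F, G); symmetry gives (G, S), the same approximation
gives (F, S), and nuclear approximation reaches compact T. -/
theorem tendsto_opPair (hT : IsCompactOperator T) (hS : IsNuclear S) :
    Tendsto (opPair T S) (cocompact _) (𝓝 0) := by
  have hG : IsNuclear (gaussOp d) := isNuclear_gaussOp
  have approx : ∀ {A : L2 d →L[ℂ] L2 d}, IsNuclear A → ∀ ε : ℝ≥0∞, 0 < ε →
      ∃ B ∈ shiftSpan (gaussOp d), ‖A - B‖ₑ < ε := fun hA ε hε => by
    obtain ⟨B, hB, h⟩ := exists_shiftSpan_gaussOp le_rfl hA hε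
    exact ⟨B, hB, (enorm_le_pairNorm le_rfl _).trans_lt h⟩
  have h0 : Tendsto (opPair (gaussOp d) (gaussOp d)) (cocompact _) (𝓝 0) := by
    have e : opPair (gaussOp d) (gaussOp d) = fun z => gaussFactor (d := d) 0 * phaseWave (d := d) 0 z := by
      funext z
      have hf : gaussFreq (0 : PhaseSpace d) = 0 := by
        funext i; simp [gaussFreq]
      rw [← opPair_rankOne_gaussOp, hf, neg_zero, gaussOp]
    rw [e]
    have h1 : Tendsto (phaseWave (0 : PhaseSpace d)) (cocompact _) (𝓝 0) := by
      rw [tendsto_zero_iff_norm_tendsto_zero]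
      simp only [norm_phaseWave]
      exact tendsto_phaseGauss Real.pi_pos
    simpa using h1.const_mul (gaussFactor (0 : PhaseSpace d))
  have h1 : ∀ {F : L2 d →L[ℂ] L2 d}, IsNuclear F →
      Tendsto (opPair F (gaussOp d)) (cocompact _) (𝓝 0) := fun hF =>
    tendsto_opPair_of_approx hG fun ε hε => by
      obtain ⟨B, hB, h⟩ := approx hF ε hε
      exact ⟨B, h, tendsto_opPair_of_mem_shiftSpan hG h0 hB⟩
  have h2 : Tendsto (opPair (gaussOp d) S) (cocompact _) (𝓝 0) := by
    have e : opPair (gaussOp d) S = opPair S (gaussOp d) ∘ Homeomorph.neg _ :=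
      funext fun z => opPair_comm hS _ z
    rw [e]
    exact (h1 hS).comp (Homeomorph.neg _).isClosedEmbedding.tendsto_cocompact
  have h3 : ∀ {F : L2 d →L[ℂ] L2 d}, IsNuclear F →
      Tendsto (opPair F S) (cocompact _) (𝓝 0) := fun hF =>
    tendsto_opPair_of_approx hS fun ε hε => by
      obtain ⟨B, hB, h⟩ := approx hF ε hε
      exact ⟨B, h, tendsto_opPair_of_mem_shiftSpan hS h2 hB⟩
  refine tendsto_opPair_of_approx hS fun ε hε => ?_
  obtain ⟨δ, hδ, hδε⟩ := ENNReal.lt_iff_exists_nnreal_btwn.mp hε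
  obtain ⟨F, hF, h⟩ := exists_isNuclear_norm_sub_lt hT (ε := δ) (by exact_mod_cast hδ)
  refine ⟨F, ?_, h3 hF⟩
  rw [← ofReal_norm]
  exact (ENNReal.ofReal_lt_iff_lt_toReal (norm_nonneg _) ENNReal.coe_ne_top).mpr h |>.trans hδε

theorem isCompactOperator_of_approx {E : Type*} [NormedAddCommGroup E] [NormedSpace ℂ E]
    [CompleteSpace E] {T : E →L[ℂ] E}
    (h : ∀ ε : ℝ≥0∞, 0 < ε → ∃ A : E →L[ℂ] E, ‖T - A‖ₑ < ε ∧ IsCompactOperator A) :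
    IsCompactOperator T := by
  have hc : IsClosed {f : E →L[ℂ] E | IsCompactOperator f} := isClosed_setOfPred_isCompactOperator
  have : T ∈ closure {f : E →L[ℂ] E | IsCompactOperator f} := by
    rw [EMetric.mem_closure_iff]
    intro ε hε
    obtain ⟨A, hA, hAc⟩ := h ε hε
    exact ⟨A, hAc, by rwa [edist_eq_enorm_sub]⟩
  rwa [hc.closure_eq] at this

theorem memLp_top_of_zeroAtInfty (f : C₀(PhaseSpace d, ℂ)) : MemLp f ∞ volume := by
  obtain ⟨C, hC⟩ := isBounded_iff_forall_norm_le.mp f.isBounded_range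
  exact memLp_top_of_bound (map_continuous f).aestronglyMeasurable C
    (Filter.Eventually.of_forall fun z => hC _ ⟨z, rfl⟩)

/-- Approximate f uniformly by compactly supported g. Then g ∗ S is trace class and Young's
inequality controls the error in operator norm. -/
theorem isCompactOperator_funConv (hS : IsNuclear S) (f : C₀(PhaseSpace d, ℂ)) :
    IsCompactOperator (funConv f S) := by
  have hSn : schattenNorm 1 S ≠ ∞ := (isNuclear_iff.mp hS).ne
  refine isCompactOperator_of_approx fun ε hε => ?_
  obtain ⟨δ, hδ, hδε⟩ : ∃ δ : ℝ, 0 < δ ∧ schattenNorm 1 S * ENNReal.ofReal δ < ε := by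
    have h1 : Tendsto (fun δ : ℝ => schattenNorm 1 S * ENNReal.ofReal δ) (𝓝[>] 0)
        (𝓝 (schattenNorm 1 S * ENNReal.ofReal 0)) :=
      (((ENNReal.continuous_const_mul hSn).comp ENNReal.continuous_ofReal).tendsto 0).mono_left
        nhdsWithin_le_nhds
    rw [ENNReal.ofReal_zero, mul_zero] at h1
    obtain ⟨δ, h2, h3⟩ := ((h1.eventually (gt_mem_nhds hε)).and self_mem_nhdsWithin).exists
    exact ⟨δ, h3, h2⟩
  obtain ⟨g, hgc, hgs, hg⟩ := exists_hasCompactSupport_approx f hδ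
  have hf := memLp_top_of_zeroAtInfty f
  have hg' : MemLp g ∞ volume := hgc.memLp_of_hasCompactSupport hgs
  refine ⟨funConv g S, ?_,
    (isNuclear_funConv hS (hgc.memLp_of_hasCompactSupport hgs)).isCompactOperator⟩
  rw [← funConv_sub hS le_top hf hg']
  refine (((enorm_le_pairNorm le_top _).trans (pairNorm_funConv_le hS le_top (hf.sub hg'))).trans
    ?_).trans_lt hδε
  refine mul_le_mul' le_rfl ?_
  rw [eLpNorm_exponent_top]
  refine essSup_le_of_ae_le _ (Filter.Eventually.of_forall fun z => ?_)
  beta_reduce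
  rw [← ofReal_norm]
  exact ENNReal.ofReal_le_ofReal (hg z)

end Decay

/-! ### Density and annihilators in L^p -/

section FunctionDensity

variable {d : ℕ} {S T R : L2 d →L[ℂ] L2 d} {p q : ℝ≥0∞}

theorem exists_pos_mul_lt {C ε : ℝ≥0∞} (hC : C ≠ ∞) (hε : 0 < ε) : ∃ δ, 0 < δ ∧ C * δ < ε := by
  obtain ⟨δ, hδ, h⟩ := ENNReal.exists_nnreal_pos_mul_lt hC hε.ne'
  exact ⟨δ, by exact_mod_cast hδ, by rwa [mul_comm]⟩

theorem eq_zero_of_forall_enorm_lt {z : ℂ} (h : ∀ ε : ℝ≥0∞, 0 < ε → ‖z‖ₑ < ε) : z = 0 := by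
  by_contra hz
  exact lt_irrefl _ (h ‖z‖ₑ (by simpa using hz))

theorem enorm_integral_mul_le {f g : PhaseSpace d → ℂ} (hf : MemLp f q volume)
    (hg : MemLp g p volume) (hpq : p⁻¹ + q⁻¹ = 1) :
    ‖∫ z, f z * g z‖ₑ ≤ eLpNorm f q volume * eLpNorm g p volume :=
  (enorm_integral_le_lintegral_enorm _).trans
    (lintegral_enorm_mul_le hf.aestronglyMeasurable hg.aestronglyMeasurable
      (by rwa [add_comm] at hpq))

theorem integral_mul_eq_zero_of_approx {f g : PhaseSpace d → ℂ} (hf : MemLp f q volume)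
    (hg : MemLp g p volume) (hpq : p⁻¹ + q⁻¹ = 1)
    (h : ∀ ε : ℝ≥0∞, 0 < ε → ∃ k, MemLp k p volume ∧ ∫ z, f z * k z = 0 ∧
      eLpNorm (g - k) p volume < ε) : ∫ z, f z * g z = 0 := by
  refine eq_zero_of_forall_enorm_lt fun ε hε => ?_
  obtain ⟨δ, hδ, hδε⟩ := exists_pos_mul_lt hf.2.ne hε
  obtain ⟨k, hk, h0, hkδ⟩ := h δ hδ
  have hqp : q⁻¹ + p⁻¹ = 1 := by rwa [add_comm]
  have e : ∫ z, f z * g z = ∫ z, f z * (g - k) z := by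
    simp only [Pi.sub_apply, mul_sub]
    rw [integral_sub (integrable_mul_of_memLp hf hg hqp) (integrable_mul_of_memLp hf hk hqp), h0,
      sub_zero]
  rw [e]
  refine (enorm_integral_mul_le hf (hg.sub hk) hpq).trans_lt (lt_of_le_of_lt ?_ hδε)
  exact mul_le_mul' le_rfl hkδ.le

/-- The functions which can be approximated in `L^p` by elements of `D`. -/
def lpClosure (p : ℝ≥0∞) (D : Set (PhaseSpace d → ℂ)) : Set (PhaseSpace d → ℂ) :=
  {g | MemLp g p volume ∧ ∀ ε : ℝ≥0∞, 0 < ε → ∃ k ∈ D, eLpNorm (g - k) p volume < ε}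

theorem mem_lpClosure_of_approx (hp : 1 ≤ p) {D : Set (PhaseSpace d → ℂ)}
    (hD : ∀ k ∈ D, MemLp k p volume) {g : PhaseSpace d → ℂ} (hg : MemLp g p volume)
    (h : ∀ ε : ℝ≥0∞, 0 < ε → ∃ k ∈ lpClosure p D, eLpNorm (g - k) p volume < ε) :
    g ∈ lpClosure p D := by
  refine ⟨hg, fun ε hε => ?_⟩
  obtain ⟨k, hk, hgk⟩ := h (ε / 2) (ENNReal.half_pos hε.ne')
  obtain ⟨l, hl, hkl⟩ := hk.2 (ε / 2) (ENNReal.half_pos hε.ne')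
  refine ⟨l, hl, ?_⟩
  have e : g - l = (g - k) + (k - l) := by abel
  rw [e]
  refine (eLpNorm_add_le (hg.sub hk.1).1 (hk.1.sub (hD l hl)).1 hp).trans_lt ?_
  rw [← ENNReal.add_halves ε]
  exact ENNReal.add_lt_add hgk hkl

theorem span_le_lpClosure (hp : 1 ≤ p) {D : Submodule ℂ (PhaseSpace d → ℂ)}
    (hD : ∀ k ∈ D, MemLp k p volume) {s : Set (PhaseSpace d → ℂ)} (hs : s ⊆ lpClosure p D)
    {g : PhaseSpace d → ℂ} (hg : g ∈ Submodule.span ℂ s) : g ∈ lpClosure p (D : Set _) := by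
  induction hg using Submodule.span_induction with
  | mem x hx => exact hs hx
  | zero => exact ⟨MemLp.zero, fun ε hε => ⟨0, D.zero_mem, by simpa using hε⟩⟩
  | add x y _ _ hx hy =>
    refine ⟨hx.1.add hy.1, fun ε hε => ?_⟩
    obtain ⟨k, hk, hxk⟩ := hx.2 (ε / 2) (ENNReal.half_pos hε.ne')
    obtain ⟨l, hl, hyl⟩ := hy.2 (ε / 2) (ENNReal.half_pos hε.ne')
    refine ⟨k + l, D.add_mem hk hl, ?_⟩
    rw [add_sub_add_comm]
    refine (eLpNorm_add_le (hx.1.sub (hD k hk)).1 (hy.1.sub (hD l hl)).1 hp).trans_lt ?_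
    rw [← ENNReal.add_halves ε]
    exact ENNReal.add_lt_add hxk hyl
  | smul c x _ hx =>
    refine ⟨hx.1.const_smul c, fun ε hε => ?_⟩
    obtain ⟨δ, hδ, hδε⟩ := exists_pos_mul_lt (C := ‖c‖ₑ) enorm_ne_top hε
    obtain ⟨k, hk, hxk⟩ := hx.2 δ hδ
    refine ⟨c • k, D.smul_mem c hk, ?_⟩
    rw [← smul_sub, eLpNorm_const_smul]
    exact (mul_le_mul' le_rfl hxk.le).trans_lt hδε

/-- `opPair` as a linear map in its first argument. -/
def opPairₗ (hS : IsNuclear S) : (L2 d →L[ℂ] L2 d) →ₗ[ℂ] PhaseSpace d → ℂ where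
  toFun T := opPair T S
  map_add' := opPair_add_left hS
  map_smul' c T := opPair_smul_left c T S

/-- The span of the translates of the function `opPair T S`. -/
def pairSpan (T S : L2 d →L[ℂ] L2 d) : Submodule ℂ (PhaseSpace d → ℂ) :=
  Submodule.span ℂ (Set.range fun z : PhaseSpace d => opPair (opShift z T) S)

theorem mem_pairSpan_iff (hS : IsNuclear S) {g : PhaseSpace d → ℂ} :
    g ∈ pairSpan T S ↔ ∃ A ∈ shiftSpan T, opPair A S = g := by
  have e : pairSpan T S = (shiftSpan T).map (opPairₗ hS) := by
    rw [pairSpan, shiftSpan, Submodule.map_span, ← Set.range_comp]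
    rfl
  rw [e]
  rfl

theorem memLp_of_mem_pairSpan (hp : 1 ≤ p) (hT : IsNuclear T) (hS : IsNuclear S)
    {g : PhaseSpace d → ℂ} (hg : g ∈ pairSpan T S) : MemLp g p volume := by
  obtain ⟨A, hA, rfl⟩ := (mem_pairSpan_iff hS).mp hg
  exact memLp_opPair hS hp ((isNuclear_of_mem_shiftSpan hT hA).memSchatten hp)

theorem OpInjective.opPair_mem_lpClosure (hp : 1 ≤ p) (hq : 1 ≤ q) (hpq : p⁻¹ + q⁻¹ = 1)
    (hR : IsNuclear R) (h : OpInjective q R) (hS : IsNuclear S) (hT : IsNuclear T) :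
    opPair T S ∈ lpClosure p (pairSpan R S : Set _) := by
  refine ⟨memLp_opPair hS hp (hT.memSchatten hp), fun ε hε => ?_⟩
  obtain ⟨δ, hδ, hδε⟩ := exists_pos_mul_lt (C := schattenNorm 1 S * 4)
    (ENNReal.mul_ne_top (isNuclear_iff.mp hS).ne (by norm_num)) hε
  obtain ⟨B, hB, hTB⟩ := h.exists_shiftSpan hp hq hpq hR hT hδ
  refine ⟨opPair B S, (mem_pairSpan_iff hS).mpr ⟨B, hB, rfl⟩, ?_⟩
  rw [← opPair_sub_left hS]
  refine (eLpNorm_opPair_le hS hp _).trans_lt (lt_of_le_of_lt ?_ hδε)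
  rw [mul_assoc]
  exact mul_le_mul' le_rfl ((schattenNorm_le_pairNorm hp _).trans (mul_le_mul' le_rfl hTB.le))

/-- Commutativity of operator convolution, α_w(G) ∗ S = α_w(S) ∗ G; the parity on the right-hand
side disappears because PGP = G. -/
theorem opPair_opShift_gaussOp_opCheck (hS : IsNuclear S) (w : PhaseSpace d) :
    opPair (opShift w (gaussOp d)) (opCheck S) = opPair (opShift w S) (gaussOp d) := by
  funext z
  rw [opPair_opShift_left hS.check, opPair_opCheck_right hS, opCheck_gaussOp,
    opPair_opShift_left isNuclear_gaussOp, opPair_comm hS, neg_neg]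

/-- The wave is a multiple of F ∗ G with F of rank one. Translates of S approximate F, and each
α_w(S) ∗ G equals α_w(G) ∗ S, where α_w(G) is approximated by translates of T. Young's inequality
carries both approximations to L^p. -/
theorem phaseWave_mem_lpClosure (hp : 1 ≤ p) (hq : 1 ≤ q) (hpq : p⁻¹ + q⁻¹ = 1)
    (hT : IsNuclear T) (hS : IsNuclear S) (hTi : OpInjective q T) (hSi : OpInjective q S)
    (ξ : PhaseSpace d) : phaseWave ξ ∈ lpClosure p (pairSpan T (opCheck S) : Set _) := by
  have hD : ∀ k ∈ pairSpan T (opCheck S), MemLp k p volume :=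
    fun k hk => memLp_of_mem_pairSpan hp hT hS.check hk
  have h1 : ∀ k ∈ pairSpan S (gaussOp d), k ∈ lpClosure p (pairSpan T (opCheck S) : Set _) := by
    refine fun k hk => span_le_lpClosure hp hD ?_ hk
    rintro _ ⟨w, rfl⟩
    beta_reduce
    rw [← opPair_opShift_gaussOp_opCheck hS]
    exact hTi.opPair_mem_lpClosure hp hq hpq hT hS.check (isNuclear_gaussOp.shift w)
  have h2 := hSi.opPair_mem_lpClosure hp hq hpq hS isNuclear_gaussOp
    (IsNuclear.rankOne (gaussVec (gaussFreq ξ)) (gaussVec (-gaussFreq ξ)))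
  have h3 := mem_lpClosure_of_approx hp hD h2.1 fun ε hε => by
    obtain ⟨k, hk, hkε⟩ := h2.2 ε hε
    exact ⟨k, h1 k hk, hkε⟩
  refine span_le_lpClosure hp hD (Set.singleton_subset_iff.mpr h3) ?_
  rw [Submodule.mem_span_singleton]
  refine ⟨(gaussFactor ξ)⁻¹, ?_⟩
  funext z
  rw [Pi.smul_apply, opPair_rankOne_gaussOp, smul_eq_mul,
    inv_mul_cancel_left₀ (gaussFactor_ne_zero ξ)]

theorem LpDense.mono {D D' : Set (PhaseSpace d → ℂ)} (h : LpDense p D) (hDD : D ⊆ D')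
    (hD' : ∀ g ∈ D', MemLp g p volume) : LpDense p D' := by
  refine ⟨hD', ?_⟩
  have h2 := h.2
  split_ifs at h2 ⊢ with hpt
  · intro f hf F hF ε hε
    obtain ⟨g, hg, h3⟩ := h2 f hf F hF ε hε
    exact ⟨g, hDD hg, h3⟩
  · intro f hf ε hε
    obtain ⟨g, hg, h3⟩ := h2 f hf ε hε
    exact ⟨g, hDD hg, h3⟩

/-- A combination of the given functionals is integration against one H in L¹. If no nonzero such H
annihilates D, finite-dimensional separation matches f exactly on all of F. -/
theorem exists_mem_integral_eq_of_annihilator {D : Submodule ℂ (PhaseSpace d → ℂ)}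
    (hD : ∀ g ∈ D, MemLp g ∞ volume)
    (h : ∀ H, MemLp H 1 volume → (∀ g ∈ D, ∫ z, H z * g z = 0) → H =ᵐ[volume] 0)
    {f : PhaseSpace d → ℂ} (hf : MemLp f ∞ volume) (F : Finset (PhaseSpace d → ℂ))
    (hF : ∀ k ∈ F, MemLp k 1 volume) : ∃ g ∈ D, ∀ k ∈ F, ∫ z, k z * g z = ∫ z, k z * f z := by
  let M : Submodule ℂ (PhaseSpace d → ℂ) :=
    { carrier := {g | MemLp g ∞ volume}
      add_mem' := fun ha hb => ha.add hb
      zero_mem' := MemLp.zero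
      smul_mem' := fun c _ ha => ha.const_smul c }
  have h11 : (1 : ℝ≥0∞)⁻¹ + ∞⁻¹ = 1 := by simp
  have hint : ∀ (k : F) (g : M), Integrable (fun z => k.1 z * g.1 z) volume := fun k g =>
    integrable_mul_of_memLp (hF k k.2) g.2 h11
  let L : F → M →ₗ[ℂ] ℂ := fun k =>
    { toFun := fun g => ∫ z, k.1 z * g.1 z
      map_add' := fun g g' => by
        rw [← integral_add (hint k g) (hint k g')]
        simp only [Submodule.coe_add, Pi.add_apply, mul_add]
      map_smul' := fun c g => by
        rw [RingHom.id_apply, smul_eq_mul, ← integral_const_mul]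
        simp only [Submodule.coe_smul, Pi.smul_apply, smul_eq_mul]
        refine integral_congr_ae (Filter.Eventually.of_forall fun z => ?_)
        ring }
  obtain ⟨g, hg, hgL⟩ := exists_mem_eq_of_annihilator L (D.comap M.subtype) (fun c hc x => by
    set H : PhaseSpace d → ℂ := fun z => ∑ k : F, c k * k.1 z with hH
    have hHm : MemLp H 1 volume :=
      memLp_finsetSum _ fun k _ => (hF k k.2).const_mul (c k)
    have hHg : ∀ g : M, ∑ᶠ k, c k * L k g = ∫ z, H z * g.1 z := fun g => by
      rw [finsum_eq_sum_of_fintype]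
      simp only [hH, Finset.sum_mul]
      rw [integral_finsetSum _ fun k _ => by
        simpa only [mul_assoc] using (hint k g).const_mul (c k)]
      refine Finset.sum_congr rfl fun k _ => ?_
      simp only [mul_assoc]
      rw [integral_const_mul]
      rfl
    have hH0 := h H hHm fun g hg => by
      rw [← hHg ⟨g, hD g hg⟩]
      exact hc ⟨g, hD g hg⟩ hg
    rw [hHg]
    refine integral_eq_zero_of_ae ?_
    filter_upwards [hH0] with z hz
    rw [hz]
    simp) ⟨f, hf⟩
  exact ⟨g.1, hg, fun k hk => hgL ⟨k, hk⟩⟩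

theorem lpDense_of_phaseWave_mem (hp : 1 ≤ p) {D : Submodule ℂ (PhaseSpace d → ℂ)}
    (hD : ∀ g ∈ D, MemLp g p volume) (h : ∀ ξ, phaseWave ξ ∈ lpClosure p (D : Set (PhaseSpace d → ℂ))) :
    LpDense p (D : Set (PhaseSpace d → ℂ)) := by
  refine ⟨hD, ?_⟩
  split_ifs with hpt
  -- For p = ∞ norm approximation is available only for the waves, not for arbitrary f. It suffices:
  -- an L¹ function annihilating D annihilates the waves, hence is 0.
  · subst hpt
    intro f hf F hF ε hε
    have h11 : (∞ : ℝ≥0∞)⁻¹ + 1⁻¹ = 1 := by simp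
    obtain ⟨g, hg, hgF⟩ := exists_mem_integral_eq_of_annihilator hD (fun H hH hH0 =>
      ae_eq_zero_of_integral_phaseWave le_rfl hH fun ξ =>
        integral_mul_eq_zero_of_approx hH (h ξ).1 h11 fun ε hε => by
          obtain ⟨k, hk, hkε⟩ := (h ξ).2 ε hε
          exact ⟨k, hD k hk, hH0 k hk, hkε⟩) hf F hF
    refine ⟨g, hg, fun k hk => ?_⟩
    have h12 : (∞ : ℝ≥0∞)⁻¹ + 1⁻¹ = 1 := by simp
    simp only [sub_mul]
    rw [integral_sub (integrable_mul_of_memLp hf (hF k hk) h12)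
      (integrable_mul_of_memLp (hD g hg) (hF k hk) h12)]
    have := hgF k hk
    simp only [mul_comm (k _)] at this
    rwa [this, sub_self, norm_zero]
  · intro f hf ε hε
    have hf' : f ∈ lpClosure p (D : Set _) := mem_lpClosure_of_approx hp hD hf fun ε hε => by
      obtain ⟨k, hk, hkε⟩ := exists_phaseWave_eLpNorm_sub_lt hp hpt hf hε
      refine ⟨k, span_le_lpClosure hp hD ?_ hk, hkε⟩
      rintro _ ⟨ξ, rfl⟩
      exact h ξ
    exact hf'.2 ε hε

theorem LpDense.ae_eq_zero (hp : 1 ≤ p) (hq : 1 ≤ q) (hpq : p⁻¹ + q⁻¹ = 1)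
    {D : Set (PhaseSpace d → ℂ)} (hD : LpDense p D) {f : PhaseSpace d → ℂ}
    (hf : MemLp f q volume) (h : ∀ g ∈ D, ∫ z, f z * g z = 0) : f =ᵐ[volume] 0 := by
  refine ae_eq_zero_of_integral_phaseWave hq hf fun ξ => ?_
  have hw := memLp_phaseWave ξ hp
  have h2 := hD.2
  split_ifs at h2 with hpt
  · subst hpt
    have hq1 : q = 1 := by simpa using hpq
    subst hq1
    refine eq_zero_of_forall_enorm_lt fun ε hε => ?_
    obtain ⟨δ, hδ, hδε⟩ := ENNReal.lt_iff_exists_nnreal_btwn.mp hε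
    obtain ⟨g, hg, h3⟩ := h2 (phaseWave ξ) hw {f} (by simpa using hf) δ (by exact_mod_cast hδ)
    have h4 := h3 f (Finset.mem_singleton_self f)
    simp only [sub_mul] at h4
    have h5 := h g hg
    simp only [mul_comm (f _)] at h5 ⊢
    rw [integral_sub (integrable_mul_of_memLp hw hf hpq)
      (integrable_mul_of_memLp (hD.1 g hg) hf hpq), h5, sub_zero] at h4
    rw [← ofReal_norm]
    exact (ENNReal.ofReal_lt_iff_lt_toReal (norm_nonneg _) ENNReal.coe_ne_top).mpr h4 |>.trans hδε
  · exact integral_mul_eq_zero_of_approx hf hw hpq fun ε hε => by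
      obtain ⟨g, hg, h3⟩ := h2 _ hw ε hε
      exact ⟨g, hD.1 g hg, h g hg, h3⟩

/-- The integral is tr(T (f ∗ S)). For p = ∞ the formula holds for bounded T since f is integrable;
for finite p it is used for nuclear operators approximating T. -/
theorem integral_mul_opPair_eq_zero (hp : 1 ≤ p) (hq : 1 ≤ q) (hpq : p⁻¹ + q⁻¹ = 1)
    (hS : IsNuclear S) {f : PhaseSpace d → ℂ} (hf : MemLp f q volume) (h : funConv f S = 0)
    (hT : MemSchatten p T) : ∫ z, f z * opPair T S z = 0 := by
  have h0 : ∀ A : L2 d →L[ℂ] L2 d, trace (A ∘L (0 : L2 d →L[ℂ] L2 d)) = 0 := fun A => by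
    simpa using trace_smul 0 (0 : L2 d →L[ℂ] L2 d)
  rcases eq_or_ne p ∞ with rfl | hpt
  · have hq1 : q = 1 := by simpa using hpq
    subst hq1
    rw [← trace_comp_funConv_of_integrable hS T hf, h, h0]
  · refine integral_mul_eq_zero_of_approx hf (memLp_opPair hS hp hT) hpq fun ε hε => ?_
    obtain ⟨δ, hδ, hδε⟩ := exists_pos_mul_lt (C := schattenNorm 1 S * 4)
      (ENNReal.mul_ne_top (isNuclear_iff.mp hS).ne (by norm_num)) hε
    obtain ⟨F, hF, hTF⟩ := exists_isNuclear_pairNorm_sub_lt hp hpt hT hδ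
    refine ⟨opPair F S, memLp_opPair hS hp (hF.memSchatten hp), ?_, ?_⟩
    · rw [← trace_comp_funConv hF hS hq hf, h, h0]
    · rw [← opPair_sub_left hS]
      refine (eLpNorm_opPair_le hS hp _).trans_lt (lt_of_le_of_lt ?_ hδε)
      rw [mul_assoc]
      exact mul_le_mul' le_rfl ((schattenNorm_le_pairNorm hp _).trans (mul_le_mul' le_rfl hTF.le))

end FunctionDensity

/-! ### Annihilators for the trace pairing -/

section TraceDuality

variable {E : Type*} [NormedAddCommGroup E] [InnerProductSpace ℂ E] [CompleteSpace E]
  {S T A : E →L[ℂ] E} {p q : ℝ≥0∞}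

theorem trace_zero : trace (0 : E →L[ℂ] E) = 0 := by
  simpa using trace_smul 0 (0 : E →L[ℂ] E)

theorem eq_zero_of_trace_comp_rankOne (h : ∀ x y, trace (T ∘L rankOne ℂ x y) = 0) : T = 0 := by
  refine ContinuousLinearMap.ext fun x => ext_inner_left ℂ fun y => ?_
  rw [← trace_comp_rankOne, h, zero_apply, inner_zero_right]

theorem enorm_trace_comp_le (hT : IsNuclear T) (A : E →L[ℂ] E) :
    ‖trace (T ∘L A)‖ₑ ≤ schattenNorm 1 T * ‖A‖ₑ := by
  rw [← hT.trace_comp_comm]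
  exact (hT.enorm_trace_le le_rfl ENNReal.one_ne_top (by simp) A).trans
    (mul_le_mul' le_rfl (pairNorm_top_le A))

theorem trace_eq_zero_of_norm_approx (hT : IsNuclear T) (h : ∀ ε : ℝ≥0∞, 0 < ε →
    ∃ B : E →L[ℂ] E, trace (T ∘L B) = 0 ∧ ‖A - B‖ₑ < ε) : trace (T ∘L A) = 0 := by
  refine eq_zero_of_forall_enorm_lt fun ε hε => ?_
  obtain ⟨δ, hδ, hδε⟩ := exists_pos_mul_lt (isNuclear_iff.mp hT).ne hε
  obtain ⟨B, h0, hB⟩ := h δ hδ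
  have e : trace (T ∘L A) = trace (T ∘L (A - B)) := by
    rw [ContinuousLinearMap.comp_sub, (hT.comp_right A).trace_sub (hT.comp_right B), h0, sub_zero]
  rw [e]
  exact ((enorm_trace_comp_le hT _).trans (mul_le_mul' le_rfl hB.le)).trans_lt hδε

theorem trace_eq_zero_of_pairNorm_approx (hp : 1 ≤ p) (hpt : p ≠ ∞) (hq : 1 ≤ q)
    (hpq : p⁻¹ + q⁻¹ = 1) (hT : MemSchatten q T) (hA : IsNuclear A)
    (h : ∀ ε : ℝ≥0∞, 0 < ε → ∃ B, IsNuclear B ∧ trace (T ∘L B) = 0 ∧ pairNorm p (A - B) < ε) :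
    trace (T ∘L A) = 0 := by
  refine eq_zero_of_forall_enorm_lt fun ε hε => ?_
  obtain ⟨δ, hδ, hδε⟩ := exists_pos_mul_lt (C := pairNorm q T * 4)
    (ENNReal.mul_ne_top ((memSchatten_iff hq T).mp hT).ne (by norm_num)) hε
  obtain ⟨B, hBn, h0, hB⟩ := h δ hδ
  have e : trace (T ∘L A) = trace (T ∘L (A - B)) := by
    rw [ContinuousLinearMap.comp_sub, (hA.comp_left T).trace_sub (hBn.comp_left T), h0, sub_zero]
  rw [e]
  refine ((hA.sub hBn).enorm_trace_le hp hpt hpq T).trans_lt (lt_of_le_of_lt ?_ hδε)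
  rw [mul_comm, mul_assoc]
  exact mul_le_mul' le_rfl ((schattenNorm_le_pairNorm hp _).trans (mul_le_mul' le_rfl hB.le))

theorem schattenDense_of_approx (hp : 1 ≤ p) (hpt : p ≠ ∞) {D : Set (E →L[ℂ] E)}
    (hD : ∀ A ∈ D, MemSchatten p A) (h : ∀ A : E →L[ℂ] E, IsNuclear A → ∀ ε : ℝ≥0∞, 0 < ε →
      ∃ B ∈ D, pairNorm p (A - B) < ε) : SchattenDense p D := by
  refine ⟨hD, ?_⟩
  rw [if_neg hpt]
  intro A hA ε hε
  obtain ⟨δ, hδ, hδε⟩ := exists_pos_mul_lt (C := 4 * 2) (by norm_num) hε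
  obtain ⟨F, hF, hAF⟩ := exists_isNuclear_pairNorm_sub_lt hp hpt hA hδ
  obtain ⟨B, hB, hFB⟩ := h F hF δ hδ
  refine ⟨B, hB, (schattenNorm_le_pairNorm hp _).trans_lt (lt_of_le_of_lt ?_ hδε)⟩
  rw [mul_assoc, two_mul, ← sub_add_sub_cancel A F B]
  exact mul_le_mul' le_rfl ((pairNorm_add_le hp _ _).trans (add_le_add hAF.le hFB.le))

theorem compactDense_of_approx {D : Set (E →L[ℂ] E)} (hD : ∀ A ∈ D, IsCompactOperator A)
    (h : ∀ A : E →L[ℂ] E, IsNuclear A → ∀ ε : ℝ≥0∞, 0 < ε → ∃ B ∈ D, ‖A - B‖ₑ < ε) :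
    CompactDense D := by
  refine ⟨hD, fun A hA => ?_⟩
  rw [Metric.mem_closure_iff]
  intro ε hε
  obtain ⟨F, hF, hAF⟩ := exists_isNuclear_norm_sub_lt hA (half_pos hε)
  obtain ⟨B, hB, hFB⟩ := h F hF (ENNReal.ofReal (ε / 2)) (by simpa using hε)
  refine ⟨B, hB, ?_⟩
  rw [← ofReal_norm, ENNReal.ofReal_lt_ofReal_iff (half_pos hε)] at hFB
  rw [dist_eq_norm, ← sub_add_sub_cancel A F B, ← add_halves ε]
  exact (norm_add_le _ _).trans_lt (add_lt_add hAF hFB)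

omit [CompleteSpace E] in
theorem CompactDense.exists_enorm_sub_lt {D : Set (E →L[ℂ] E)} (hD : CompactDense D)
    (hA : IsCompactOperator A) {ε : ℝ≥0∞} (hε : 0 < ε) : ∃ B ∈ D, ‖A - B‖ₑ < ε := by
  obtain ⟨B, hB, h⟩ := EMetric.mem_closure_iff.mp (hD.2 hA) ε hε
  exact ⟨B, hB, by rwa [edist_eq_enorm_sub] at h⟩

theorem IsNuclear.finsetSum {ι : Type*} (s : Finset ι) {f : ι → E →L[ℂ] E}
    (h : ∀ i ∈ s, IsNuclear (f i)) : IsNuclear (∑ i ∈ s, f i) := by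
  rw [← mem_schattenSubmodule_one]
  exact Submodule.sum_mem _ fun i hi => mem_schattenSubmodule_one.mpr (h i hi)

theorem trace_comp_sum {ι : Type*} (s : Finset ι) {f : ι → E →L[ℂ] E}
    (h : ∀ i ∈ s, IsNuclear (f i)) (A : E →L[ℂ] E) :
    trace (A ∘L ∑ i ∈ s, f i) = ∑ i ∈ s, trace (A ∘L f i) := by
  classical
  induction s using Finset.induction_on with
  | empty => simp [trace_zero]
  | insert a s ha ih =>
    have h1 := h a (Finset.mem_insert_self a s)
    have h2 : ∀ i ∈ s, IsNuclear (f i) := fun i hi => h i (Finset.mem_insert_of_mem hi)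
    rw [Finset.sum_insert ha, Finset.sum_insert ha, ContinuousLinearMap.comp_add,
      (h1.comp_left A).trace_add ((IsNuclear.finsetSum s h2).comp_left A), ih h2]

/-- Weak-* density of a subspace with trivial annihilator. -/
theorem schattenDense_top_of_annihilator (D : Submodule ℂ (E →L[ℂ] E))
    (h : ∀ T : E →L[ℂ] E, IsNuclear T → (∀ A ∈ D, trace (T ∘L A) = 0) → T = 0) :
    SchattenDense ∞ (D : Set (E →L[ℂ] E)) := by
  refine ⟨fun A _ => (memSchatten_iff le_top A).mpr
    ((pairNorm_top_le A).trans_lt enorm_lt_top), ?_⟩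
  rw [if_pos rfl]
  intro A F hF ε hε
  have hF' : ∀ T ∈ F, IsNuclear T := fun T hT => isNuclear_iff.mpr (hF T hT)
  let L : F → (E →L[ℂ] E) →ₗ[ℂ] ℂ := fun T =>
    { toFun := fun A => trace (A ∘L T.1)
      map_add' := fun A B => by
        rw [ContinuousLinearMap.add_comp]
        exact ((hF' T T.2).comp_left A).trace_add ((hF' T T.2).comp_left B)
      map_smul' := fun c A => by
        rw [ContinuousLinearMap.smul_comp, trace_smul, RingHom.id_apply, smul_eq_mul] }
  obtain ⟨B, hB, hBL⟩ := exists_mem_eq_of_annihilator L D (fun c hc A => by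
    have hn : ∀ T ∈ (Finset.univ : Finset F), IsNuclear (c T • T.1) :=
      fun T _ => (hF' T T.2).smul (c T)
    set R : E →L[ℂ] E := ∑ T : F, c T • T.1 with hR
    have e : ∀ A, ∑ᶠ T, c T * L T A = trace (A ∘L R) := fun A => by
      rw [finsum_eq_sum_of_fintype, hR, trace_comp_sum _ hn]
      refine Finset.sum_congr rfl fun T _ => ?_
      rw [ContinuousLinearMap.comp_smul, trace_smul]
      rfl
    have hRn : IsNuclear R := IsNuclear.finsetSum _ hn
    have h0 : R = 0 := h R hRn fun A hA => by
      rw [← hRn.trace_comp_comm, ← e]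
      exact hc A hA
    rw [e, h0, ContinuousLinearMap.comp_zero, trace_zero]) A
  refine ⟨B, hB, fun T hT => ?_⟩
  have h1 : trace (B ∘L T) = trace (A ∘L T) := hBL ⟨T, hT⟩
  rw [ContinuousLinearMap.sub_comp,
    ((hF' T hT).comp_left A).trace_sub ((hF' T hT).comp_left B), h1, sub_self, norm_zero]
  exact hε

theorem SchattenDense.mono {D D' : Set (E →L[ℂ] E)} (h : SchattenDense p D) (hDD : D ⊆ D')
    (hD' : ∀ A ∈ D', MemSchatten p A) : SchattenDense p D' := by
  refine ⟨hD', ?_⟩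
  have h2 := h.2
  split_ifs at h2 ⊢ with hpt
  · intro A F hF ε hε
    obtain ⟨B, hB, h3⟩ := h2 A F hF ε hε
    exact ⟨B, hDD hB, h3⟩
  · intro A hA ε hε
    obtain ⟨B, hB, h3⟩ := h2 A hA ε hε
    exact ⟨B, hDD hB, h3⟩

end TraceDuality

/-! ### Operator-side conditions -/

section OperatorDensity

variable {d : ℕ} {S T : L2 d →L[ℂ] L2 d} {p q : ℝ≥0∞}

/-- Density of the translates against triviality of their annihilator; rank-one operators suffice as
test elements. For p = ∞ the ambient space is K, whose dual is 𝒯^1, in agreement with q = 1. -/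
theorem isRegularOp_iff (hp : 1 ≤ p) (hq : 1 ≤ q) (hpq : p⁻¹ + q⁻¹ = 1) (hS : IsNuclear S) :
    IsRegularOp p S ↔ OpInjective q S := by
  change (if p = ∞ then CompactDense (shiftSpan S : Set (L2 d →L[ℂ] L2 d)) else
    SchattenDense p (shiftSpan S : Set (L2 d →L[ℂ] L2 d))) ↔ _
  split_ifs with hpt
  · subst hpt
    have hq1 : q = 1 := by simpa using hpq
    subst hq1
    refine ⟨fun h T hT h0 => eq_zero_of_trace_comp_rankOne fun x y => ?_, fun h =>
      compactDense_of_approx (fun A hA => (isNuclear_of_mem_shiftSpan hS hA).isCompactOperator)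
        fun A hA ε hε => ?_⟩
    · refine trace_eq_zero_of_norm_approx (isNuclear_iff.mpr hT) fun ε hε => ?_
      obtain ⟨B, hB, h3⟩ := h.exists_enorm_sub_lt (IsNuclear.rankOne x y).isCompactOperator hε
      exact ⟨B, trace_comp_eq_zero_of_mem_shiftSpan hS h0 hB, h3⟩
    · obtain ⟨B, hB, h3⟩ := h.exists_shiftSpan hp hq hpq hS hA hε
      exact ⟨B, hB, (enorm_le_pairNorm le_top _).trans_lt h3⟩
  · refine ⟨fun h T hT h0 => eq_zero_of_trace_comp_rankOne fun x y => ?_, fun h =>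
      schattenDense_of_approx hp hpt
        (fun A hA => (isNuclear_of_mem_shiftSpan hS hA).memSchatten hp)
        fun A hA ε hε => h.exists_shiftSpan hp hq hpq hS hA hε⟩
    refine trace_eq_zero_of_pairNorm_approx hp hpt hq hpq hT (IsNuclear.rankOne x y)
      fun ε hε => ?_
    have h2 := h.2
    rw [if_neg hpt] at h2
    obtain ⟨B, hB, h3⟩ := h2 _ ((IsNuclear.rankOne x y).memSchatten hp) ε hε
    exact ⟨B, isNuclear_of_mem_shiftSpan hS hB, trace_comp_eq_zero_of_mem_shiftSpan hS h0 hB,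
      (pairNorm_le_schattenNorm hp _).trans_lt h3⟩

/-- The convolutions of `S` with continuous functions of compact support. -/
def compactConv (hS : IsNuclear S) : Submodule ℂ (L2 d →L[ℂ] L2 d) where
  carrier := {A | ∃ f : PhaseSpace d → ℂ, Continuous f ∧ HasCompactSupport f ∧ A = funConv f S}
  add_mem' := by
    rintro _ _ ⟨f, hf, hfs, rfl⟩ ⟨g, hg, hgs, rfl⟩
    exact ⟨f + g, hf.add hg, hfs.add hgs, (funConv_add hS le_rfl
      (hf.memLp_of_hasCompactSupport hfs) (hg.memLp_of_hasCompactSupport hgs)).symm⟩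
  zero_mem' := ⟨0, continuous_const, HasCompactSupport.zero, (funConv_zero hS).symm⟩
  smul_mem' := by
    rintro c _ ⟨f, hf, hfs, rfl⟩
    exact ⟨c • f, hf.const_smul c, hfs.smul_left (f := fun _ => c),
      (funConv_smul hS le_rfl c (hf.memLp_of_hasCompactSupport hfs)).symm⟩

theorem isNuclear_of_mem_compactConv (hS : IsNuclear S) {A : L2 d →L[ℂ] L2 d}
    (hA : A ∈ compactConv hS) : IsNuclear A := by
  obtain ⟨f, hf, hfs, rfl⟩ := hA
  exact isNuclear_funConv hS (hf.memLp_of_hasCompactSupport hfs)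

/-- The trace against f ∗ S is ∫ f(z) tr(T α_z(S)) dz, so the continuous function tr(T α_z(S)) is
orthogonal to all test functions. -/
theorem opPair_eq_zero_of_compactConv (hS : IsNuclear S)
    (h : ∀ A ∈ compactConv hS, trace (T ∘L A) = 0) (z : PhaseSpace d) : opPair T S z = 0 := by
  have hc := continuous_opPair hS T
  have h1 : ∀ᵐ z, opPair T S z = 0 := by
    refine ae_eq_zero_of_integral_contDiff_smul_eq_zero hc.locallyIntegrable fun g hg hgs => ?_
    have hgc : Continuous fun z => (g z : ℂ) := Complex.continuous_ofReal.comp hg.continuous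
    have hgs' : HasCompactSupport fun z => (g z : ℂ) :=
      hgs.comp_left (g := fun x : ℝ => (x : ℂ)) Complex.ofReal_zero
    have h2 := h _ ⟨_, hgc, hgs', rfl⟩
    rw [trace_comp_funConv_of_integrable hS T (hgc.memLp_of_hasCompactSupport hgs')] at h2
    simpa only [Complex.real_smul] using h2
  exact congrFun ((hc.ae_eq_iff_eq volume continuous_const).mp h1) z

/-- Compactly supported continuous f lie in every L^p and give trace class f ∗ S, so this one
subspace serves all exponents in (5) as well as (ii). -/
theorem OpInjective.exists_compactConv (hp : 1 ≤ p) (hq : 1 ≤ q) (hpq : p⁻¹ + q⁻¹ = 1)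
    (hS : IsNuclear S) (h : OpInjective q S) {A : L2 d →L[ℂ] L2 d} (hA : IsNuclear A)
    {ε : ℝ≥0∞} (hε : 0 < ε) : ∃ B ∈ compactConv hS, pairNorm p (A - B) < ε :=
  exists_mem_pairNorm_sub_lt hp hpq _ (fun _ hB => isNuclear_of_mem_compactConv hS hB)
    (fun T hT h0 => h T ((memSchatten_iff hq T).mpr hT) (opPair_eq_zero_of_compactConv hS h0)) hA hε

theorem memSchatten_funConv (hS : IsNuclear S) (hp : 1 ≤ p) {f : PhaseSpace d → ℂ}
    (hf : MemLp f p volume) : MemSchatten p (funConv f S) :=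
  (memSchatten_iff hp _).mpr ((pairNorm_funConv_le hS hp hf).trans_lt
    (ENNReal.mul_lt_top (isNuclear_iff.mp hS) hf.2))

theorem schattenDense_funConv_iff (hp : 1 ≤ p) (hq : 1 ≤ q) (hpq : p⁻¹ + q⁻¹ = 1)
    (hS : IsNuclear S) :
    SchattenDense p {A | ∃ f : PhaseSpace d → ℂ, MemLp f p volume ∧ A = funConv f S} ↔
      OpInjective q S := by
  have hsub : (compactConv hS : Set (L2 d →L[ℂ] L2 d)) ⊆
      {A | ∃ f : PhaseSpace d → ℂ, MemLp f p volume ∧ A = funConv f S} := by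
    rintro _ ⟨f, hf, hfs, rfl⟩
    exact ⟨f, hf.memLp_of_hasCompactSupport hfs, rfl⟩
  have hmem : ∀ A ∈ {A | ∃ f : PhaseSpace d → ℂ, MemLp f p volume ∧ A = funConv f S},
      MemSchatten p A := by
    rintro _ ⟨f, hf, rfl⟩
    exact memSchatten_funConv hS hp hf
  rcases eq_or_ne p ∞ with rfl | hpt
  · have hq1 : q = 1 := by simpa using hpq
    subst hq1
    refine ⟨fun h T hT h0 => eq_zero_of_trace_comp_rankOne fun x y => ?_, fun h =>
      (schattenDense_top_of_annihilator (compactConv hS) fun T hT h0 =>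
        h T (isNuclear_iff.mp hT) (opPair_eq_zero_of_compactConv hS h0)).mono hsub hmem⟩
    have hTn : IsNuclear T := isNuclear_iff.mpr hT
    have h2 := h.2
    rw [if_pos rfl] at h2
    refine eq_zero_of_forall_enorm_lt fun ε hε => ?_
    obtain ⟨δ, hδ, hδε⟩ := ENNReal.lt_iff_exists_nnreal_btwn.mp hε
    obtain ⟨B, ⟨f, hf, rfl⟩, h3⟩ := h2 (rankOne ℂ x y) {T} (by simpa using hT) δ
      (by exact_mod_cast hδ)
    have h4 := h3 T (Finset.mem_singleton_self T)
    have h5 : trace (T ∘L funConv f S) = 0 := by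
      rw [trace_comp_funConv hTn hS hp hf]
      simp [h0]
    rw [hTn.trace_comp_comm, ContinuousLinearMap.comp_sub,
      (hTn.comp_right _).trace_sub (hTn.comp_right _), h5, sub_zero] at h4
    rw [← ofReal_norm]
    exact (ENNReal.ofReal_lt_iff_lt_toReal (norm_nonneg _) ENNReal.coe_ne_top).mpr h4 |>.trans hδε
  · refine ⟨fun h T hT h0 => eq_zero_of_trace_comp_rankOne fun x y => ?_, fun h =>
      (schattenDense_of_approx hp hpt
        (fun A hA => (isNuclear_of_mem_compactConv hS hA).memSchatten hp)
        fun A hA ε hε => h.exists_compactConv hp hq hpq hS hA hε).mono hsub hmem⟩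
    refine trace_eq_zero_of_pairNorm_approx hp hpt hq hpq hT (IsNuclear.rankOne x y)
      fun ε hε => ?_
    have h2 := h.2
    rw [if_neg hpt] at h2
    -- For f in L^p alone f ∗ S need not be nuclear and the trace formula is unavailable; f is
    -- replaced by a compactly supported g, at a cost bounded by Young's inequality.
    obtain ⟨_, ⟨f, hf, rfl⟩, h3⟩ := h2 _ ((IsNuclear.rankOne x y).memSchatten hp) (ε / 2)
      (ENNReal.half_pos hε.ne')
    obtain ⟨δ, hδ, hδε⟩ := exists_pos_mul_lt (isNuclear_iff.mp hS).ne (ENNReal.half_pos hε.ne')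
    obtain ⟨g, hgs, hfg, hgc, hg⟩ := hf.exists_hasCompactSupport_eLpNorm_sub_le hpt hδ.ne'
    have hg1 : MemLp g 1 volume := hgc.memLp_of_hasCompactSupport hgs
    refine ⟨funConv g S, isNuclear_funConv hS hg1, ?_, ?_⟩
    · rw [trace_comp_funConv_of_integrable hS T hg1]
      simp [h0]
    · rw [← sub_add_sub_cancel _ (funConv f S), ← ENNReal.add_halves ε, ← funConv_sub hS hp hf hg]
      refine (pairNorm_add_le hp _ _).trans_lt (ENNReal.add_lt_add
        ((pairNorm_le_schattenNorm hp _).trans_lt h3) (lt_of_le_of_lt ?_ hδε))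
      exact (pairNorm_funConv_le hS hp (hf.sub hg)).trans (mul_le_mul' le_rfl hfg)

theorem compactDense_funConv_iff (hS : IsNuclear S) :
    CompactDense {A | ∃ f : C₀(PhaseSpace d, ℂ), A = funConv f S} ↔ OpInjective 1 S := by
  refine ⟨fun h T hT h0 => eq_zero_of_trace_comp_rankOne fun x y => ?_, fun h =>
    compactDense_of_approx ?_ fun A hA ε hε => ?_⟩
  · have hTn : IsNuclear T := isNuclear_iff.mpr hT
    refine trace_eq_zero_of_norm_approx hTn fun ε hε => ?_
    obtain ⟨_, ⟨f, rfl⟩, h3⟩ := h.exists_enorm_sub_lt (IsNuclear.rankOne x y).isCompactOperator hε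
    refine ⟨funConv f S, ?_, h3⟩
    rw [trace_comp_funConv hTn hS le_top (memLp_top_of_zeroAtInfty f)]
    simp [h0]
  · rintro _ ⟨f, rfl⟩
    exact isCompactOperator_funConv hS f
  · obtain ⟨_, ⟨f, hf, hfs, rfl⟩, h3⟩ := h.exists_compactConv (p := ∞) le_top le_rfl (by simp) hS hA hε
    exact ⟨_, ⟨⟨⟨f, hf⟩, hfs.is_zero_at_infty⟩, rfl⟩, (enorm_le_pairNorm le_top _).trans_lt h3⟩

end OperatorDensity

/-! ### Commuting convolutions; function against operator injectivity -/

section Exchange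

variable {d : ℕ} {S T A : L2 d →L[ℂ] L2 d} {p q : ℝ≥0∞}

theorem opPair_add_right {S₁ S₂ : L2 d →L[ℂ] L2 d} (h₁ : IsNuclear S₁) (h₂ : IsNuclear S₂)
    (T : L2 d →L[ℂ] L2 d) : opPair T (S₁ + S₂) = opPair T S₁ + opPair T S₂ := by
  ext z
  rw [opPair, opShift_add, ContinuousLinearMap.comp_add]
  exact ((h₁.shift z).comp_left T).trace_add ((h₂.shift z).comp_left T)

theorem opPair_smul_right (c : ℂ) (T S : L2 d →L[ℂ] L2 d) :
    opPair T (c • S) = c • opPair T S := by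
  ext z
  rw [opPair, opShift_smul, ContinuousLinearMap.comp_smul, trace_smul]
  rfl

theorem opCheck_add (S₁ S₂ : L2 d →L[ℂ] L2 d) : opCheck (S₁ + S₂) = opCheck S₁ + opCheck S₂ := by
  rw [opCheck, ContinuousLinearMap.add_comp, ContinuousLinearMap.comp_add]
  rfl

theorem opCheck_smul (c : ℂ) (S : L2 d →L[ℂ] L2 d) : opCheck (c • S) = c • opCheck S := by
  rw [opCheck, ContinuousLinearMap.smul_comp, ContinuousLinearMap.comp_smul]
  rfl

theorem eLpNorm_opPair_le_pairNorm (hS : IsNuclear S) (hp : 1 ≤ p) (T : L2 d →L[ℂ] L2 d) :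
    eLpNorm (opPair T S) p volume ≤ (4 * pairNorm 1 S) * (4 * pairNorm p T) :=
  (eLpNorm_opPair_le hS hp T).trans
    (mul_le_mul' (schattenNorm_le_pairNorm le_rfl S) (schattenNorm_le_pairNorm hp T))

/-- A bounded functional on the trace class that vanishes on the translates of the Gaussian
projection is zero. -/
theorem eq_zero_of_shift_gaussOp (δ : (L2 d →L[ℂ] L2 d) → ℂ)
    (hadd : ∀ A B, IsNuclear A → IsNuclear B → δ (A + B) = δ A + δ B)
    (hsmul : ∀ (c : ℂ) A, IsNuclear A → δ (c • A) = c * δ A) {C : ℝ≥0∞} (hC : C ≠ ∞)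
    (hb : ∀ A, IsNuclear A → ‖δ A‖ₑ ≤ C * pairNorm 1 A)
    (h0 : ∀ z, δ (opShift z (gaussOp d)) = 0) (hA : IsNuclear A) : δ A = 0 := by
  have hG : IsNuclear (gaussOp d) := isNuclear_gaussOp
  have h1 : ∀ B ∈ shiftSpan (gaussOp d), δ B = 0 := by
    intro B hB
    induction hB using Submodule.span_induction with
    | mem x hx => obtain ⟨z, rfl⟩ := hx; exact h0 z
    | zero => simpa using hsmul 0 _ hG
    | add x y hx hy h1 h2 =>
      rw [hadd x y (isNuclear_of_mem_shiftSpan hG hx) (isNuclear_of_mem_shiftSpan hG hy), h1, h2,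
        add_zero]
    | smul c x hx h1 => rw [hsmul c x (isNuclear_of_mem_shiftSpan hG hx), h1, mul_zero]
  refine eq_zero_of_forall_enorm_lt fun ε hε => ?_
  obtain ⟨η, hη, hηε⟩ := exists_pos_mul_lt hC hε
  obtain ⟨B, hB, hAB⟩ := exists_shiftSpan_gaussOp le_rfl hA hη
  have hBn := isNuclear_of_mem_shiftSpan hG hB
  have e : δ A = δ (A - B) := by
    rw [← sub_add_cancel A B, hadd _ _ (hA.sub hBn) hBn, h1 B hB, add_zero, sub_add_cancel]
  rw [e]
  exact ((hb _ (hA.sub hBn)).trans (mul_le_mul' le_rfl hAB.le)).trans_lt hηε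

theorem integrable_opPair_mul_opPair (hS : IsNuclear S) (hA : IsNuclear A) {R : L2 d →L[ℂ] L2 d}
    (hR : IsNuclear R) (T : L2 d →L[ℂ] L2 d) :
    Integrable (fun z => opPair T S z * opPair A R z) volume :=
  integrable_mul_of_memLp (memLp_opPair_of_isNuclear hS T)
    (memLp_opPair hR le_rfl (isNuclear_iff.mp hA)) (by simp)

theorem enorm_integral_opPair_mul_le (hS : IsNuclear S) (hA : IsNuclear A)
    {R : L2 d →L[ℂ] L2 d} (hR : IsNuclear R) (T : L2 d →L[ℂ] L2 d) :
    ‖∫ z, opPair T S z * opPair A R z‖ₑ ≤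
      (4 * pairNorm 1 S) * (4 * ‖T‖ₑ) * ((4 * pairNorm 1 R) * (4 * pairNorm 1 A)) := by
  refine (enorm_integral_mul_le (p := 1) (q := ∞) (memLp_opPair_of_isNuclear hS T)
    (memLp_opPair hR le_rfl (isNuclear_iff.mp hA)) (by simp)).trans ?_
  refine mul_le_mul' ((eLpNorm_opPair_le_pairNorm hS le_top T).trans ?_)
    (eLpNorm_opPair_le_pairNorm hR le_rfl A)
  exact mul_le_mul' le_rfl (mul_le_mul' le_rfl (pairNorm_top_le T))

/-- Between translates of G the commutation relation is the substitution z ↦ z + s. -/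
theorem integral_opPair_exchange_shift (T : L2 d →L[ℂ] L2 d) (a s : PhaseSpace d) :
    ∫ z, opPair T (gaussOp d) z * opPair (opShift a (gaussOp d)) (opShift s (gaussOp d)) z =
      ∫ z, opPair T (opCheck (opShift s (gaussOp d))) z *
        opPair (opShift a (gaussOp d)) (gaussOp d) z := by
  have _ : (volume : Measure (PhaseSpace d)).IsAddRightInvariant :=
    inferInstanceAs (Measure.prod volume volume).IsAddRightInvariant
  rw [opCheck_opShift, opCheck_gaussOp, ← integral_add_right_eq_self (fun z =>
    opPair T (opShift (-s) (gaussOp d)) z * opPair (opShift a (gaussOp d)) (gaussOp d) z) s]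
  refine integral_congr_ae (Filter.Eventually.of_forall fun z => ?_)
  beta_reduce
  rw [opPair_opShift_right, opPair_opShift_right, add_neg_cancel_right]

/-- The commutation relation between convolutions with two trace class operators. -/
theorem integral_opPair_exchange (hA : IsNuclear A) (hS : IsNuclear S) (T : L2 d →L[ℂ] L2 d) :
    ∫ z, opPair T (gaussOp d) z * opPair A S z =
      ∫ z, opPair T (opCheck S) z * opPair A (gaussOp d) z := by
  have hG : IsNuclear (gaussOp d) := isNuclear_gaussOp
  have hfin : ∀ {R : L2 d →L[ℂ] L2 d}, IsNuclear R → pairNorm 1 R ≠ ∞ :=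
    fun hR => (hR.pairNorm_lt_top le_rfl).ne
  have h4 : (4 : ℝ≥0∞) ≠ ∞ := by norm_num
  -- First stage: the second operator is a translate of G. The difference of the two sides is a
  -- functional of B bounded in the trace norm, so it is enough to test B on translates of G.
  have h1 : ∀ s (B : L2 d →L[ℂ] L2 d), IsNuclear B →
      ∫ z, opPair T (gaussOp d) z * opPair B (opShift s (gaussOp d)) z =
      ∫ z, opPair T (opCheck (opShift s (gaussOp d))) z * opPair B (gaussOp d) z := by
    intro s B hB
    have hGs := hG.shift s
    rw [← sub_eq_zero]
    refine eq_zero_of_shift_gaussOp (fun B =>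
      (∫ z, opPair T (gaussOp d) z * opPair B (opShift s (gaussOp d)) z) -
      ∫ z, opPair T (opCheck (opShift s (gaussOp d))) z * opPair B (gaussOp d) z)
      (C := (4 * pairNorm 1 (gaussOp d)) * (4 * ‖T‖ₑ) *
          ((4 * pairNorm 1 (opShift s (gaussOp d))) * 4) +
        (4 * pairNorm 1 (opCheck (opShift s (gaussOp d)))) * (4 * ‖T‖ₑ) *
          ((4 * pairNorm 1 (gaussOp d)) * 4))
      (fun B B' hB hB' => ?_) (fun c B hB => ?_) ?_ (fun B hB => ?_) (fun a => ?_) hB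
    · rw [opPair_add_left hGs, opPair_add_left hG]
      simp only [Pi.add_apply, mul_add]
      rw [integral_add (integrable_opPair_mul_opPair hG hB hGs T) (integrable_opPair_mul_opPair hG hB' hGs T),
        integral_add (integrable_opPair_mul_opPair hGs.check hB hG T)
          (integrable_opPair_mul_opPair hGs.check hB' hG T)]
      ring
    · rw [opPair_smul_left, opPair_smul_left]
      simp only [Pi.smul_apply, smul_eq_mul, mul_left_comm _ c]
      rw [integral_const_mul, integral_const_mul, mul_sub]
    · have := hfin hG
      have := hfin hGs
      have := hfin hGs.check
      have : ‖T‖ₑ ≠ ∞ := enorm_ne_top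
      exact ENNReal.add_ne_top.mpr ⟨by simp_all [ENNReal.mul_eq_top], by simp_all [ENNReal.mul_eq_top]⟩
    · refine enorm_sub_le.trans ?_
      rw [add_mul]
      refine add_le_add ((enorm_integral_opPair_mul_le hG hB hGs T).trans_eq (by ring))
        ((enorm_integral_opPair_mul_le hGs.check hB hG T).trans_eq (by ring))
    · exact sub_eq_zero.mpr (integral_opPair_exchange_shift T a s)
  rw [← sub_eq_zero]
  -- Second stage: A is fixed and arbitrary, and the difference is now a bounded functional of S,
  -- vanishing on translates of G by the first stage.
  refine eq_zero_of_shift_gaussOp (fun S =>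
    (∫ z, opPair T (gaussOp d) z * opPair A S z) -
    ∫ z, opPair T (opCheck S) z * opPair A (gaussOp d) z)
    (C := (4 * pairNorm 1 (gaussOp d)) * (4 * ‖T‖ₑ) * (4 * (4 * pairNorm 1 A)) +
      4 * (4 * ‖T‖ₑ) * ((4 * pairNorm 1 (gaussOp d)) * (4 * pairNorm 1 A)))
    (fun S S' hS hS' => ?_) (fun c S hS => ?_) ?_ (fun S hS => ?_)
    (fun s => sub_eq_zero.mpr (h1 s A hA)) hS
  · rw [opPair_add_right hS hS', opCheck_add, opPair_add_right hS.check hS'.check]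
    simp only [Pi.add_apply, mul_add, add_mul]
    rw [integral_add (integrable_opPair_mul_opPair hG hA hS T) (integrable_opPair_mul_opPair hG hA hS' T),
      integral_add (integrable_opPair_mul_opPair hS.check hA hG T)
        (integrable_opPair_mul_opPair hS'.check hA hG T)]
    ring
  · rw [opPair_smul_right, opCheck_smul, opPair_smul_right]
    simp only [Pi.smul_apply, smul_eq_mul, mul_left_comm _ c, mul_assoc]
    rw [integral_const_mul, integral_const_mul, mul_sub]
  · have := hfin hG
    have := hfin hA
    have : ‖T‖ₑ ≠ ∞ := enorm_ne_top
    exact ENNReal.add_ne_top.mpr ⟨by simp_all [ENNReal.mul_eq_top], by simp_all [ENNReal.mul_eq_top]⟩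
  · refine enorm_sub_le.trans ?_
    rw [add_mul]
    refine add_le_add ((enorm_integral_opPair_mul_le hG hA hS T).trans_eq (by ring))
      ((enorm_integral_opPair_mul_le hS.check hA hG T).trans_eq ?_)
    rw [pairNorm_opCheck]
    ring

/-- If f ∗ S = 0 then (f ∗ G) ∗ S = (f ∗ S) ∗ G = 0, tested on translates. As f ∗ G lies in 𝒯^q,
injectivity of S gives f ∗ G = 0, and injectivity of G on functions gives f = 0. -/
theorem OpInjective.funInjective (hq : 1 ≤ q) (hS : IsNuclear S) (h : OpInjective q S) :
    FunInjective q S := by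
  intro f hf h0
  have hG : IsNuclear (gaussOp d) := isNuclear_gaussOp
  refine gaussOp_convolution_injective hq hf (h.opCheck hq hS _ (memSchatten_funConv hG hq hf)
    fun w => ?_)
  have hw := hS.check.shift w
  rw [opPair, hw.trace_comp_comm, trace_comp_funConv hw hG hq hf]
  have e : opPair (opShift w (QHA.opCheck S)) (gaussOp d) = opPair (opShift w (gaussOp d)) S := by
    rw [← opPair_opShift_gaussOp_opCheck hS.check, opCheck_opCheck]
  rw [e, ← trace_comp_funConv (hG.shift w) hS hq hf, h0, ContinuousLinearMap.comp_zero, trace_zero]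

/-- If T ∗ S = 0, then f = T ∗ G lies in L^q and f ∗ S = (T ∗ S) ∗ G = 0 by
`integral_opPair_exchange`, read off on rank-one operators. Hence T ∗ G = 0 and T = 0. -/
theorem FunInjective.opInjective (hq : 1 ≤ q) (hS : IsNuclear S) (h : FunInjective q S) :
    OpInjective q S := by
  have hG : IsNuclear (gaussOp d) := isNuclear_gaussOp
  rw [← opInjective_opCheck_iff hq hS]
  intro T hT h0
  have hm := memLp_opPair hG hq hT
  have h1 : funConv (opPair T (gaussOp d)) S = 0 := by
    refine eq_zero_of_trace_comp_rankOne fun x y => ?_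
    have hxy : IsNuclear (rankOne ℂ x y : L2 d →L[ℂ] L2 d) := IsNuclear.rankOne x y
    rw [hxy.trace_comp_comm, trace_comp_funConv hxy hS hq hm, integral_opPair_exchange hxy hS]
    simp [h0]
  have h2 := h _ hm h1
  exact eq_zero_of_opPair_gaussOp fun z =>
    congrFun (((continuous_opPair hG T).ae_eq_iff_eq volume continuous_const).mp h2) z

theorem funInjective_iff (hq : 1 ≤ q) (hS : IsNuclear S) : FunInjective q S ↔ OpInjective q S :=
  ⟨FunInjective.opInjective hq hS, OpInjective.funInjective hq hS⟩

end Exchange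

/-! ### Function-side conditions -/

section FunctionEquivalences

variable {d : ℕ} {S T : L2 d →L[ℂ] L2 d} {p q : ℝ≥0∞}

theorem ae_eq_zero_opConv_iff (hq : 1 ≤ q) (hS : IsNuclear S) :
    (∀ T : L2 d →L[ℂ] L2 d, MemSchatten q T → opConv T S =ᵐ[volume] 0 → T = 0) ↔
      OpInjective q S := by
  rw [← opInjective_opCheck_iff hq hS]
  refine forall₂_congr fun T _ => imp_congr_left ?_
  rw [opConv_eq_opPair, (continuous_opPair hS.check T).ae_eq_iff_eq volume (g := 0) continuous_zero,
    funext_iff]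
  rfl

theorem opInjective_of_integral_opPair (hq : 1 ≤ q) (hS : IsNuclear S)
    (h : ∀ f : PhaseSpace d → ℂ, MemLp f q volume → funConv f (opCheck S) = 0 →
      f =ᵐ[volume] 0) : OpInjective q S :=
  (opInjective_opCheck_iff hq hS).mp (FunInjective.opInjective hq hS.check h)

/-- An f with f ∗ (PSP) = 0 annihilates all T ∗ S, so density forces injectivity. Conversely,
combinations of translates of S ∗ S already approximate every Gaussian wave. -/
theorem lpDense_opConv_iff (hp : 1 ≤ p) (hq : 1 ≤ q) (hpq : p⁻¹ + q⁻¹ = 1) (hS : IsNuclear S) :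
    LpDense p {g | ∃ T : L2 d →L[ℂ] L2 d, MemSchatten p T ∧ g = opConv T S} ↔
      OpInjective q S := by
  refine ⟨fun h => opInjective_of_integral_opPair hq hS fun f hf h0 =>
    h.ae_eq_zero hp hq hpq hf ?_, fun h =>
      (lpDense_of_phaseWave_mem hp (fun k hk => memLp_of_mem_pairSpan hp hS hS.check hk)
        (phaseWave_mem_lpClosure hp hq hpq hS hS h h)).mono ?_ ?_⟩
  · rintro _ ⟨T, hT, rfl⟩
    exact integral_mul_opPair_eq_zero hp hq hpq hS.check hf h0 hT
  · intro g hg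
    obtain ⟨A, hA, rfl⟩ := (mem_pairSpan_iff hS.check).mp hg
    exact ⟨A, (isNuclear_of_mem_shiftSpan hS hA).memSchatten hp, rfl⟩
  · rintro _ ⟨T, hT, rfl⟩
    exact memLp_opPair hS.check hp hT

theorem isRegularFun_opConv_iff (hS : IsNuclear S) (T : L2 d →L[ℂ] L2 d) :
    IsRegularFun p (opConv T S) ↔ LpDense p (pairSpan T (opCheck S) : Set (PhaseSpace d → ℂ)) := by
  have e : (fun z w : PhaseSpace d => opConv T S (w - z)) =
      fun z => opPair (opShift z T) (opCheck S) :=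
    funext fun z => funext fun w => (opPair_opShift_left hS.check T z w).symm
  rw [IsRegularFun, e, pairSpan]

theorem isRegularFun_opConv (hp : 1 ≤ p) (hq : 1 ≤ q) (hpq : p⁻¹ + q⁻¹ = 1) (hS : IsNuclear S)
    (hT : IsNuclear T) (hTi : OpInjective q T) (hSi : OpInjective q S) :
    IsRegularFun p (opConv T S) :=
  (isRegularFun_opConv_iff hS T).mpr
    (lpDense_of_phaseWave_mem hp (fun _ hk => memLp_of_mem_pairSpan hp hT hS.check hk)
      (phaseWave_mem_lpClosure hp hq hpq hT hS hTi hSi))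

theorem opInjective_of_isRegularFun (hp : 1 ≤ p) (hq : 1 ≤ q) (hpq : p⁻¹ + q⁻¹ = 1)
    (hS : IsNuclear S) (hT : IsNuclear T) (h : IsRegularFun p (opConv T S)) :
    OpInjective q S := by
  rw [isRegularFun_opConv_iff hS] at h
  refine opInjective_of_integral_opPair hq hS fun f hf h0 => h.ae_eq_zero hp hq hpq hf fun g hg => ?_
  obtain ⟨A, hA, rfl⟩ := (mem_pairSpan_iff hS.check).mp hg
  exact integral_mul_opPair_eq_zero hp hq hpq hS.check hf h0
    ((isNuclear_of_mem_shiftSpan hT hA).memSchatten hp)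

/-- Every Schatten class consists of bounded operators, so injectivity for q = ∞ is the strongest;
this is why 1-regular operators T₀ serve for every p in (7). -/
theorem OpInjective.of_top (h : OpInjective ∞ S) (q : ℝ≥0∞) :
    OpInjective q S :=
  fun T _ => h T ((memSchatten_iff le_top T).mpr ((pairNorm_top_le T).trans_lt enorm_lt_top))

theorem norm_le_of_eLpNorm_top_lt {f : PhaseSpace d → ℂ} (hf : Continuous f) {ε : ℝ}
    (h : eLpNorm f ∞ volume < ENNReal.ofReal ε) (z : PhaseSpace d) : ‖f z‖ ≤ ε := by
  have h1 : ∀ᵐ z, ‖f z‖ₑ ≤ eLpNorm f ∞ volume := by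
    rw [eLpNorm_exponent_top]
    exact enorm_ae_le_eLpNormEssSup f volume
  have h2 : ∀ᵐ z, z ∈ {z | ‖f z‖ ≤ ε} := by
    filter_upwards [h1] with z hz
    have hz := hz.trans_lt h
    rw [← ofReal_norm] at hz
    exact (ENNReal.ofReal_lt_ofReal_iff_of_nonneg (norm_nonneg _)).mp hz |>.le
  have hc : IsClosed {z | ‖f z‖ ≤ ε} := isClosed_le hf.norm continuous_const
  have h3 := hc.ae_eq_univ_iff_eq.mp (Filter.eventuallyEq_univ.mpr h2)
  exact Set.eq_univ_iff_forall.mp h3 z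

theorem continuous_of_mem_span_phaseWave {k : PhaseSpace d → ℂ}
    (hk : k ∈ Submodule.span ℂ (Set.range fun ξ : PhaseSpace d => phaseWave ξ)) :
    Continuous k := by
  induction hk using Submodule.span_induction with
  | mem x hx => obtain ⟨ξ, rfl⟩ := hx; exact continuous_phaseWave ξ
  | zero => exact continuous_const
  | add x y _ _ hx hy => exact hx.add hy
  | smul c x _ hx => exact hx.const_smul c

theorem cZeroDense_opConv_iff (hS : IsNuclear S) :
    CZeroDense {g | ∃ K : L2 d →L[ℂ] L2 d, IsCompactOperator K ∧ g = opConv K S} ↔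
      OpInjective 1 S := by
  have hC : ∀ K : L2 d →L[ℂ] L2 d, IsCompactOperator K →
      ∃ u : C₀(PhaseSpace d, ℂ), ⇑u = opConv K S := fun K hK =>
    ⟨⟨⟨opPair K (opCheck S), continuous_opPair hS.check K⟩, tendsto_opPair hK hS.check⟩, rfl⟩
  have h11 : (∞ : ℝ≥0∞)⁻¹ + 1⁻¹ = 1 := by simp
  refine ⟨fun h => opInjective_of_integral_opPair le_rfl hS fun f hf h0 =>
    ae_eq_zero_of_integral_phaseWave le_rfl hf fun ξ => ?_, fun h => ⟨?_, ?_⟩⟩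
  · let v : C₀(PhaseSpace d, ℂ) := ⟨⟨phaseWave ξ, continuous_phaseWave ξ⟩, by
      refine tendsto_zero_iff_norm_tendsto_zero.mpr ?_
      simpa only [ContinuousMap.coe_mk, norm_phaseWave] using tendsto_phaseGauss Real.pi_pos⟩
    refine integral_mul_eq_zero_of_approx hf (memLp_phaseWave ξ le_top) h11 fun ε hε => ?_
    obtain ⟨δ, hδ, hδε⟩ := ENNReal.lt_iff_exists_nnreal_btwn.mp hε
    obtain ⟨u, hu, huv⟩ := Metric.dense_iff.mp h.2 v δ (by exact_mod_cast hδ)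
    obtain ⟨K, hK, huK⟩ := huv
    have hKs : MemSchatten ∞ K :=
      (memSchatten_iff le_top K).mpr ((pairNorm_top_le K).trans_lt enorm_lt_top)
    refine ⟨u, memLp_top_of_zeroAtInfty u, ?_, ?_⟩
    · rw [huK]
      exact integral_mul_opPair_eq_zero le_top le_rfl h11 hS.check hf h0 hKs
    · rw [eLpNorm_exponent_top]
      refine (essSup_le_of_ae_le (δ : ℝ≥0∞) (Filter.Eventually.of_forall fun z => ?_)).trans_lt hδε
      beta_reduce
      have h3 : ‖phaseWave ξ z - u z‖ ≤ δ := by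
        have h4 := (v - u).toBCF.norm_coe_le_norm z
        rw [mem_ball_iff_norm, ← norm_neg, neg_sub] at hu
        exact h4.trans hu.le
      rw [Pi.sub_apply, ← ofReal_norm]
      exact ENNReal.ofReal_le_of_le_toReal h3
  · rintro _ ⟨K, hK, rfl⟩
    exact hC K hK
  · rw [Metric.dense_iff]
    intro u ε hε
    have hε3 : 0 < ε / 3 := by positivity
    have hD : ∀ k ∈ pairSpan S (opCheck S), MemLp k ∞ volume :=
      fun k hk => memLp_of_mem_pairSpan le_top hS hS.check hk
    -- Two approximations of size ε/3 each: u by a combination k of waves, then k in the L^∞ norm by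
    -- A ∗ S with A nuclear. By continuity the latter is a pointwise bound.
    obtain ⟨k, hk, huk⟩ := exists_phaseWave_norm_sub_lt u hε3
    have hkc : Continuous k := continuous_of_mem_span_phaseWave hk
    have hk' : k ∈ lpClosure ∞ (pairSpan S (opCheck S) : Set (PhaseSpace d → ℂ)) := by
      refine span_le_lpClosure le_top hD ?_ hk
      rintro _ ⟨ξ, rfl⟩
      exact phaseWave_mem_lpClosure le_top le_rfl h11 hS hS h h ξ
    obtain ⟨g, hg, hkg⟩ := hk'.2 (ENNReal.ofReal (ε / 3)) (by simpa using hε)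
    obtain ⟨A, hA, rfl⟩ := (mem_pairSpan_iff hS.check).mp hg
    have hAc := (isNuclear_of_mem_shiftSpan hS hA).isCompactOperator
    obtain ⟨w, hw⟩ := hC A hAc
    refine ⟨w, ?_, A, hAc, hw⟩
    rw [Metric.mem_ball, dist_comm, dist_eq_norm]
    refine lt_of_le_of_lt (b := ε / 3 + ε / 3) ?_ (by linarith)
    refine BoundedContinuousFunction.norm_le (f := (u - w).toBCF) (by positivity) |>.mpr fun z => ?_
    have h5 := norm_le_of_eLpNorm_top_lt (hkc.sub (continuous_opPair hS.check A)) hkg z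
    have h6 : w z = opPair A (opCheck S) z := congrFun hw z
    change ‖u z - w z‖ ≤ _
    rw [h6, ← sub_add_sub_cancel (u z) (k z)]
    exact (norm_add_le _ _).trans (add_le_add (huk z) h5)

end FunctionEquivalences

end QHA

end

/-! ### The main theorem -/

theorem mainTheorem2 (d : ℕ) (p q : ℝ≥0∞) (hp : 1 ≤ p) (hpq : p⁻¹ + q⁻¹ = 1) :
    (∀ S : QHA.L2 d →L[ℂ] QHA.L2 d, QHA.MemSchatten 1 S →
      -- the convolution of an `L^p`- or `L^q`-function with `S` is well defined
      (∀ f : QHA.PhaseSpace d → ℂ, MemLp f p volume ∨ MemLp f q volume →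
        ∃ A, QHA.IsWeakIntegral (fun z => f z • QHA.opShift z S) A) ∧
      List.TFAE [
        QHA.IsRegularOp p S,
        ∀ f : QHA.PhaseSpace d → ℂ, MemLp f q volume → QHA.funConv f S = 0 → f =ᵐ[volume] 0,
        QHA.LpDense p {g | ∃ T : QHA.L2 d →L[ℂ] QHA.L2 d,
          QHA.MemSchatten p T ∧ g = QHA.opConv T S},
        ∀ T : QHA.L2 d →L[ℂ] QHA.L2 d, QHA.MemSchatten q T →
          QHA.opConv T S =ᵐ[volume] 0 → T = 0,
        QHA.SchattenDense p {A | ∃ f : QHA.PhaseSpace d → ℂ,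
          MemLp f p volume ∧ A = QHA.funConv f S},
        QHA.IsRegularFun p (QHA.opConv S S),
        ∀ T₀ : QHA.L2 d →L[ℂ] QHA.L2 d, QHA.MemSchatten 1 T₀ → QHA.IsRegularOp 1 T₀ →
          QHA.IsRegularFun p (QHA.opConv T₀ S)] ∧
      (p = ∞ → List.TFAE [
        QHA.IsRegularOp p S,
        QHA.CZeroDense {g | ∃ K : QHA.L2 d →L[ℂ] QHA.L2 d,
          IsCompactOperator K ∧ g = QHA.opConv K S},
        QHA.CompactDense {A | ∃ f : C₀(QHA.PhaseSpace d, ℂ), A = QHA.funConv f S}])) ∧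
    ∃ S₀ : QHA.L2 d →L[ℂ] QHA.L2 d, QHA.MemSchatten 1 S₀ ∧ QHA.IsRegularOp p S₀ := by
  have hq : 1 ≤ q := by
    rw [← ENNReal.inv_le_one, ← hpq]
    exact le_add_self
  refine ⟨fun S hS1 => ?_, QHA.gaussOp d, QHA.isNuclear_iff.mp QHA.isNuclear_gaussOp,
    (QHA.isRegularOp_iff hp hq hpq QHA.isNuclear_gaussOp).mpr (QHA.opInjective_gaussOp q)⟩
  have hS : QHA.IsNuclear S := QHA.isNuclear_iff.mpr hS1
  have hG : QHA.IsNuclear (QHA.gaussOp d) := QHA.isNuclear_gaussOp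
  refine ⟨fun f hf => hf.elim (QHA.exists_isWeakIntegral hS hp) (QHA.exists_isWeakIntegral hS hq),
    ?_, ?_⟩
  · have h1 := QHA.isRegularOp_iff hp hq hpq hS
    tfae_have 1 ↔ 2 := h1.trans (QHA.funInjective_iff hq hS).symm
    tfae_have 1 ↔ 3 := h1.trans (QHA.lpDense_opConv_iff hp hq hpq hS).symm
    tfae_have 1 ↔ 4 := h1.trans (QHA.ae_eq_zero_opConv_iff hq hS).symm
    tfae_have 1 ↔ 5 := h1.trans (QHA.schattenDense_funConv_iff hp hq hpq hS).symm
    tfae_have 1 → 6 := fun h =>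
      QHA.isRegularFun_opConv hp hq hpq hS hS (h1.mp h) (h1.mp h)
    tfae_have 6 → 1 := fun h => h1.mpr (QHA.opInjective_of_isRegularFun hp hq hpq hS hS h)
    tfae_have 1 → 7 := fun h T₀ hT₀ hreg => by
      have hT : QHA.IsNuclear T₀ := QHA.isNuclear_iff.mpr hT₀
      exact QHA.isRegularFun_opConv hp hq hpq hS hT
        (((QHA.isRegularOp_iff le_rfl le_top (by simp) hT).mp hreg).of_top q) (h1.mp h)
    -- The Gaussian operator is regular, so it is an admissible T₀.
    tfae_have 7 → 1 := fun h => h1.mpr (QHA.opInjective_of_isRegularFun hp hq hpq hS hG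
      (h _ (QHA.isNuclear_iff.mp hG) ((QHA.isRegularOp_iff le_rfl le_top (by simp) hG).mpr
        (QHA.opInjective_gaussOp ∞))))
    tfae_finish
  · rintro rfl
    have hq1 : q = 1 := by simpa using hpq
    subst hq1
    have h1 := QHA.isRegularOp_iff hp hq hpq hS
    tfae_have 1 ↔ 2 := h1.trans (QHA.cZeroDense_opConv_iff hS).symm
    tfae_have 1 ↔ 3 := h1.trans (QHA.compactDense_funConv_iff hS).symm
    tfae_finish
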